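/- Let $\lambda_1,\lambda_2,\lambda_3,p\in\mathbb R$ with $\lambda_3>0$ and $p\in(4,6]$. Write $\widehat f(\xi)=\int_{\mathbb R^3}f(x)e^{-ix\cdot\xi}\,dx$ and $\widehat K(\xi)=\frac{4\pi}{3}\,\frac{2\xi_3^2-\xi_1^2-\xi_2^2}{|\xi|^2}$, the Fourier transform of the dipolar kernel $K(x)=\frac{x_1^2+x_2^2-2x_3^2}{|x|^5}$. For $u\in H^1(\mathbb R^3;\mathbb C)$ consider the energy of the extended dipolar Gross–Pitaevskii equation without external potential, $$E(u)=\frac12\|\nabla u\|_2^2+\frac12\,\frac1{(2\pi)^3}\int_{\mathbb R^3}\big(\lambda_1+\lambda_2\widehat K(\xi)\big)\,\big|\widehat{|u|^2}(\xi)\big|^2\,d\xi+\frac2p\,\lambda_3\|u\|_p^p .$$ For $c>0$ let $S(c)=\{u\in H^1(\mathbb R^3;\mathbb C):\|u\|_2^2=c\}$ and $\gamma(c)=\inf_{u\in S(c)}E(u)$, and let $c_b=\sup\{c>0:\gamma(c)=0\}$ (a priori possibly infinite). A minimizer of $E$ on $S(c)$ is a $u\in S(c)$ with $E(u)\le E(v)$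 for all $v\in S(c)$. 1. Assume that either $\lambda_2\ge 0$ and $\lambda_1-\frac{4\pi}{3}\lambda_2\ge 0$, or $\lambda_2<0$ and $\lambda_1+\frac{8\pi}{3}\lambda_2\ge 0$. Then for every $c\in(0,\infty)$ we have $E(u)>0$ for all $u\in S(c)$ and $\gamma(c)=0$, and $E$ has no minimizer on $S(c)$. 2. Assume that either $\lambda_2\ge 0$ and $\lambda_1-\frac{4\pi}{3}\lambda_2<0$, or $\lambda_2<0$ and $\lambda_1+\frac{8\pi}{3}\lambda_2<0$. Then $c_b$ is finite, the supremum is attained, i.e. $c_b=\max\{c>0:\gamma(c)=0\}$, and $c_b>0$. For every $c\in(0,c_b)$ we have $E(u)>0$ for all $u\in S(c)$, and $E$ has no minimizer on $S(c)$. For every $c\in(c_b,\infty)$, $E$ has at least one minimizer on $S(c)$. -/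

import Mathlib

open MeasureTheory
open scoped SchwartzMap LineDeriv FourierTransform

namespace DipolarGP

noncomputable section

/-- Physical space `ℝ³` with its Euclidean norm and Lebesgue measure. -/
abbrev Space : Type := EuclideanSpace ℝ (Fin 3)

/-- The complex Hilbert space `L²(ℝ³; ℂ)`; its elements are classes of a.e. equal functions. -/
abbrev L2 : Type := Lp ℂ 2 (volume : Measure Space)

/-- The `i`-th standard basis vector of `ℝ³`. -/
def basisVec (i : Fin 3) : Space := EuclideanSpace.single i 1

/-- `g` is the `i`-th distributional (weak) partial derivative of `u`. -/
def IsWeakPartial (i : Fin 3) (u g : L2) : Prop :=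
  ∂_{basisVec i} (u : 𝓢'(Space, ℂ)) = (g : 𝓢'(Space, ℂ))

/-- `u` belongs to the Sobolev space `H¹(ℝ³; ℂ)`. -/
def MemH1 (u : L2) : Prop :=
  TemperedDistribution.MemSobolev 1 2 (u : 𝓢'(Space, ℂ))

theorem IsWeakPartial.unique {i : Fin 3} {u g h : L2}
    (hg : IsWeakPartial i u g) (hh : IsWeakPartial i u h) : g = h := by
  have hker := Lp.ker_toTemperedDistributionCLM_eq_bot (E := Space) (F := ℂ)
    (μ := volume) (p := 2)
  rw [LinearMap.ker_eq_bot] at hker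
  apply hker
  exact hg.symm.trans hh

theorem MemH1.exists_isWeakPartial {u : L2} (hu : MemH1 u) (i : Fin 3) :
    ∃ g : L2, IsWeakPartial i u g := by
  have h := TemperedDistribution.MemSobolev.lineDerivOp hu (m := basisVec i)
  rw [sub_self, TemperedDistribution.memSobolev_zero_iff] at h
  exact h

open Classical in
/-- The `i`-th weak partial derivative `∂ᵢu ∈ L²` of `u` (it exists and is unique for
`u ∈ H¹`; the value `0` is used if it does not exist in `L²`). -/
def weakPartial (u : L2) (i : Fin 3) : L2 :=
  if h : ∃ g : L2, IsWeakPartial i u g then h.choose else 0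

theorem MemH1.isWeakPartial {u : L2} (hu : MemH1 u) (i : Fin 3) :
    IsWeakPartial i u (weakPartial u i) := by
  have h := hu.exists_isWeakPartial i
  rw [weakPartial, dif_pos h]
  exact h.choose_spec

/-- `H¹` consists of the `L²` functions whose first weak derivatives are in `L²`. -/
theorem memH1_iff (u : L2) : MemH1 u ↔ ∀ i, ∃ g : L2, IsWeakPartial i u g := by
  refine ⟨fun hu i => hu.exists_isWeakPartial i, fun h => ?_⟩
  have h0 : TemperedDistribution.MemSobolev 0 2 (u : 𝓢'(Space, ℂ)) :=
    TemperedDistribution.memSobolev_zero_iff.2 ⟨u, rfl⟩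
  have hdd : ∀ i, TemperedDistribution.MemSobolev (-1) 2
      (∂_{basisVec i} (∂_{basisVec i} (u : 𝓢'(Space, ℂ)))) := by
    intro i
    obtain ⟨g, hg⟩ := h i
    have h1 : TemperedDistribution.MemSobolev 0 2 (∂_{basisVec i} (u : 𝓢'(Space, ℂ))) :=
      TemperedDistribution.memSobolev_zero_iff.2 ⟨g, hg⟩
    simpa using h1.lineDerivOp (m := basisVec i)
  have hlap : TemperedDistribution.MemSobolev (-1) 2 (Laplacian.laplacian (u : 𝓢'(Space, ℂ))) := by
    rw [TemperedDistribution.laplacian_eq_sum (EuclideanSpace.basisFun (Fin 3) ℝ),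
      Fin.sum_univ_three]
    have he : ∀ i, EuclideanSpace.basisFun (Fin 3) ℝ i = basisVec i := fun i => by
      simp [basisVec]
    simp only [he]
    exact ((hdd 0).add (hdd 1)).add (hdd 2)
  have hb : TemperedDistribution.besselPotential Space ℂ 2 (u : 𝓢'(Space, ℂ)) =
      (u : 𝓢'(Space, ℂ)) - (((2 * Real.pi) ^ 2)⁻¹ : ℂ) • Laplacian.laplacian (u : 𝓢'(Space, ℂ)) := by
    have hs : (fun x : Space => (((1 + ‖x‖ ^ 2) ^ ((2 : ℝ) / 2) : ℝ) : ℂ)) =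
        (fun _ => (1 : ℂ)) + fun x => ((‖x‖ ^ 2 : ℝ) : ℂ) := by
      ext x
      simp
    have hm : TemperedDistribution.fourierMultiplierCLM ℂ
        (fun x : Space => ((‖x‖ ^ 2 : ℝ) : ℂ)) (u : 𝓢'(Space, ℂ)) =
        -((((2 * Real.pi) ^ 2)⁻¹ : ℂ) • Laplacian.laplacian (u : 𝓢'(Space, ℂ))) := by
      rw [TemperedDistribution.laplacian_eq_fourierMultiplierCLM]
      ext φ
      simp
    rw [sub_eq_add_neg, ← hm, TemperedDistribution.besselPotential, hs]
    simp only [TemperedDistribution.fourierMultiplierCLM_apply]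
    rw [TemperedDistribution.smulLeftCLM_add (by fun_prop) (by fun_prop)]
    simp
  have h2 : TemperedDistribution.MemSobolev (-1) 2
      (TemperedDistribution.besselPotential Space ℂ 2 (u : 𝓢'(Space, ℂ))) := by
    rw [hb]
    exact (h0.mono (by norm_num)).sub (hlap.smul _)
  rw [TemperedDistribution.memSobolev_besselPotential_iff] at h2
  norm_num at h2
  exact h2

/-- The Fourier transform `f̂(ξ) = ∫ f(x) e^{-i x·ξ} dx`. -/
def fourierHat (f : Space → ℂ) (ξ : Space) : ℂ :=
  ∫ x : Space, f x * Complex.exp (-(Complex.I * ((inner ℝ x ξ : ℝ) : ℂ)))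

/-- The Fourier transform of the dipolar kernel `K(x) = (x₁² + x₂² - 2x₃²)/|x|⁵`, that is
`K̂(ξ) = (4π/3) (2ξ₃² - ξ₁² - ξ₂²)/|ξ|²`; the operator `f ↦ K * f` is the Fourier multiplier
with this symbol. -/
def dipoleHat (ξ : Space) : ℝ :=
  4 * Real.pi / 3 * ((2 * ξ 2 ^ 2 - ξ 0 ^ 2 - ξ 1 ^ 2) / ‖ξ‖ ^ 2)

/-- `A(u) = ‖∇u‖₂²`. -/
def kinetic (u : L2) : ℝ := ∑ i : Fin 3, ‖weakPartial u i‖ ^ 2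

/-- `B(u) = (2π)⁻³ ∫ (l₁ + l₂ K̂(ξ)) |𝓕(|u|²)(ξ)|² dξ`. -/
def interaction (l₁ l₂ : ℝ) (u : L2) : ℝ :=
  1 / (2 * Real.pi) ^ 3 *
    ∫ ξ : Space, (l₁ + l₂ * dipoleHat ξ) *
      ‖fourierHat (fun x => ((‖u x‖ ^ 2 : ℝ) : ℂ)) ξ‖ ^ 2

/-- `C(u) = l₃ ‖u‖_p^p`. -/
def highOrder (l₃ p : ℝ) (u : L2) : ℝ := l₃ * ∫ x : Space, ‖u x‖ ^ p

/-- The energy without external potential, `E(u) = A(u)/2 + B(u)/2 + (2/p) C(u)`. -/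
def energy (l₁ l₂ l₃ p : ℝ) (u : L2) : ℝ :=
  1 / 2 * kinetic u + 1 / 2 * interaction l₁ l₂ u + 2 / p * highOrder l₃ p u

/-- The constraint set `S(c) = {u ∈ H¹(ℝ³; ℂ) : ‖u‖₂² = c}`. -/
def massSphere (c : ℝ) : Set L2 := {u | MemH1 u ∧ ‖u‖ ^ 2 = c}

/-- The infimum `γ(c)` of `E` on `S(c)`, taken in the extended reals. -/
def infEnergy (l₁ l₂ l₃ p c : ℝ) : EReal :=
  ⨅ u ∈ massSphere c, ((energy l₁ l₂ l₃ p u : ℝ) : EReal)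

/-- `u` is a minimizer of `E` on `S(c)`. -/
def IsMinimizer (l₁ l₂ l₃ p c : ℝ) (u : L2) : Prop :=
  u ∈ massSphere c ∧ IsMinOn (energy l₁ l₂ l₃ p) (massSphere c) u

/-- The set `{c > 0 : γ(c) = 0}`. -/
def zeroSet (l₁ l₂ l₃ p : ℝ) : Set ℝ := {c | 0 < c ∧ infEnergy l₁ l₂ l₃ p c = 0}

/-- The critical mass `c_b = sup {c > 0 : γ(c) = 0}`, a priori possibly infinite. -/
def criticalMass (l₁ l₂ l₃ p : ℝ) : EReal :=
  sSup ((fun c : ℝ => (c : EReal)) '' zeroSet l₁ l₂ l₃ p)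

end

end DipolarGP

/-!
Two families of competitors are used. Spreading a function out at fixed mass sends its energy
to zero, so the infimum of the energy on `S(c)` is at most zero (`infEnergy_le_zero`); it therefore
vanishes exactly when the energy is nonnegative on `S(c)`, and it is not attained when the energy is
positive there. Dilating a function, `x ↦ u (x / t)`, multiplies the mass, the interaction (whose
symbol is homogeneous of degree zero) and the term of order `p` by `t ^ 3`, but the kinetic energy
only by `t`. Hence the energy per unit of mass strictly decreases when a function is dilated to a
larger mass (`exists_energy_lt_of_dilate`).

If the symbol `l₁ + l₂ K̂` is nonnegative, the energy is a sum of nonnegative terms and the kinetic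
one is positive. If the symbol is negative along the `ξ₃`-axis or in the plane orthogonal to it,
then squeezing a fixed function in Fourier space towards that set makes its interaction negative; a
small multiple makes the interaction dominate the term of order `p > 4`, and a dilation then makes
the energy negative (`exists_energy_neg`). So the set of `c` with vanishing infimum is bounded. It
contains all small masses by the Sobolev inequality (`exists_energy_nonneg_of_small_mass`), the
energy is positive on `S(c)` for every `c` below one of its elements by the dilation argument, and
it contains its supremum because the energy is continuous along `s ↦ s u` (`sSup_mem_zeroSet`).

Above the supremum the energy takes a negative value on `S(c)`, and the infimum `g < 0` is attained
(`exists_isMinimizer`). The term of order `p > 4` controls the interaction up to a multiple of the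
mass, so a minimizing sequence is bounded in `H¹`; as its energies may be taken below `g / 2 < 0`,
its `L⁴` norms stay away from zero. Since a function in `H¹` is close in `L²` to its averages over
small balls, some average of each member of the sequence is bounded below (`exists_ballAvg_ge`).
After recentring there and passing to a subsequence, the sequence is `w + v n` with `w ≠ 0` and
`v n` weakly null. Mass and energy decouple: the kinetic energy is a Hilbert norm, the
interaction is a bounded quadratic form in the density, and the mixed terms vanish by Rellich's theorem
(`NullSeq.energy_split`). As `E(v n) ≥ (‖v n‖² / c) g` by the dilation argument, the limit gives
`E(w) ≤ (‖w‖² / c) g`. A mass `‖w‖² < c` would allow a dilation of `w` to an element of `S(c)` with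
energy below `g`; so `‖w‖² = c`, and `w` is a minimizer.
-/

namespace DipolarGP

open Filter Topology
open scoped ENNReal NNReal

noncomputable section

/-! ### Weak partial derivatives -/

/-- Weak derivatives tested against Schwartz functions. -/
theorem isWeakPartial_iff {i : Fin 3} {u g : L2} : IsWeakPartial i u g ↔
    ∀ φ : 𝓢(Space, ℂ), ∫ x, (∂_{basisVec i} φ) x * u x = -∫ x, φ x * g x := by
  unfold IsWeakPartial
  rw [DFunLike.ext_iff]
  refine forall_congr' fun φ => ?_
  rw [TemperedDistribution.lineDerivOp_apply_apply, map_neg]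
  simp only [Lp.toTemperedDistribution_apply, smul_eq_mul]
  exact neg_eq_iff_eq_neg

theorem IsWeakPartial.add {i : Fin 3} {u v g h : L2} (hu : IsWeakPartial i u g)
    (hv : IsWeakPartial i v h) : IsWeakPartial i (u + v) (g + h) := by
  have key : ∀ a b : L2, ((a + b : L2) : 𝓢'(Space, ℂ)) = (a : 𝓢'(Space, ℂ)) + b :=
    fun a b => map_add (Lp.toTemperedDistributionCLM ℂ (volume : Measure Space) 2) a b
  unfold IsWeakPartial at *
  rw [key, key, LineDeriv.lineDerivOp_add, hu, hv]

theorem IsWeakPartial.smul {i : Fin 3} {u g : L2} (c : ℂ) (hu : IsWeakPartial i u g) :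
    IsWeakPartial i (c • u) (c • g) := by
  have key : ∀ a : L2, ((c • a : L2) : 𝓢'(Space, ℂ)) = c • (a : 𝓢'(Space, ℂ)) :=
    fun a => map_smul (Lp.toTemperedDistributionCLM ℂ (volume : Measure Space) 2) c a
  unfold IsWeakPartial at *
  rw [key, key, LineDeriv.lineDerivOp_smul, hu]

theorem IsWeakPartial.sub {i : Fin 3} {u v g h : L2} (hu : IsWeakPartial i u g)
    (hv : IsWeakPartial i v h) : IsWeakPartial i (u - v) (g - h) := by
  simpa [sub_eq_add_neg] using hu.add (hv.smul (-1))

theorem memH1_of_isWeakPartial {u : L2} {g : Fin 3 → L2} (h : ∀ i, IsWeakPartial i u (g i)) :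
    MemH1 u := (memH1_iff u).2 fun i => ⟨g i, h i⟩

theorem IsWeakPartial.weakPartial_eq {i : Fin 3} {u g : L2} (h : IsWeakPartial i u g) :
    weakPartial u i = g := by
  have h' : ∃ g : L2, IsWeakPartial i u g := ⟨g, h⟩
  rw [weakPartial, dif_pos h']
  exact h'.choose_spec.unique h

theorem MemH1.sub {u v : L2} (hu : MemH1 u) (hv : MemH1 v) : MemH1 (u - v) :=
  memH1_of_isWeakPartial fun i => (hu.isWeakPartial i).sub (hv.isWeakPartial i)

theorem MemH1.weakPartial_sub {u v : L2} (hu : MemH1 u) (hv : MemH1 v) (i : Fin 3) :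
    weakPartial (u - v) i = weakPartial u i - weakPartial v i :=
  ((hu.isWeakPartial i).sub (hv.isWeakPartial i)).weakPartial_eq

theorem MemH1.smul {u : L2} (hu : MemH1 u) (c : ℂ) : MemH1 (c • u) :=
  memH1_of_isWeakPartial fun i => (hu.isWeakPartial i).smul c

theorem MemH1.weakPartial_smul {u : L2} (hu : MemH1 u) (c : ℂ) (i : Fin 3) :
    weakPartial (c • u) i = c • weakPartial u i :=
  ((hu.isWeakPartial i).smul c).weakPartial_eq

theorem isWeakPartial_toLp (φ : 𝓢(Space, ℂ)) (i : Fin 3) :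
    IsWeakPartial i (φ.toLp 2 volume) ((∂_{basisVec i} φ).toLp 2 volume) := by
  unfold IsWeakPartial
  rw [Lp.toTemperedDistribution_toLp_eq, Lp.toTemperedDistribution_toLp_eq,
    TemperedDistribution.lineDerivOp_toTemperedDistributionCLM_eq]

/-! ### Density of Schwartz functions in `H¹` -/

/-- A Fourier multiplier bounded by `C` has norm at most `C` on `L²`. -/
theorem norm_le_of_fourierMultiplier {m : Space → ℂ} (hm : m.HasTemperateGrowth) {C : ℝ}
    (hC : ∀ x, ‖m x‖ ≤ C) {f w : L2}
    (h : TemperedDistribution.fourierMultiplierCLM ℂ m (f : 𝓢'(Space, ℂ)) = (w : 𝓢'(Space, ℂ))) :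
    ‖w‖ ≤ C * ‖f‖ := by
  let m' : BoundedContinuousFunction Space ℂ :=
    BoundedContinuousFunction.ofNormedAddCommGroup m hm.1.continuous C hC
  have hm' : MemLp m ∞ (volume : Measure Space) := m'.memLp_top
  have hw : 𝓕 w = ((hm'.toLp m) • 𝓕 f : L2) := by
    have hker := Lp.ker_toTemperedDistributionCLM_eq_bot (E := Space) (F := ℂ)
      (μ := volume) (p := 2)
    rw [LinearMap.ker_eq_bot] at hker
    apply hker
    change ((𝓕 w : L2) : 𝓢'(Space, ℂ)) = (((hm'.toLp m) • 𝓕 f : L2) : 𝓢'(Space, ℂ))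
    rw [Lp.toTemperedDistribution_smul_eq hm, ← Lp.fourier_toTemperedDistribution_eq,
      ← Lp.fourier_toTemperedDistribution_eq, ← h,
      TemperedDistribution.fourierMultiplierCLM_apply, FourierTransform.fourier_fourierInv_eq]
  have hC0 : 0 ≤ C := (norm_nonneg _).trans (hC 0)
  rw [← Lp.norm_fourier_eq w, hw, ← Lp.norm_fourier_eq f]
  refine (Lp.norm_smul_le _ _).trans ?_
  gcongr
  rw [Lp.norm_toLp]
  refine ENNReal.toReal_le_of_le_ofReal hC0 ?_
  rw [eLpNorm_exponent_top]
  refine eLpNormEssSup_le_of_ae_bound (Eventually.of_forall hC)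

/-- The inverse Bessel potential of order one is a contraction of `L²`. -/
theorem norm_le_of_bessel {v h : L2}
    (hb : TemperedDistribution.besselPotential Space ℂ 1 (v : 𝓢'(Space, ℂ)) = (h : 𝓢'(Space, ℂ))) :
    ‖v‖ ≤ ‖h‖ := by
  have h1 : TemperedDistribution.besselPotential Space ℂ (-1) (h : 𝓢'(Space, ℂ)) =
      (v : 𝓢'(Space, ℂ)) := by
    rw [← hb, TemperedDistribution.besselPotential_besselPotential_apply]; simp
  have := norm_le_of_fourierMultiplier (m := fun x : Space =>
    (((1 + ‖x‖ ^ 2) ^ ((-1 : ℝ) / 2) : ℝ) : ℂ)) (C := 1) (by fun_prop) ?_ h1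
  · simpa using this
  · intro x
    rw [Complex.norm_real, Real.norm_eq_abs, abs_eq_self.mpr (by positivity)]
    exact Real.rpow_le_one_of_one_le_of_nonpos (by simp) (by norm_num)

/-- A partial derivative composed with the inverse Bessel potential of order one has the bounded
Fourier symbol `2πi ξᵢ (1 + |ξ|²)^(-1/2)`. -/
theorem norm_weakPartial_le_of_bessel {v g h : L2} {i : Fin 3} (hg : IsWeakPartial i v g)
    (hb : TemperedDistribution.besselPotential Space ℂ 1 (v : 𝓢'(Space, ℂ)) = (h : 𝓢'(Space, ℂ))) :
    ‖g‖ ≤ 2 * Real.pi * ‖h‖ := by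
  have h1 : TemperedDistribution.besselPotential Space ℂ (-1) (h : 𝓢'(Space, ℂ)) =
      (v : 𝓢'(Space, ℂ)) := by
    rw [← hb, TemperedDistribution.besselPotential_besselPotential_apply]; simp
  have hm : Function.HasTemperateGrowth (fun x : Space =>
    ((inner ℝ x (basisVec i) * (1 + ‖x‖ ^ 2) ^ ((-1 : ℝ) / 2) : ℝ) : ℂ)) := by fun_prop
  have h2 : TemperedDistribution.fourierMultiplierCLM ℂ
      ((2 * Real.pi * Complex.I : ℂ) • fun x : Space =>
      ((inner ℝ x (basisVec i) * (1 + ‖x‖ ^ 2) ^ ((-1 : ℝ) / 2) : ℝ) : ℂ)) (h : 𝓢'(Space, ℂ)) =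
      (g : 𝓢'(Space, ℂ)) := by
    rw [TemperedDistribution.fourierMultiplierCLM_smul hm]
    rw [smul_apply,
      ← TemperedDistribution.besselPotential_neg_one_lineDerivOp_eq]
    rw [← show _ = _ from hg, ← h1, TemperedDistribution.lineDeriv_eq_fourierMultiplierCLM,
      TemperedDistribution.lineDeriv_eq_fourierMultiplierCLM, TemperedDistribution.besselPotential,
      ContinuousLinearMap.map_smul_of_tower,
      TemperedDistribution.fourierMultiplierCLM_fourierMultiplierCLM_apply
        (by fun_prop) (by fun_prop),
      TemperedDistribution.fourierMultiplierCLM_fourierMultiplierCLM_apply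
        (by fun_prop) (by fun_prop),
      mul_comm (fun x : Space => (((inner ℝ x (basisVec i) : ℝ) : ℂ)))]
  refine norm_le_of_fourierMultiplier ?_ ?_ h2
  · fun_prop
  intro x
  have h₁ : (((1 + ‖x‖ ^ 2) ^ ((-1 : ℝ) / 2)) : ℝ) = (√(1 + ‖x‖ ^ 2))⁻¹ := by
    rw [neg_div, Real.rpow_neg (by positivity), Real.sqrt_eq_rpow]
  have h₂ : |inner ℝ x (basisVec i)| ≤ √(1 + ‖x‖ ^ 2) := by
    refine (abs_real_inner_le_norm _ _).trans ?_
    simp only [basisVec, PiLp.norm_single, norm_one, mul_one]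
    exact Real.le_sqrt_of_sq_le (by linarith)
  rw [Pi.smul_apply, norm_smul, Complex.norm_real, Real.norm_eq_abs, abs_mul, h₁,
    abs_of_nonneg (inv_nonneg.2 (Real.sqrt_nonneg _)), ← div_eq_mul_inv]
  have h₃ : |inner ℝ x (basisVec i)| / √(1 + ‖x‖ ^ 2) ≤ 1 :=
    div_le_one_of_le₀ h₂ (Real.sqrt_nonneg _)
  have h₄ : ‖(2 * Real.pi * Complex.I : ℂ)‖ = 2 * Real.pi := by
    simp [abs_of_pos Real.pi_pos]
  rw [h₄]
  nlinarith [Real.pi_pos]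

/-- Every `u ∈ H¹` is a limit of Schwartz functions, together with its partial derivatives. -/
theorem MemH1.exists_schwartz_tendsto {u : L2} (hu : MemH1 u) :
    ∃ φ : ℕ → 𝓢(Space, ℂ), Tendsto (fun n => ((φ n).toLp 2 volume : L2)) atTop (𝓝 u) ∧
      ∀ i, Tendsto (fun n => ((∂_{basisVec i} (φ n)).toLp 2 volume : L2)) atTop
        (𝓝 (weakPartial u i)) := by
  have hu' : MemH1 u := hu
  obtain ⟨g, hg⟩ : ∃ g : L2, TemperedDistribution.besselPotential Space ℂ 1 (u : 𝓢'(Space, ℂ)) =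
    (g : 𝓢'(Space, ℂ)) := hu'
  have hdense : DenseRange (SchwartzMap.toLpCLM ℝ (E := Space) ℂ 2 volume) :=
    SchwartzMap.denseRange_toLpCLM (by simp)
  obtain ⟨s, hs, hlim⟩ := mem_closure_iff_seq_limit.1 (hdense g)
  choose ψ hψ using hs
  have hm : Function.HasTemperateGrowth (fun x : Space =>
    (((1 + ‖x‖ ^ 2) ^ ((-1 : ℝ) / 2) : ℝ) : ℂ)) := by fun_prop
  let φ : ℕ → 𝓢(Space, ℂ) := fun n => SchwartzMap.fourierMultiplierCLM ℂ
    (fun x : Space => (((1 + ‖x‖ ^ 2) ^ ((-1 : ℝ) / 2) : ℝ) : ℂ)) (ψ n)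
  have hb : ∀ n, TemperedDistribution.besselPotential Space ℂ 1
      ((((φ n).toLp 2 volume : L2) - u : L2) : 𝓢'(Space, ℂ)) = ((s n - g : L2) : 𝓢'(Space, ℂ)) := by
    intro n
    have key : ∀ a b : L2, ((a - b : L2) : 𝓢'(Space, ℂ)) = (a : 𝓢'(Space, ℂ)) - b :=
      fun a b => map_sub (Lp.toTemperedDistributionCLM ℂ (volume : Measure Space) 2) a b
    have h1 : (((φ n).toLp 2 volume : L2) : 𝓢'(Space, ℂ)) =
        TemperedDistribution.besselPotential Space ℂ (-1) ((s n : L2) : 𝓢'(Space, ℂ)) := by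
      rw [← hψ n, SchwartzMap.toLpCLM_apply, Lp.toTemperedDistribution_toLp_eq,
        Lp.toTemperedDistribution_toLp_eq, TemperedDistribution.besselPotential,
        TemperedDistribution.fourierMultiplierCLM_toTemperedDistributionCLM_eq hm]
    rw [key, key, map_sub, hg, h1, TemperedDistribution.besselPotential_besselPotential_apply]
    simp
  have hlim0 : Tendsto (fun n => ‖s n - g‖) atTop (𝓝 0) := tendsto_iff_norm_sub_tendsto_zero.1 hlim
  refine ⟨φ, ?_, fun i => ?_⟩
  · rw [tendsto_iff_norm_sub_tendsto_zero]
    exact squeeze_zero (fun _ => norm_nonneg _) (fun n => norm_le_of_bessel (hb n)) hlim0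
  · rw [tendsto_iff_norm_sub_tendsto_zero]
    refine squeeze_zero (fun _ => norm_nonneg _) (fun n => norm_weakPartial_le_of_bessel
      ((isWeakPartial_toLp (φ n) i).sub (hu.isWeakPartial i)) (hb n)) ?_
    simpa using hlim0.const_mul (2 * Real.pi)

/-! ### Translations -/

/-- The function `x ↦ u (x + h)`. -/
def translate (h : Space) (u : L2) : L2 :=
  Lp.compMeasurePreserving (fun x => x + h) (measurePreserving_add_right volume h) u

theorem coeFn_translate (h : Space) (u : L2) : translate h u =ᵐ[volume] fun x => u (x + h) :=
  Lp.coeFn_compMeasurePreserving u (measurePreserving_add_right volume h)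

theorem norm_translate (h : Space) (u : L2) : ‖translate h u‖ = ‖u‖ :=
  Lp.norm_compMeasurePreserving u (measurePreserving_add_right volume h)

theorem continuous_translate (h : Space) : Continuous (translate h) :=
  (Lp.isometry_compMeasurePreserving (measurePreserving_add_right volume h)).continuous

theorem kinetic_nonneg (u : L2) : 0 ≤ kinetic u := Finset.sum_nonneg fun _ _ => sq_nonneg _

/-- By Plancherel's theorem and `|exp (iθ) - 1| ≤ |θ|`. -/
theorem schwartz_norm_translate_sub_le (φ : 𝓢(Space, ℂ)) (h : Space) :
    ‖translate h (φ.toLp 2 volume) - φ.toLp 2 volume‖ ≤ ‖((∂_{h} φ).toLp 2 volume : L2)‖ := by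
  set ψ : 𝓢(Space, ℂ) := SchwartzMap.compSubConstCLM ℂ (-h) φ with hψ
  have h1 : translate h (φ.toLp 2 volume) = ψ.toLp 2 volume := by
    apply Lp.ext
    have := (measurePreserving_add_right (volume : Measure Space) h).quasiMeasurePreserving.ae
      (φ.coeFn_toLp 2 volume)
    filter_upwards [coeFn_translate h (φ.toLp 2 volume), ψ.coeFn_toLp 2 volume,
      this] with x h1 h2 h3
    rw [h1, h2, h3, hψ, SchwartzMap.compSubConstCLM_apply, sub_neg_eq_add]
  have h2 : (ψ.toLp 2 volume : L2) - φ.toLp 2 volume = (ψ - φ).toLp 2 volume :=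
    (map_sub (SchwartzMap.toLpCLM ℂ (E := Space) ℂ 2 volume) ψ φ).symm
  have hF : ∀ χ : 𝓢(Space, ℂ), ‖(χ.toLp 2 volume : L2)‖ = ‖((𝓕 χ).toLp 2 volume : L2)‖ :=
    fun χ => by rw [← SchwartzMap.toLp_fourier_eq, Lp.norm_fourier_eq]
  rw [h1, h2, hF, hF (∂_{h} φ)]
  refine Lp.norm_le_norm_of_ae_le ?_
  filter_upwards [(𝓕 (ψ - φ)).coeFn_toLp 2 volume, (𝓕 (∂_{h} φ)).coeFn_toLp 2 volume] with ξ h3 h4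
  rw [h3, h4, SchwartzMap.fourier_lineDerivOp_eq]
  have h5 : 𝓕 (ψ - φ) ξ =
      (Complex.exp ((2 * Real.pi * inner ℝ h ξ : ℝ) * Complex.I) - 1) * 𝓕 φ ξ := by
    have h6 : 𝓕 ψ ξ = Complex.exp ((2 * Real.pi * inner ℝ h ξ : ℝ) * Complex.I) * 𝓕 φ ξ := by
      rw [SchwartzMap.fourier_coe, SchwartzMap.fourier_coe]
      have := congrFun (VectorFourier.fourierIntegral_comp_add_right Real.fourierChar
        (volume : Measure Space) (innerₗ Space) φ h) ξ
      have h7 : (ψ : Space → ℂ) = φ ∘ fun v => v + h := by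
        ext x
        rw [hψ, SchwartzMap.compSubConstCLM_apply, sub_neg_eq_add]; rfl
      rw [h7]
      refine this.trans ?_
      rw [Circle.smul_def, smul_eq_mul, Real.fourierChar_apply]
      rfl
    rw [sub_eq_add_neg, FourierTransform.fourier_add, FourierTransform.fourier_neg,
      add_apply, neg_apply, h6]
    ring
  rw [h5, smul_apply, SchwartzMap.smulLeftCLM_apply_apply (by fun_prop)]
  rw [norm_mul, norm_smul, norm_smul, ← mul_assoc]
  gcongr
  have h8 := Real.norm_exp_I_mul_ofReal_sub_one_le (x := 2 * Real.pi * inner ℝ h ξ)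
  rw [mul_comm]
  refine h8.trans (le_of_eq ?_)
  rw [real_inner_comm]
  simp [abs_of_pos Real.pi_pos]

/-- A translation by `h` moves `u ∈ H¹` by at most `‖h‖ ‖∇u‖₂` in `L²`. -/
theorem MemH1.norm_translate_sub_le {u : L2} (hu : MemH1 u) (h : Space) :
    ‖translate h u - u‖ ≤ ‖h‖ * √(kinetic u) := by
  obtain ⟨φ, h1, h2⟩ := hu.exists_schwartz_tendsto
  have hh : h = ∑ i, h i • basisVec i := by
    have := (EuclideanSpace.basisFun (Fin 3) ℝ).sum_repr h
    simpa [basisVec] using this.symm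
  have key : ∀ n, ‖translate h ((φ n).toLp 2 volume) - (φ n).toLp 2 volume‖ ≤
      ‖h‖ * √(∑ i, ‖((∂_{basisVec i} (φ n)).toLp 2 volume : L2)‖ ^ 2) := by
    intro n
    refine (schwartz_norm_translate_sub_le (φ n) h).trans ?_
    have h3 : ((∂_{h} (φ n)).toLp 2 volume : L2) =
        ∑ i, (h i) • ((∂_{basisVec i} (φ n)).toLp 2 volume : L2) := by
      have h4 : ∂_{h} (φ n) = ∑ i, h i • ∂_{basisVec i} (φ n) := by
        conv_lhs => rw [hh]
        simp only [Fin.sum_univ_three, LineDeriv.lineDerivOp_left_add,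
          LineDeriv.lineDerivOp_left_smul]
      rw [h4]
      have := map_sum (SchwartzMap.toLpCLM ℝ (E := Space) ℂ 2 volume)
        (fun i => h i • ∂_{basisVec i} (φ n)) Finset.univ
      simpa only [map_smul, SchwartzMap.toLpCLM_apply] using this
    rw [h3, EuclideanSpace.norm_eq]
    refine (norm_sum_le _ _).trans ?_
    simp only [norm_smul]
    exact Real.sum_mul_le_sqrt_mul_sqrt _ _ _
  refine le_of_tendsto_of_tendsto ((((continuous_translate h).tendsto u).comp h1).sub h1).norm
    ?_ (Eventually.of_forall key)
  refine Tendsto.const_mul _ ((Real.continuous_sqrt.tendsto _).comp ?_)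
  exact tendsto_finsetSum _ fun i _ => ((h2 i).norm.pow 2)

/-! ### Affine changes of variables -/

/-- The diagonal map `x ↦ (d₀ x₀, d₁ x₁, d₂ x₂)`. -/
def stretch (d : Fin 3 → ℝ) (hd : ∀ i, 0 < d i) : Space ≃L[ℝ] Space :=
  LinearEquiv.toContinuousLinearEquiv
    { toFun := fun x => WithLp.toLp 2 fun i => d i * x i
      invFun := fun x => WithLp.toLp 2 fun i => (d i)⁻¹ * x i
      map_add' := fun x y => by ext i; simp [mul_add]
      map_smul' := fun c x => by ext i; simp [mul_left_comm]
      left_inv := fun x => by ext i; simp [(hd i).ne']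
      right_inv := fun x => by ext i; simp [(hd i).ne'] }

section
variable (d : Fin 3 → ℝ) (hd : ∀ i, 0 < d i) (y : Space)

@[simp] theorem stretch_apply (x : Space) (i : Fin 3) : stretch d hd x i = d i * x i := rfl

@[simp] theorem stretch_symm_apply (x : Space) (i : Fin 3) :
    (stretch d hd).symm x i = (d i)⁻¹ * x i := rfl

theorem stretch_symm_basisVec (i : Fin 3) :
    (stretch d hd).symm (basisVec i) = (d i)⁻¹ • basisVec i := by
  ext j
  by_cases h : j = i
  · subst h; simp [basisVec]
  · simp [basisVec, h]

/-- The factor by which composition with `stretch d` multiplies integrals. -/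
def jac : ℝ := |LinearMap.det ((stretch d hd : Space →L[ℝ] Space) : Space →ₗ[ℝ] Space)|⁻¹

theorem det_stretch_ne_zero :
    LinearMap.det ((stretch d hd : Space →L[ℝ] Space) : Space →ₗ[ℝ] Space) ≠ 0 :=
  (LinearEquiv.isUnit_det' (stretch d hd).toLinearEquiv).ne_zero

theorem jac_pos : 0 < jac d hd := inv_pos.2 (abs_pos.2 (det_stretch_ne_zero d hd))

theorem jac_const (t : ℝ) (ht : 0 < t) : jac (fun _ => t) (fun _ => ht) = (t ^ 3)⁻¹ := by
  have : ((stretch (fun _ => t) (fun _ => ht) : Space →L[ℝ] Space) : Space →ₗ[ℝ] Space) =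
      t • LinearMap.id := by
    ext x i; simp
  rw [jac, this, LinearMap.det_smul, LinearMap.det_id, mul_one, finrank_euclideanSpace,
    Fintype.card_fin, abs_of_pos (by positivity)]

/-- The affine homeomorphism `x ↦ stretch d x + y`. -/
def affineHomeo : Space ≃ₜ Space := (stretch d hd).toHomeomorph.trans (Homeomorph.addRight y)

@[simp] theorem affineHomeo_apply (x : Space) : affineHomeo d hd y x = stretch d hd x + y := rfl

theorem map_affineHomeo : Measure.map (affineHomeo d hd y) (volume : Measure Space) =
    ENNReal.ofReal (jac d hd) • volume := by
  have h1 : (affineHomeo d hd y : Space → Space) =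
      (fun x => x + y) ∘ ((stretch d hd : Space →L[ℝ] Space) : Space →ₗ[ℝ] Space) := rfl
  rw [h1, ← Measure.map_map (by fun_prop) (by exact (stretch d hd).continuous.measurable),
    Measure.map_linearMap_addHaar_eq_smul_addHaar _ (det_stretch_ne_zero d hd),
    Measure.map_smul, (measurePreserving_add_right volume y).map_eq, abs_inv]
  rfl

theorem integral_comp_affine {G : Type*} [NormedAddCommGroup G] [NormedSpace ℝ G] (f : Space → G) :
    ∫ x, f (stretch d hd x + y) = jac d hd • ∫ x, f x := by
  have := (affineHomeo d hd y).measurableEmbedding.integral_map (μ := volume) f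
  rw [map_affineHomeo, integral_smul_measure,
    ENNReal.toReal_ofReal (jac_pos d hd).le] at this
  exact this.symm

theorem memLp_comp_affine {G : Type*} [NormedAddCommGroup G] {f : Space → G} {p : ℝ≥0∞}
    (hf : MemLp f p volume) : MemLp (fun x => f (stretch d hd x + y)) p volume := by
  have h : MemLp f p (Measure.map (affineHomeo d hd y) volume) := by
    rw [map_affineHomeo]
    exact hf.smul_measure ENNReal.ofReal_ne_top
  exact h.comp_of_map (affineHomeo d hd y).continuous.measurable.aemeasurable

/-- The function `x ↦ u (stretch d x + y)`. -/
def compAffine (u : L2) : L2 := (memLp_comp_affine d hd y (Lp.memLp u)).toLp _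

theorem coeFn_compAffine (u : L2) :
    compAffine d hd y u =ᵐ[volume] fun x => u (stretch d hd x + y) :=
  MemLp.coeFn_toLp _

theorem norm_sq_eq_integral (u : L2) : ‖u‖ ^ 2 = ∫ x, ‖u x‖ ^ 2 := by
  have h := @L2.inner_def Space ℂ ℂ _ _ _ _ _ u u
  have h2 := congrArg Complex.re ((inner_self_eq_norm_sq_to_K (𝕜 := ℂ) u).symm.trans h)
  have h3 : ((‖u‖ : ℂ) ^ 2).re = ‖u‖ ^ 2 := by norm_cast
  refine (h3.symm.trans h2).trans ?_
  have h4 : ∀ x, inner ℂ (u x) (u x) = ((‖u x‖ ^ 2 : ℝ) : ℂ) := fun x => by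
    rw [inner_self_eq_norm_sq_to_K]; norm_cast
  simp_rw [h4]
  rw [integral_complex_ofReal, Complex.ofReal_re]

theorem norm_sq_compAffine (u : L2) : ‖compAffine d hd y u‖ ^ 2 = jac d hd * ‖u‖ ^ 2 := by
  rw [norm_sq_eq_integral, norm_sq_eq_integral, ← smul_eq_mul, ← integral_comp_affine d hd y]
  refine integral_congr_ae ?_
  filter_upwards [coeFn_compAffine d hd y u] with x hx
  rw [hx]

/-- The chain rule for weak derivatives. -/
theorem IsWeakPartial.compAffine {i : Fin 3} {u g : L2} (h : IsWeakPartial i u g) :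
    IsWeakPartial i (compAffine d hd y u) ((d i : ℂ) • DipolarGP.compAffine d hd y g) := by
  rw [isWeakPartial_iff] at h ⊢
  intro φ
  -- the test function transported by the inverse affine map
  let ψ : 𝓢(Space, ℂ) := SchwartzMap.compSubConstCLM ℂ y
    (SchwartzMap.compCLMOfContinuousLinearEquiv ℂ (stretch d hd).symm φ)
  have hψ : ∀ x, ψ (stretch d hd x + y) = φ x := fun x => by
    simp only [ψ, SchwartzMap.compSubConstCLM_apply,
      SchwartzMap.compCLMOfContinuousLinearEquiv_apply, Function.comp_apply, add_sub_cancel_right,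
      ContinuousLinearEquiv.symm_apply_apply]
  have hψ' : ∀ x, (∂_{basisVec i} ψ) (stretch d hd x + y) =
      ((d i)⁻¹ : ℝ) • (∂_{basisVec i} φ) x := fun x => by
    have h1 : (ψ : Space → ℂ) = fun z => (SchwartzMap.compCLMOfContinuousLinearEquiv ℂ
      (stretch d hd).symm φ) (z - y) := rfl
    rw [SchwartzMap.lineDerivOp_apply_eq_fderiv, h1, fderiv_comp_sub,
      ← SchwartzMap.lineDerivOp_apply_eq_fderiv,
      SchwartzMap.lineDerivOp_compCLMOfContinuousLinearEquiv, stretch_symm_basisVec,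
      LineDeriv.lineDerivOp_left_smul]
    simp
  have h1 := h ψ
  have e1 : ∫ x, (∂_{basisVec i} φ) x * DipolarGP.compAffine d hd y u x =
      (d i : ℂ) * ((jac d hd) • ∫ x, (∂_{basisVec i} ψ) x * u x) := by
    rw [← integral_comp_affine d hd y, ← integral_const_mul]
    refine integral_congr_ae ?_
    filter_upwards [coeFn_compAffine d hd y u] with x hx
    rw [hx, hψ']
    have : (d i : ℂ) ≠ 0 := Complex.ofReal_ne_zero.2 (hd i).ne'
    simp only [Complex.real_smul, Complex.ofReal_inv]
    field_simp
  have e2 : ∫ x, φ x * ((d i : ℂ) • DipolarGP.compAffine d hd y g : L2) x =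
      (d i : ℂ) * ((jac d hd) • ∫ x, ψ x * g x) := by
    rw [← integral_comp_affine d hd y, ← integral_const_mul]
    refine integral_congr_ae ?_
    filter_upwards [coeFn_compAffine d hd y g,
      Lp.coeFn_smul (d i : ℂ) (DipolarGP.compAffine d hd y g)] with x hx hx'
    rw [hx', Pi.smul_apply, hx, hψ, smul_eq_mul]
    ring
  rw [e1, e2, h1, smul_neg, mul_neg]

theorem MemH1.compAffine {u : L2} (hu : MemH1 u) : MemH1 (compAffine d hd y u) :=
  memH1_of_isWeakPartial fun i => (hu.isWeakPartial i).compAffine d hd y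

theorem MemH1.weakPartial_compAffine {u : L2} (hu : MemH1 u) (i : Fin 3) :
    weakPartial (DipolarGP.compAffine d hd y u) i =
      (d i : ℂ) • DipolarGP.compAffine d hd y (weakPartial u i) :=
  ((hu.isWeakPartial i).compAffine d hd y).weakPartial_eq

theorem MemH1.kinetic_compAffine {u : L2} (hu : MemH1 u) :
    kinetic (DipolarGP.compAffine d hd y u) =
      jac d hd * ∑ i, d i ^ 2 * ‖weakPartial u i‖ ^ 2 := by
  rw [kinetic, Finset.mul_sum]
  refine Finset.sum_congr rfl fun i _ => ?_
  rw [hu.weakPartial_compAffine, norm_smul, mul_pow, norm_sq_compAffine, Complex.norm_real,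
    Real.norm_eq_abs, sq_abs]
  ring

theorem integral_norm_rpow_compAffine (u : L2) (p : ℝ) :
    ∫ x, ‖compAffine d hd y u x‖ ^ p = jac d hd * ∫ x, ‖u x‖ ^ p := by
  rw [← smul_eq_mul, ← integral_comp_affine d hd y]
  refine integral_congr_ae ?_
  filter_upwards [coeFn_compAffine d hd y u] with x hx
  rw [hx]

theorem inner_stretch (x ξ : Space) :
    inner ℝ (stretch d hd x) ξ = inner ℝ x (stretch d hd ξ) := by
  simp only [PiLp.inner_apply, stretch_apply, Real.inner_apply]
  exact Finset.sum_congr rfl fun i _ => by ring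

/-- The Fourier transform of `f (stretch d x + y)`, up to a factor of modulus one. -/
theorem norm_fourierHat_comp_affine (f : Space → ℂ) (ξ : Space) :
    ‖fourierHat (fun x => f (stretch d hd x + y)) (stretch d hd ξ)‖ =
      jac d hd * ‖fourierHat f ξ‖ := by
  have h1 : fourierHat (fun x => f (stretch d hd x + y)) (stretch d hd ξ) =
      (jac d hd : ℂ) * (Complex.exp (Complex.I * ((inner ℝ y ξ : ℝ) : ℂ)) * fourierHat f ξ) := by
    rw [fourierHat, fourierHat, ← integral_const_mul, ← Complex.real_smul,
      ← integral_comp_affine d hd y]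
    refine integral_congr_ae (Eventually.of_forall fun x => ?_)
    simp only [inner_add_left, inner_stretch]
    rw [mul_left_comm, ← Complex.exp_add]
    congr 2
    push_cast
    ring
  rw [h1, norm_mul, norm_mul, mul_comm Complex.I, Complex.norm_exp_ofReal_mul_I, one_mul,
    Complex.norm_real, Real.norm_eq_abs, abs_of_pos (jac_pos d hd)]

/-- A change of variables multiplies the squared Fourier transform of the density by the square of
the Jacobian, and the substitution in the frequencies removes one of the two factors. -/
theorem interaction_compAffine (l₁ l₂ : ℝ) (u : L2) :
    interaction l₁ l₂ (compAffine d hd y u) = jac d hd *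
      (1 / (2 * Real.pi) ^ 3 * ∫ ξ : Space, (l₁ + l₂ * dipoleHat (stretch d hd ξ)) *
        ‖fourierHat (fun x => ((‖u x‖ ^ 2 : ℝ) : ℂ)) ξ‖ ^ 2) := by
  have h0 : ∀ ξ, fourierHat (fun x => ((‖compAffine d hd y u x‖ ^ 2 : ℝ) : ℂ)) ξ =
      fourierHat (fun x => ((‖u (stretch d hd x + y)‖ ^ 2 : ℝ) : ℂ)) ξ := fun ξ => by
    refine integral_congr_ae ?_
    filter_upwards [coeFn_compAffine d hd y u] with x hx
    rw [hx]
  have hJ := (jac_pos d hd).ne'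
  have h1 := integral_comp_affine d hd 0 fun ξ : Space => (l₁ + l₂ * dipoleHat ξ) *
      ‖fourierHat (fun x => ((‖compAffine d hd y u x‖ ^ 2 : ℝ) : ℂ)) ξ‖ ^ 2
  have h2 : ∀ ξ, ‖fourierHat (fun x => ((‖compAffine d hd y u x‖ ^ 2 : ℝ) : ℂ))
      (stretch d hd ξ)‖ = jac d hd * ‖fourierHat (fun x => ((‖u x‖ ^ 2 : ℝ) : ℂ)) ξ‖ := fun ξ => by
    rw [h0]
    exact norm_fourierHat_comp_affine d hd y (fun x => ((‖u x‖ ^ 2 : ℝ) : ℂ)) ξ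
  simp only [add_zero, h2, mul_pow, mul_left_comm _ (jac d hd ^ 2), integral_const_mul,
    smul_eq_mul] at h1
  rw [interaction]
  have h3 : ∫ ξ : Space, (l₁ + l₂ * dipoleHat ξ) *
      ‖fourierHat (fun x => ((‖compAffine d hd y u x‖ ^ 2 : ℝ) : ℂ)) ξ‖ ^ 2 = jac d hd *
      ∫ ξ : Space, (l₁ + l₂ * dipoleHat (stretch d hd ξ)) *
        ‖fourierHat (fun x => ((‖u x‖ ^ 2 : ℝ) : ℂ)) ξ‖ ^ 2 := by
    apply mul_left_cancel₀ hJ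
    rw [← h1]; ring
  rw [h3]; ring

end

theorem norm_stretch_const (t : ℝ) (ht : 0 < t) (x : Space) :
    ‖stretch (fun _ => t) (fun _ => ht) x‖ = t * ‖x‖ := by
  have : stretch (fun _ => t) (fun _ => ht) x = t • x := by ext i; simp
  rw [this, norm_smul, Real.norm_eq_abs, abs_of_pos ht]

theorem dipoleHat_stretch_const (t : ℝ) (ht : 0 < t) (ξ : Space) :
    dipoleHat (stretch (fun _ => t) (fun _ => ht) ξ) = dipoleHat ξ := by
  rw [dipoleHat, dipoleHat, norm_stretch_const]
  simp only [stretch_apply, mul_pow]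
  rw [show 2 * (t ^ 2 * ξ 2 ^ 2) - t ^ 2 * ξ 0 ^ 2 - t ^ 2 * ξ 1 ^ 2 =
    t ^ 2 * (2 * ξ 2 ^ 2 - ξ 0 ^ 2 - ξ 1 ^ 2) by ring, mul_div_mul_left _ _ (by positivity)]

/-! ### The Sobolev inequality -/

/-- A smooth cutoff function, equal to one on the unit ball. -/
def cutoff : ContDiffBump (0 : Space) := ⟨1, 2, one_pos, one_lt_two⟩

/-- The Gagliardo–Nirenberg–Sobolev inequality for Schwartz functions, by truncation to
compactly supported functions. -/
theorem eLpNorm_six_schwartz_le (φ : 𝓢(Space, ℂ)) :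
    eLpNorm φ 6 (volume : Measure Space) ≤
      SNormLESNormFDerivOfEqConst ℂ (volume : Measure Space) 2 *
        eLpNorm (fderiv ℝ φ) 2 (volume : Measure Space) := by
  set C := SNormLESNormFDerivOfEqConst ℂ (volume : Measure Space) 2
  -- the derivative of the cutoff at scale `n + 1` is of order `1 / (n + 1)`
  let χ : ℕ → Space → ℝ := fun n x => cutoff (((n : ℝ) + 1)⁻¹ • x)
  have hχs : ∀ n, ContDiff ℝ 1 (χ n) := fun n =>
    (cutoff.contDiff (n := 1)).comp (contDiff_const_smul _)
  obtain ⟨L, hL⟩ : ∃ L, ∀ x, ‖fderiv ℝ cutoff x‖ ≤ L :=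
    (((cutoff.contDiff (n := 1)).continuous_fderiv one_ne_zero)).bounded_above_of_compact_support
      (cutoff.hasCompactSupport.fderiv (𝕜 := ℝ))
  have hL0 : 0 ≤ L := (norm_nonneg _).trans (hL 0)
  have hχd : ∀ n x, ‖fderiv ℝ (χ n) x‖ ≤ L * ((n : ℝ) + 1)⁻¹ := fun n x => by
    have : fderiv ℝ (χ n) x = ((n : ℝ) + 1)⁻¹ • fderiv ℝ cutoff (((n : ℝ) + 1)⁻¹ • x) :=
      fderiv_comp_smul _
    rw [this, norm_smul, Real.norm_eq_abs, abs_of_pos (by positivity), mul_comm]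
    gcongr
    exact hL _
  have hχ1 : ∀ n x, |χ n x| ≤ 1 := fun n x => by
    rw [abs_of_nonneg cutoff.nonneg]; exact cutoff.le_one
  let w : ℕ → Space → ℂ := fun n x => χ n x • φ x
  have hφ : ContDiff ℝ 1 φ := φ.smooth 1
  have hws : ∀ n, ContDiff ℝ 1 (w n) := fun n => (hχs n).smul hφ
  have hχc : ∀ n, HasCompactSupport (χ n) := fun n =>
    cutoff.hasCompactSupport.comp_smul (by positivity)
  have hwc : ∀ n, HasCompactSupport (w n) := fun n => (hχc n).smul_right
  have hwd : ∀ n x, ‖fderiv ℝ (w n) x‖ ≤ ‖fderiv ℝ φ x‖ + L * ((n : ℝ) + 1)⁻¹ * ‖φ x‖ := by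
    intro n x
    have : fderiv ℝ (w n) x = χ n x • fderiv ℝ φ x + (fderiv ℝ (χ n) x).smulRight (φ x) :=
      fderiv_fun_smul ((hχs n).differentiable one_ne_zero x) (hφ.differentiable one_ne_zero x)
    rw [this]
    refine (norm_add_le _ _).trans (add_le_add ?_ ?_)
    · rw [norm_smul]
      exact mul_le_of_le_one_left (norm_nonneg _) (hχ1 n x)
    · rw [ContinuousLinearMap.norm_smulRight_apply]
      gcongr
      exact hχd n x
  have hdm : AEStronglyMeasurable (fderiv ℝ φ) (volume : Measure Space) :=
    (hφ.continuous_fderiv one_ne_zero).aestronglyMeasurable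
  have hw6 : ∀ n, eLpNorm (w n) 6 (volume : Measure Space) ≤
      C * (eLpNorm (fderiv ℝ φ) 2 volume +
        ENNReal.ofReal (L * ((n : ℝ) + 1)⁻¹) * eLpNorm φ 2 volume) := by
    intro n
    have h := eLpNorm_le_eLpNorm_fderiv_of_eq (volume : Measure Space) (hws n) (hwc n)
      (p := 2) (p' := 6) (by norm_num) (by simp) (by simp; norm_num)
    refine h.trans (mul_le_mul_right ?_ _)
    have h2 : eLpNorm (fderiv ℝ (w n)) 2 (volume : Measure Space) ≤
        eLpNorm ((fun x => ‖fderiv ℝ φ x‖) + fun x => (L * ((n : ℝ) + 1)⁻¹) • ‖φ x‖) 2 volume := by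
      refine eLpNorm_mono_real fun x => ?_
      simpa using hwd n x
    have hm : AEStronglyMeasurable (fun x => (L * ((n : ℝ) + 1)⁻¹) • ‖φ x‖)
        (volume : Measure Space) := by
      have hc : Continuous fun x => (L * ((n : ℝ) + 1)⁻¹) • ‖φ x‖ := by fun_prop
      exact hc.aestronglyMeasurable
    refine h2.trans ((eLpNorm_add_le hdm.norm hm (by norm_num)).trans ?_)
    rw [eLpNorm_norm]
    gcongr
    refine (eLpNorm_const_smul_le (c := L * ((n : ℝ) + 1)⁻¹) (f := fun x => ‖φ x‖)).trans ?_
    rw [eLpNorm_norm, Real.enorm_eq_ofReal (by positivity)]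
  have hlim : ∀ x, Tendsto (fun n => w n x) atTop (𝓝 (φ x)) := by
    intro x
    have h1 : Tendsto (fun n : ℕ => (((n : ℝ) + 1)⁻¹) • x) atTop (𝓝 ((0 : ℝ) • x)) :=
      (tendsto_one_div_add_atTop_nhds_zero_nat.congr fun n => by rw [one_div]).smul_const x
    have h2 : Tendsto (fun n => χ n x) atTop (𝓝 (cutoff ((0 : ℝ) • x))) :=
      (cutoff.continuous.tendsto _).comp h1
    have h3 : cutoff ((0 : ℝ) • x) = 1 := by
      rw [zero_smul]; exact cutoff.one_of_mem_closedBall (by simp [cutoff])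
    rw [h3] at h2
    simpa [w] using h2.smul_const (φ x)
  have hbd : Tendsto (fun n : ℕ => C * (eLpNorm (fderiv ℝ φ) 2 (volume : Measure Space) +
      ENNReal.ofReal (L * ((n : ℝ) + 1)⁻¹) * eLpNorm φ 2 (volume : Measure Space))) atTop
      (𝓝 (C * (eLpNorm (fderiv ℝ φ) 2 volume + 0 * eLpNorm φ 2 volume))) := by
    refine ENNReal.Tendsto.const_mul (tendsto_const_nhds.add ?_) (Or.inr ENNReal.coe_ne_top)
    refine ENNReal.Tendsto.mul_const ?_ (Or.inr (φ.memLp 2 volume).eLpNorm_ne_top)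
    have : Tendsto (fun n : ℕ => L * ((n : ℝ) + 1)⁻¹) atTop (𝓝 0) := by
      simpa [one_div] using tendsto_one_div_add_atTop_nhds_zero_nat.const_mul L
    simpa [Function.comp_def] using (ENNReal.continuous_ofReal.tendsto 0).comp this
  rw [zero_mul, add_zero] at hbd
  refine (Lp.eLpNorm_lim_le_liminf_eLpNorm (fun n => (hws n).continuous.aestronglyMeasurable) _
    (Eventually.of_forall hlim)).trans ?_
  rw [← hbd.liminf_eq]
  exact liminf_le_liminf (Eventually.of_forall hw6)

theorem norm_fderiv_schwartz_le (φ : 𝓢(Space, ℂ)) (x : Space) :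
    ‖fderiv ℝ φ x‖ ≤ ∑ i, ‖(∂_{basisVec i} φ) x‖ := by
  refine ContinuousLinearMap.opNorm_le_bound _ (by positivity) fun v => ?_
  have hv : v = ∑ i, v i • basisVec i := by
    have := (EuclideanSpace.basisFun (Fin 3) ℝ).sum_repr v
    simpa [basisVec] using this.symm
  conv_lhs => rw [hv]
  rw [map_sum, Finset.sum_mul]
  refine (norm_sum_le _ _).trans (Finset.sum_le_sum fun i _ => ?_)
  rw [map_smul, norm_smul, SchwartzMap.lineDerivOp_apply_eq_fderiv, mul_comm]
  gcongr
  exact PiLp.norm_apply_le v i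

/-- The Sobolev inequality passes from Schwartz functions to their limits in `H¹` by Fatou's
lemma. -/
theorem MemH1.eLpNorm_six_le {u : L2} (hu : MemH1 u) :
    eLpNorm u 6 (volume : Measure Space) ≤
      SNormLESNormFDerivOfEqConst ℂ (volume : Measure Space) 2 *
        ENNReal.ofReal (∑ i, ‖weakPartial u i‖) := by
  obtain ⟨φ, h1, h2⟩ := hu.exists_schwartz_tendsto
  set C := SNormLESNormFDerivOfEqConst ℂ (volume : Measure Space) 2
  have hS : ∀ n, eLpNorm (φ n) 6 (volume : Measure Space) ≤
      C * ENNReal.ofReal (∑ i, ‖((∂_{basisVec i} (φ n)).toLp 2 volume : L2)‖) := by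
    intro n
    refine (eLpNorm_six_schwartz_le (φ n)).trans ?_
    gcongr
    have h3 : eLpNorm (fderiv ℝ (φ n)) 2 (volume : Measure Space) ≤
        eLpNorm (∑ i, fun x => ‖(∂_{basisVec i} (φ n)) x‖) 2 volume := by
      refine eLpNorm_mono_real fun x => ?_
      simpa using norm_fderiv_schwartz_le (φ n) x
    refine h3.trans ((eLpNorm_sum_le (fun i _ =>
      (∂_{basisVec i} (φ n)).continuous.norm.aestronglyMeasurable) (by norm_num)).trans ?_)
    rw [ENNReal.ofReal_sum_of_nonneg (fun _ _ => norm_nonneg _)]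
    refine Finset.sum_le_sum fun i _ => ?_
    rw [eLpNorm_norm, SchwartzMap.norm_toLp,
      ENNReal.ofReal_toReal ((∂_{basisVec i} (φ n)).memLp 2 volume).eLpNorm_ne_top]
  obtain ⟨ns, hns, hae⟩ := (tendstoInMeasure_of_tendsto_Lp h1).exists_seq_tendsto_ae
  have hae' : ∀ᵐ x ∂(volume : Measure Space),
      Tendsto (fun k => (φ (ns k)) x) atTop (𝓝 (u x)) := by
    have h4 : ∀ᵐ x ∂(volume : Measure Space), ∀ k,
        ((φ (ns k)).toLp 2 volume : L2) x = φ (ns k) x :=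
      ae_all_iff.2 fun k => (φ (ns k)).coeFn_toLp 2 volume
    filter_upwards [hae, h4] with x hx hx'
    simpa only [hx'] using hx
  have hbd : Tendsto (fun k => C * ENNReal.ofReal
      (∑ i, ‖((∂_{basisVec i} (φ (ns k))).toLp 2 volume : L2)‖)) atTop
      (𝓝 (C * ENNReal.ofReal (∑ i, ‖weakPartial u i‖))) := by
    refine ENNReal.Tendsto.const_mul ?_ (Or.inr ENNReal.coe_ne_top)
    refine (ENNReal.continuous_ofReal.tendsto _).comp ?_
    exact tendsto_finsetSum _ fun i _ => ((h2 i).comp hns.tendsto_atTop).norm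
  refine (Lp.eLpNorm_lim_le_liminf_eLpNorm
    (fun k => (φ (ns k)).continuous.aestronglyMeasurable) _ hae').trans ?_
  rw [← hbd.liminf_eq]
  exact liminf_le_liminf (Eventually.of_forall fun k => hS _)

theorem MemH1.memLp_six {u : L2} (hu : MemH1 u) : MemLp u 6 (volume : Measure Space) :=
  ⟨Lp.aestronglyMeasurable u, hu.eLpNorm_six_le.trans_lt (by finiteness)⟩

theorem integrable_norm_sq (u : L2) : Integrable (fun x => ‖u x‖ ^ 2) volume :=
  (Lp.memLp u).integrable_norm_pow (by norm_num)

theorem MemH1.integrable_norm_six {u : L2} (hu : MemH1 u) :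
    Integrable (fun x => ‖u x‖ ^ 6) volume := by
  simpa using hu.memLp_six.integrable_norm_pow (p := 6) (by norm_num)

/-- The Sobolev inequality `‖u‖₆⁶ ≤ S ‖∇u‖₂⁶`. -/
theorem exists_sobolev_const : ∃ S : ℝ, 0 < S ∧ ∀ u : L2, MemH1 u →
    ∫ x, ‖u x‖ ^ 6 ≤ S * kinetic u ^ 3 := by
  set C := SNormLESNormFDerivOfEqConst ℂ (volume : Measure Space) 2
  refine ⟨((C : ℝ) ^ 2 * 3) ^ 3 + 1, by positivity, fun u hu => ?_⟩
  have h1 := ENNReal.toReal_mono (by finiteness) hu.eLpNorm_six_le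
  rw [ENNReal.toReal_mul, ENNReal.coe_toReal, ENNReal.toReal_ofReal (by positivity)] at h1
  have h2 : ∫ x, ‖u x‖ ^ 6 = (eLpNorm u 6 (volume : Measure Space)).toReal ^ 6 := by
    have h := hu.memLp_six.eLpNorm_eq_integral_rpow_norm (by norm_num) (by norm_num)
    have h0 : 0 ≤ ∫ x, ‖u x‖ ^ 6 := integral_nonneg fun x => by positivity
    rw [h, ENNReal.toReal_ofReal (by positivity)]
    simp only [ENNReal.toReal_ofNat, Real.rpow_ofNat]
    rw [← Real.rpow_natCast, ← Real.rpow_mul h0]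
    norm_num
  have h3 : (∑ i, ‖weakPartial u i‖) ^ 2 ≤ 3 * kinetic u := by
    have := sq_sum_le_card_mul_sum_sq (s := Finset.univ) (f := fun i => ‖weakPartial u i‖)
    simpa [kinetic] using this
  have hk := kinetic_nonneg u
  calc ∫ x, ‖u x‖ ^ 6 = (eLpNorm u 6 (volume : Measure Space)).toReal ^ 6 := h2
    _ ≤ (C * ∑ i, ‖weakPartial u i‖) ^ 6 := by gcongr
    _ = ((C : ℝ) ^ 2 * (∑ i, ‖weakPartial u i‖) ^ 2) ^ 3 := by ring
    _ ≤ ((C : ℝ) ^ 2 * (3 * kinetic u)) ^ 3 := by gcongr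
    _ = ((C : ℝ) ^ 2 * 3) ^ 3 * kinetic u ^ 3 := by ring
    _ ≤ _ := by gcongr; linarith

theorem rpow_le_sq_add_six {t a : ℝ} (ht : 0 ≤ t) (h2 : 2 ≤ a) (h6 : a ≤ 6) :
    t ^ a ≤ t ^ 2 + t ^ 6 := by
  rcases le_total t 1 with h | h
  · have := Real.rpow_le_rpow_of_exponent_ge_of_imp ht h h2 (by intro h0 h1; linarith)
    rw [Real.rpow_ofNat] at this
    nlinarith [pow_nonneg ht 6]
  · have := Real.rpow_le_rpow_of_exponent_le h h6
    rw [Real.rpow_ofNat] at this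
    nlinarith [pow_nonneg ht 2]

theorem MemH1.integrable_rpow {u : L2} (hu : MemH1 u) {a : ℝ} (h2 : 2 ≤ a) (h6 : a ≤ 6) :
    Integrable (fun x => ‖u x‖ ^ a) volume := by
  refine ((integrable_norm_sq u).add hu.integrable_norm_six).mono'
    (((Lp.aestronglyMeasurable u).norm.aemeasurable.pow_const a).aestronglyMeasurable)
    (Eventually.of_forall fun x => ?_)
  rw [Real.norm_eq_abs, abs_of_nonneg (by positivity)]
  exact rpow_le_sq_add_six (norm_nonneg _) h2 h6

theorem MemH1.integrable_pow {u : L2} (hu : MemH1 u) {a : ℕ} (h2 : 2 ≤ a) (h6 : a ≤ 6) :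
    Integrable (fun x => ‖u x‖ ^ a) volume := by
  simpa using hu.integrable_rpow (a := a) (by exact_mod_cast h2) (by exact_mod_cast h6)

/-! ### The interaction as a quadratic form in the density -/

/-- The integral Fourier transform of `f ∈ L¹ ∩ L²` represents its `L²` Fourier transform. -/
theorem fourier_toLp_ae_eq {f : Space → ℂ} (hf1 : Integrable f volume) (hf2 : MemLp f 2 volume) :
    (𝓕 (hf2.toLp f : L2) : L2) =ᵐ[volume] 𝓕 f := by
  have hcont : Continuous (𝓕 f) :=
    VectorFourier.fourierIntegral_continuous Real.continuous_fourierChar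
      (by exact continuous_inner) hf1
  refine ae_eq_of_integral_contDiff_smul_eq ((Lp.memLp _).locallyIntegrable (by norm_num))
    hcont.locallyIntegrable fun g hg hgc => ?_
  have hg₁ : HasCompactSupport (Complex.ofRealCLM ∘ g) := hgc.comp_left rfl
  have hg₂ : ContDiff ℝ ((⊤ : ℕ∞) : WithTop ℕ∞) (Complex.ofRealCLM ∘ g) := by fun_prop
  let φ : 𝓢(Space, ℂ) := hg₁.toSchwartzMap hg₂
  have hφ : ∀ x, φ x = (g x : ℂ) := fun x => rfl
  have h1 := DFunLike.congr_fun (Lp.fourier_toTemperedDistribution_eq (hf2.toLp f : L2)) φ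
  rw [TemperedDistribution.fourier_apply, Lp.toTemperedDistribution_apply,
    Lp.toTemperedDistribution_apply] at h1
  simp only [hφ] at h1
  have h2 := VectorFourier.integral_fourierIntegral_smul_eq_flip (μ := (volume : Measure Space))
    (ν := (volume : Measure Space)) (L := innerₗ Space) (f := f) (g := φ)
    Real.continuous_fourierChar (by exact continuous_inner) hf1 φ.integrable
  calc ∫ x, g x • (𝓕 (hf2.toLp f : L2) : L2) x
      = ∫ x, (g x : ℂ) • (𝓕 (hf2.toLp f : L2) : L2) x := by simp
    _ = ∫ x, (𝓕 φ) x • (hf2.toLp f : L2) x := h1.symm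
    _ = ∫ x, f x • (𝓕 φ) x := by
        refine integral_congr_ae ?_
        filter_upwards [hf2.coeFn_toLp] with x hx
        rw [hx, smul_eq_mul, smul_eq_mul, mul_comm]
    _ = ∫ x, 𝓕 f x • φ x := by
        rw [flip_innerₗ] at h2
        exact h2.symm
    _ = ∫ x, g x • 𝓕 f x := by
        refine integral_congr_ae (Eventually.of_forall fun x => ?_)
        simp [hφ, mul_comm]

theorem fourierHat_smul (f : Space → ℂ) (η : Space) :
    fourierHat f ((2 * Real.pi) • η) = 𝓕 f η := by
  rw [Real.fourier_eq', fourierHat]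
  refine integral_congr_ae (Eventually.of_forall fun x => ?_)
  simp only [smul_eq_mul, inner_smul_right]
  rw [mul_comm]
  congr 2
  push_cast
  ring

open Classical in
/-- The density `|u|²` as an element of `L²` (zero if `|u|²` is not square integrable). -/
def density (u : L2) : L2 :=
  if h : MemLp (fun x => ((‖u x‖ ^ 2 : ℝ) : ℂ)) 2 (volume : Measure Space) then h.toLp _ else 0

theorem MemH1.memLp_density {u : L2} (hu : MemH1 u) :
    MemLp (fun x => ((‖u x‖ ^ 2 : ℝ) : ℂ)) 2 (volume : Measure Space) := by
  have hm : AEStronglyMeasurable (fun x => ((‖u x‖ ^ 2 : ℝ) : ℂ)) (volume : Measure Space) :=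
    Complex.continuous_ofReal.comp_aestronglyMeasurable
      ((Lp.aestronglyMeasurable u).norm.pow 2)
  rw [memLp_two_iff_integrable_sq_norm hm]
  refine (hu.integrable_pow (a := 4) (by norm_num) (by norm_num)).congr
    (Eventually.of_forall fun x => ?_)
  simp only [Complex.norm_real, Real.norm_eq_abs, sq_abs]
  ring

theorem MemH1.coeFn_density {u : L2} (hu : MemH1 u) :
    density u =ᵐ[volume] fun x => ((‖u x‖ ^ 2 : ℝ) : ℂ) := by
  rw [density, dif_pos hu.memLp_density]
  exact MemLp.coeFn_toLp _

theorem MemH1.norm_sq_density {u : L2} (hu : MemH1 u) :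
    ‖density u‖ ^ 2 = ∫ x, ‖u x‖ ^ 4 := by
  rw [norm_sq_eq_integral]
  refine integral_congr_ae ?_
  filter_upwards [hu.coeFn_density] with x hx
  rw [hx, Complex.norm_real, Real.norm_eq_abs, sq_abs]
  ring

theorem integrable_density (u : L2) :
    Integrable (fun x => ((‖u x‖ ^ 2 : ℝ) : ℂ)) (volume : Measure Space) :=
  (integrable_norm_sq u).ofReal

theorem MemH1.fourier_density_ae_eq {u : L2} (hu : MemH1 u) :
    (𝓕 (density u) : L2) =ᵐ[volume] 𝓕 (fun x => ((‖u x‖ ^ 2 : ℝ) : ℂ)) := by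
  have := fourier_toLp_ae_eq (integrable_density u) hu.memLp_density
  rwa [density, dif_pos hu.memLp_density]

/-- The symbol `l₁ + l₂ K̂` of the interaction. -/
def symbol (l₁ l₂ : ℝ) (ξ : Space) : ℝ := l₁ + l₂ * dipoleHat ξ

theorem dipoleHat_le (ξ : Space) : dipoleHat ξ ≤ 8 * Real.pi / 3 := by
  have hn : ‖ξ‖ ^ 2 = ξ 0 ^ 2 + ξ 1 ^ 2 + ξ 2 ^ 2 := by
    rw [EuclideanSpace.real_norm_sq_eq, Fin.sum_univ_three]
  have h : (2 * ξ 2 ^ 2 - ξ 0 ^ 2 - ξ 1 ^ 2) / ‖ξ‖ ^ 2 ≤ 2 := by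
    refine div_le_of_le_mul₀ (sq_nonneg _) (by norm_num) ?_
    nlinarith [sq_nonneg (ξ 0), sq_nonneg (ξ 1)]
  rw [dipoleHat]
  nlinarith [Real.pi_pos]

theorem le_dipoleHat (ξ : Space) : -(4 * Real.pi / 3) ≤ dipoleHat ξ := by
  have hn : ‖ξ‖ ^ 2 = ξ 0 ^ 2 + ξ 1 ^ 2 + ξ 2 ^ 2 := by
    rw [EuclideanSpace.real_norm_sq_eq, Fin.sum_univ_three]
  have h : -1 ≤ (2 * ξ 2 ^ 2 - ξ 0 ^ 2 - ξ 1 ^ 2) / ‖ξ‖ ^ 2 := by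
    rcases (sq_nonneg ‖ξ‖).eq_or_lt with h0 | h0
    · rw [← h0, div_zero]; norm_num
    · rw [le_div_iff₀ h0]
      nlinarith [sq_nonneg (ξ 2)]
  rw [dipoleHat]
  nlinarith [Real.pi_pos]

/-- An upper bound for the modulus of the symbol. -/
def symbolBound (l₁ l₂ : ℝ) : ℝ := |l₁| + |l₂| * (8 * Real.pi / 3)

theorem symbolBound_nonneg (l₁ l₂ : ℝ) : 0 ≤ symbolBound l₁ l₂ := by
  have := Real.pi_pos
  unfold symbolBound; positivity

theorem abs_symbol_le (l₁ l₂ : ℝ) (ξ : Space) : |symbol l₁ l₂ ξ| ≤ symbolBound l₁ l₂ := by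
  refine (abs_add_le _ _).trans ?_
  rw [abs_mul, symbolBound]
  gcongr
  rw [abs_le]
  constructor
  · linarith [le_dipoleHat ξ, Real.pi_pos]
  · exact dipoleHat_le ξ

theorem measurable_symbol (l₁ l₂ : ℝ) : Measurable (symbol l₁ l₂) := by
  unfold symbol dipoleHat
  fun_prop

/-- The quadratic form on `L²` with Fourier symbol `l₁ + l₂ K̂`. -/
def form (l₁ l₂ : ℝ) (f : L2) : ℝ := ∫ ξ, symbol l₁ l₂ ξ * ‖(𝓕 f : L2) ξ‖ ^ 2

theorem memLp_symbol_mul (l₁ l₂ : ℝ) (f : L2) :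
    MemLp (fun ξ => (symbol l₁ l₂ ξ : ℂ) * f ξ) 2 (volume : Measure Space) := by
  refine MemLp.of_le_mul (c := symbolBound l₁ l₂) (Lp.memLp f) ?_ (Eventually.of_forall fun ξ => ?_)
  · exact (Complex.measurable_ofReal.comp (measurable_symbol l₁ l₂)).aestronglyMeasurable.mul
      (Lp.aestronglyMeasurable f)
  · rw [norm_mul, Complex.norm_real, Real.norm_eq_abs]
    gcongr
    exact abs_symbol_le l₁ l₂ ξ

/-- The element of `L²` with Fourier transform `(l₁ + l₂ K̂) 𝓕 f`. -/
def formGradient (l₁ l₂ : ℝ) (f : L2) : L2 := 𝓕⁻ ((memLp_symbol_mul l₁ l₂ (𝓕 f)).toLp _ : L2)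

/-- `2 * formGradient l₁ l₂ f` is the derivative of `form l₁ l₂` at `f`. -/
theorem inner_formGradient (l₁ l₂ : ℝ) (f g : L2) :
    (inner ℂ (formGradient l₁ l₂ f) g).re =
      ∫ ξ, symbol l₁ l₂ ξ * (inner ℂ ((𝓕 f : L2) ξ) ((𝓕 g : L2) ξ)).re := by
  rw [formGradient, ← Lp.inner_fourier_eq, FourierTransform.fourier_fourierInv_eq, L2.inner_def]
  rw [← Complex.reCLM_apply, ← Complex.reCLM.integral_comp_comm (L2.integrable_inner _ _)]
  refine integral_congr_ae ?_
  filter_upwards [(memLp_symbol_mul l₁ l₂ (𝓕 f)).coeFn_toLp] with ξ hξ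
  rw [hξ, Complex.reCLM_apply, ← smul_eq_mul, inner_smul_left, Complex.conj_ofReal,
    Complex.re_ofReal_mul]

theorem integrable_symbol_mul (l₁ l₂ : ℝ) (f : L2) :
    Integrable (fun ξ => symbol l₁ l₂ ξ * ‖f ξ‖ ^ 2) (volume : Measure Space) :=
  (integrable_norm_sq f).bdd_mul (c := symbolBound l₁ l₂)
    (measurable_symbol l₁ l₂).aestronglyMeasurable
    (Eventually.of_forall fun ξ => abs_symbol_le l₁ l₂ ξ)

theorem form_add (l₁ l₂ : ℝ) (f g : L2) :
    form l₁ l₂ (f + g) = form l₁ l₂ f + form l₁ l₂ g +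
      2 * (inner ℂ (formGradient l₁ l₂ f) g).re := by
  have hi : Integrable (fun ξ => symbol l₁ l₂ ξ *
      (inner ℂ ((𝓕 f : L2) ξ) ((𝓕 g : L2) ξ)).re) (volume : Measure Space) :=
    (L2.integrable_inner (𝕜 := ℂ) (𝓕 f : L2) (𝓕 g : L2)).re.bdd_mul (c := symbolBound l₁ l₂)
      (measurable_symbol l₁ l₂).aestronglyMeasurable
      (Eventually.of_forall fun ξ => abs_symbol_le l₁ l₂ ξ)
  have hfg : Integrable (fun ξ => symbol l₁ l₂ ξ * ‖(𝓕 f : L2) ξ‖ ^ 2 +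
      symbol l₁ l₂ ξ * ‖(𝓕 g : L2) ξ‖ ^ 2) (volume : Measure Space) :=
    (integrable_symbol_mul l₁ l₂ _).add (integrable_symbol_mul l₁ l₂ _)
  rw [inner_formGradient, form, form, form, ← integral_const_mul,
    ← integral_add (integrable_symbol_mul l₁ l₂ _) (integrable_symbol_mul l₁ l₂ _),
    ← integral_add hfg (hi.const_mul 2), FourierTransform.fourier_add]
  refine integral_congr_ae ?_
  filter_upwards [Lp.coeFn_add (𝓕 f : L2) (𝓕 g : L2)] with ξ hξ
  rw [hξ, Pi.add_apply, @norm_add_sq ℂ]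
  simp only [RCLike.re_eq_complex_re]
  ring

theorem abs_form_le (l₁ l₂ : ℝ) (f : L2) : |form l₁ l₂ f| ≤ symbolBound l₁ l₂ * ‖f‖ ^ 2 := by
  rw [← Lp.norm_fourier_eq f, norm_sq_eq_integral, ← integral_const_mul, form]
  rw [← Real.norm_eq_abs]
  refine norm_integral_le_of_norm_le ((integrable_norm_sq _).const_mul _)
    (Eventually.of_forall fun ξ => ?_)
  rw [norm_mul, Real.norm_eq_abs, norm_pow, norm_norm]
  gcongr
  exact abs_symbol_le l₁ l₂ ξ

theorem norm_formGradient_le (l₁ l₂ : ℝ) (f : L2) :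
    ‖formGradient l₁ l₂ f‖ ≤ symbolBound l₁ l₂ * ‖f‖ := by
  rw [formGradient, ← Lp.norm_fourier_eq, FourierTransform.fourier_fourierInv_eq,
    ← Lp.norm_fourier_eq f]
  refine Lp.norm_le_mul_norm_of_ae_le_mul ?_
  filter_upwards [(memLp_symbol_mul l₁ l₂ (𝓕 f)).coeFn_toLp] with ξ hξ
  rw [hξ, norm_mul, Complex.norm_real, Real.norm_eq_abs]
  gcongr
  exact abs_symbol_le l₁ l₂ ξ

/-- The factor `(2π)⁻³` in the interaction is the Jacobian of `ξ ↦ 2πξ`, by which the two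
conventions for the Fourier transform differ. -/
theorem MemH1.interaction_eq {u : L2} (hu : MemH1 u) (l₁ l₂ : ℝ) :
    interaction l₁ l₂ u = form l₁ l₂ (density u) := by
  have h2π : (0 : ℝ) < 2 * Real.pi := by positivity
  have h1 := Measure.integral_comp_smul (volume : Measure Space) (fun ξ => (l₁ + l₂ * dipoleHat ξ) *
      ‖fourierHat (fun x => ((‖u x‖ ^ 2 : ℝ) : ℂ)) ξ‖ ^ 2) (2 * Real.pi)
  rw [finrank_euclideanSpace, Fintype.card_fin, abs_of_pos (by positivity), smul_eq_mul] at h1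
  rw [interaction, one_div, ← h1, form]
  refine integral_congr_ae ?_
  filter_upwards [hu.fourier_density_ae_eq] with ξ hξ
  have h2 : dipoleHat ((2 * Real.pi) • ξ) = dipoleHat ξ := by
    rw [← dipoleHat_stretch_const _ h2π ξ]
    congr 1
  rw [hξ, fourierHat_smul, h2, symbol]

/-! ### Scaling laws -/

/-- The function `x ↦ u (x / t + y)`. -/
def dilate (t : ℝ) (ht : 0 < t) (y : Space) (u : L2) : L2 :=
  compAffine (fun _ => t⁻¹) (fun _ => inv_pos.2 ht) y u

section
variable {t : ℝ} (ht : 0 < t) (y : Space)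

theorem jac_inv : jac (fun _ => t⁻¹) (fun _ => inv_pos.2 ht) = t ^ 3 := by
  rw [jac_const, inv_pow, inv_inv]

theorem MemH1.dilate {u : L2} (hu : MemH1 u) : MemH1 (dilate t ht y u) := hu.compAffine _ _ _

theorem norm_sq_dilate (u : L2) : ‖dilate t ht y u‖ ^ 2 = t ^ 3 * ‖u‖ ^ 2 := by
  rw [dilate, norm_sq_compAffine, jac_inv ht]

theorem MemH1.kinetic_dilate {u : L2} (hu : MemH1 u) :
    kinetic (DipolarGP.dilate t ht y u) = t * kinetic u := by
  rw [DipolarGP.dilate, hu.kinetic_compAffine, jac_inv ht, ← Finset.mul_sum, kinetic]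
  field_simp

theorem interaction_dilate (l₁ l₂ : ℝ) (u : L2) :
    interaction l₁ l₂ (dilate t ht y u) = t ^ 3 * interaction l₁ l₂ u := by
  rw [dilate, interaction_compAffine, jac_inv ht]
  have h : ∀ ξ, dipoleHat (stretch (fun _ => t⁻¹) (fun _ => inv_pos.2 ht) ξ) = dipoleHat ξ :=
    dipoleHat_stretch_const _ (inv_pos.2 ht)
  simp only [h]
  rfl

theorem highOrder_dilate (l₃ p : ℝ) (u : L2) :
    highOrder l₃ p (dilate t ht y u) = t ^ 3 * highOrder l₃ p u := by
  rw [highOrder, dilate, integral_norm_rpow_compAffine, jac_inv ht, highOrder]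
  ring

/-- Dilations scale all terms of the energy like the mass, except for the kinetic energy. -/
theorem MemH1.energy_dilate {u : L2} (hu : MemH1 u) (l₁ l₂ l₃ p : ℝ) :
    energy l₁ l₂ l₃ p (DipolarGP.dilate t ht y u) =
      t ^ 3 * energy l₁ l₂ l₃ p u - (t ^ 3 - t) / 2 * kinetic u := by
  rw [energy, energy, hu.kinetic_dilate, interaction_dilate, highOrder_dilate]
  ring

end

theorem interaction_smul (l₁ l₂ s : ℝ) (u : L2) :
    interaction l₁ l₂ ((s : ℂ) • u) = s ^ 4 * interaction l₁ l₂ u := by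
  have h : ∀ ξ, fourierHat (fun x => ((‖((s : ℂ) • u : L2) x‖ ^ 2 : ℝ) : ℂ)) ξ =
      ((s ^ 2 : ℝ) : ℂ) * fourierHat (fun x => ((‖u x‖ ^ 2 : ℝ) : ℂ)) ξ := by
    intro ξ
    rw [fourierHat, fourierHat, ← integral_const_mul]
    refine integral_congr_ae ?_
    filter_upwards [Lp.coeFn_smul (s : ℂ) u] with x hx
    rw [hx, Pi.smul_apply, norm_smul, Complex.norm_real, Real.norm_eq_abs, mul_pow, sq_abs]
    push_cast
    ring
  simp only [interaction, h, norm_mul, Complex.norm_real, Real.norm_eq_abs, mul_pow, sq_abs,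
    mul_left_comm _ ((s ^ 2) ^ 2), integral_const_mul]
  ring

theorem MemH1.kinetic_smul {u : L2} (hu : MemH1 u) (s : ℝ) :
    kinetic ((s : ℂ) • u) = s ^ 2 * kinetic u := by
  simp only [kinetic, hu.weakPartial_smul, norm_smul, Complex.norm_real, Real.norm_eq_abs, mul_pow,
    sq_abs, Finset.mul_sum]

theorem highOrder_smul (l₃ p : ℝ) {s : ℝ} (hs : 0 ≤ s) (u : L2) :
    highOrder l₃ p ((s : ℂ) • u) = s ^ p * highOrder l₃ p u := by
  have : ∫ x, ‖((s : ℂ) • u : L2) x‖ ^ p = s ^ p * ∫ x, ‖u x‖ ^ p := by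
    rw [← integral_const_mul]
    refine integral_congr_ae ?_
    filter_upwards [Lp.coeFn_smul (s : ℂ) u] with x hx
    rw [hx, Pi.smul_apply, norm_smul, Complex.norm_real, Real.norm_eq_abs, abs_of_nonneg hs,
      Real.mul_rpow hs (norm_nonneg _)]
  rw [highOrder, this, highOrder]
  ring

theorem MemH1.energy_smul {u : L2} (hu : MemH1 u) (l₁ l₂ l₃ p : ℝ) {s : ℝ} (hs : 0 ≤ s) :
    energy l₁ l₂ l₃ p ((s : ℂ) • u) = 1 / 2 * (s ^ 2 * kinetic u) +
      1 / 2 * (s ^ 4 * interaction l₁ l₂ u) + 2 / p * (s ^ p * highOrder l₃ p u) := by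
  rw [energy, hu.kinetic_smul, interaction_smul, highOrder_smul _ _ hs]

theorem norm_sq_smul (s : ℝ) (u : L2) : ‖(s : ℂ) • u‖ ^ 2 = s ^ 2 * ‖u‖ ^ 2 := by
  rw [norm_smul, Complex.norm_real, Real.norm_eq_abs, mul_pow, sq_abs]

/-! ### Positivity and a priori bounds -/

theorem integral_norm_pow_pos {u : L2} (hu : MemH1 u) (h0 : u ≠ 0) {a : ℝ} (h2 : 2 ≤ a)
    (h6 : a ≤ 6) : 0 < ∫ x, ‖u x‖ ^ a := by
  refine lt_of_le_of_ne (integral_nonneg fun x => by positivity) fun h => h0 ?_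
  have h1 := (integral_eq_zero_iff_of_nonneg (fun x => by positivity)
    (hu.integrable_rpow h2 h6)).1 h.symm
  refine (Lp.eq_zero_iff_ae_eq_zero).2 ?_
  filter_upwards [h1] with x hx
  have := (Real.rpow_eq_zero (norm_nonneg _) (by linarith)).1 hx
  simpa using this

theorem MemH1.kinetic_pos {u : L2} (hu : MemH1 u) (h0 : u ≠ 0) : 0 < kinetic u := by
  obtain ⟨S, hS, h⟩ := exists_sobolev_const
  have h1 := integral_norm_pow_pos hu h0 (a := 6) (by norm_num) le_rfl
  simp only [Real.rpow_ofNat] at h1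
  refine lt_of_le_of_ne (kinetic_nonneg u) fun hk => ?_
  have := h u hu
  rw [← hk] at this
  norm_num at this
  linarith

theorem highOrder_nonneg {l₃ : ℝ} (hl₃ : 0 < l₃) (p : ℝ) (u : L2) : 0 ≤ highOrder l₃ p u :=
  mul_nonneg hl₃.le (integral_nonneg fun x => by positivity)

theorem MemH1.abs_interaction_le {u : L2} (hu : MemH1 u) (l₁ l₂ : ℝ) :
    |interaction l₁ l₂ u| ≤ symbolBound l₁ l₂ * ∫ x, ‖u x‖ ^ 4 := by
  rw [hu.interaction_eq, ← hu.norm_sq_density]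
  exact abs_form_le _ _ _

theorem interaction_nonneg {l₁ l₂ : ℝ} (h : ∀ ξ, 0 ≤ symbol l₁ l₂ ξ) (u : L2) :
    0 ≤ interaction l₁ l₂ u := by
  refine mul_nonneg (by positivity) (integral_nonneg fun ξ => ?_)
  exact mul_nonneg (h ξ) (sq_nonneg _)

/-- Holds because the exponent four lies strictly between two and `p`. -/
theorem pow_four_le {p δ : ℝ} (hp : 4 < p) (hδ : 0 < δ) : ∃ K : ℝ, 0 < K ∧ ∀ t : ℝ, 0 ≤ t →
    t ^ 4 ≤ δ * t ^ p + K * t ^ 2 := by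
  set τ : ℝ := δ⁻¹ ^ (p - 4)⁻¹ with hτ
  have hτ0 : 0 < τ := by positivity
  refine ⟨τ ^ 2, by positivity, fun t ht => ?_⟩
  rcases le_total t τ with h | h
  · have h1 : t ^ 4 ≤ τ ^ 2 * t ^ 2 := by
      calc t ^ 4 = t ^ 2 * t ^ 2 := by ring
        _ ≤ τ ^ 2 * t ^ 2 := by gcongr
    have : 0 ≤ δ * t ^ p := by positivity
    linarith
  · have ht0 : 0 < t := hτ0.trans_le h
    have h1 : δ⁻¹ ≤ t ^ (p - 4) := by
      have := Real.rpow_le_rpow hτ0.le h (by linarith : 0 ≤ p - 4)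
      rwa [hτ, ← Real.rpow_mul (by positivity), inv_mul_cancel₀ (by linarith),
        Real.rpow_one] at this
    have h2 : t ^ p = t ^ (p - 4) * t ^ 4 := by
      rw [← Real.rpow_natCast t 4, ← Real.rpow_add ht0]; norm_num
    have h3 : 1 ≤ δ * t ^ (p - 4) := by
      calc (1 : ℝ) = δ * δ⁻¹ := (mul_inv_cancel₀ hδ.ne').symm
        _ ≤ _ := by gcongr
    have h4 : t ^ 4 ≤ δ * t ^ p := by
      rw [h2, ← mul_assoc]
      exact le_mul_of_one_le_left (by positivity) h3
    have : 0 ≤ τ ^ 2 * t ^ 2 := by positivity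
    linarith

/-- The `L⁴` norm is controlled by a small multiple of the term of order `p` and the mass. -/
theorem integral_pow_four_le {p δ : ℝ} (hp : 4 < p) (hp6 : p ≤ 6) (hδ : 0 < δ) :
    ∃ K : ℝ, 0 < K ∧ ∀ u : L2, MemH1 u →
      ∫ x, ‖u x‖ ^ 4 ≤ δ * (∫ x, ‖u x‖ ^ p) + K * ‖u‖ ^ 2 := by
  obtain ⟨K, hK, h⟩ := pow_four_le hp hδ
  refine ⟨K, hK, fun u hu => ?_⟩
  rw [norm_sq_eq_integral, ← integral_const_mul, ← integral_const_mul,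
    ← integral_add ((hu.integrable_rpow (by linarith) hp6).const_mul _)
      ((integrable_norm_sq u).const_mul _)]
  refine integral_mono (hu.integrable_pow (by norm_num) (by norm_num))
    (((hu.integrable_rpow (by linarith) hp6).const_mul _).add
      ((integrable_norm_sq u).const_mul _)) fun x => ?_
  exact h _ (norm_nonneg _)

/-- Coercivity of the energy at fixed mass: the term of order `p` absorbs the interaction. -/
theorem exists_energy_coercive (l₁ l₂ : ℝ) {l₃ p : ℝ} (hl₃ : 0 < l₃) (hp : 4 < p) (hp6 : p ≤ 6) :
    ∃ K : ℝ, 0 < K ∧ ∀ u : L2, MemH1 u →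
      1 / 2 * kinetic u - K * ‖u‖ ^ 2 ≤ energy l₁ l₂ l₃ p u := by
  set M := symbolBound l₁ l₂ + 1 with hM
  have hM0 : 0 < M := by have := symbolBound_nonneg l₁ l₂; linarith
  obtain ⟨K, hK, h⟩ := integral_pow_four_le (δ := 2 / p * l₃ / M) hp hp6 (by positivity)
  refine ⟨M * K, by positivity, fun u hu => ?_⟩
  have h1 := h u hu
  have h2 := neg_le_of_abs_le (hu.abs_interaction_le l₁ l₂)
  have h4 : 0 ≤ ∫ x, ‖u x‖ ^ 4 := integral_nonneg fun x => by positivity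
  have h3 : M * ∫ x, ‖u x‖ ^ 4 ≤ 2 / p * l₃ * (∫ x, ‖u x‖ ^ p) + M * K * ‖u‖ ^ 2 := by
    calc M * ∫ x, ‖u x‖ ^ 4 ≤ M * (2 / p * l₃ / M * (∫ x, ‖u x‖ ^ p) + K * ‖u‖ ^ 2) := by gcongr
      _ = _ := by field_simp
  have h5 : symbolBound l₁ l₂ * ∫ x, ‖u x‖ ^ 4 ≤ M * ∫ x, ‖u x‖ ^ 4 := by
    gcongr; linarith
  have h6 : 2 / p * highOrder l₃ p u = 2 / p * l₃ * (∫ x, ‖u x‖ ^ p) := by rw [highOrder]; ring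
  have h7 : 0 ≤ M * ∫ x, ‖u x‖ ^ 4 := by positivity
  rw [energy, h6]
  linarith

/-- At small mass the kinetic energy and the term of order `p` dominate the interaction: if the
kinetic energy is at least one, by interpolation between the mass and the term of order `p`, and
otherwise by interpolation between the mass and the Sobolev inequality. -/
theorem exists_energy_nonneg_of_small_mass (l₁ l₂ : ℝ) {l₃ p : ℝ} (hl₃ : 0 < l₃) (hp : 4 < p)
    (hp6 : p ≤ 6) : ∃ c₀ : ℝ, 0 < c₀ ∧ ∀ u : L2, MemH1 u → ‖u‖ ^ 2 ≤ c₀ →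
      0 ≤ energy l₁ l₂ l₃ p u := by
  set M := symbolBound l₁ l₂ + 1 with hM
  have hM0 : 0 < M := by have := symbolBound_nonneg l₁ l₂; linarith
  obtain ⟨K, hK, h⟩ := integral_pow_four_le (δ := 4 / p * l₃ / M) hp hp6 (by positivity)
  obtain ⟨S, hS, hSob⟩ := exists_sobolev_const
  refine ⟨min (1 / (M * K)) (1 / (M ^ 2 * S)), by positivity, fun u hu hc => ?_⟩
  have hA := kinetic_nonneg u
  have hC := highOrder_nonneg hl₃ p u
  have h4 : 0 ≤ ∫ x, ‖u x‖ ^ 4 := integral_nonneg fun x => by positivity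
  have h5 : symbolBound l₁ l₂ * ∫ x, ‖u x‖ ^ 4 ≤ M * ∫ x, ‖u x‖ ^ 4 := by
    gcongr; linarith
  have h2 := neg_le_of_abs_le (hu.abs_interaction_le l₁ l₂)
  suffices hmain : M * ∫ x, ‖u x‖ ^ 4 ≤ kinetic u + 4 / p * highOrder l₃ p u by
    have : 2 / p * highOrder l₃ p u = 1 / 2 * (4 / p * highOrder l₃ p u) := by ring
    rw [energy, this]
    linarith
  have hc1 : M * K * ‖u‖ ^ 2 ≤ 1 := by
    have := hc.trans (min_le_left _ _)
    rwa [le_div_iff₀ (by positivity), mul_comm] at this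
  have hc2 : M ^ 2 * S * ‖u‖ ^ 2 ≤ 1 := by
    have := hc.trans (min_le_right _ _)
    rwa [le_div_iff₀ (by positivity), mul_comm] at this
  rcases le_total 1 (kinetic u) with h1 | h1
  · calc M * ∫ x, ‖u x‖ ^ 4 ≤ M * (4 / p * l₃ / M * (∫ x, ‖u x‖ ^ p) + K * ‖u‖ ^ 2) := by
          gcongr; exact h u hu
      _ = 4 / p * highOrder l₃ p u + M * K * ‖u‖ ^ 2 := by rw [highOrder]; field_simp
      _ ≤ _ := by linarith
  · -- Young's inequality with weight proportional to `kinetic u / ‖u‖ ^ 2`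
    rcases eq_or_ne u 0 with rfl | h0
    · have hz : ∫ x, ‖(0 : L2) x‖ ^ 4 = 0 := by
        rw [integral_eq_zero_of_ae]
        filter_upwards [Lp.coeFn_zero ℂ 2 (volume : Measure Space)] with x hx
        rw [hx]; simp
      rw [hz]
      have : 0 ≤ 4 / p * highOrder l₃ p 0 := by positivity
      linarith
    have hApos := hu.kinetic_pos h0
    have hm : 0 < ‖u‖ ^ 2 := by positivity
    set μ := kinetic u / (M * ‖u‖ ^ 2) with hμ
    have hμ0 : 0 < μ := by positivity
    have hY : ∀ t : ℝ, t ^ 4 ≤ μ / 2 * t ^ 2 + 1 / (2 * μ) * t ^ 6 := fun t => by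
      have : μ / 2 * t ^ 2 + 1 / (2 * μ) * t ^ 6 - t ^ 4 = t ^ 2 * (μ - t ^ 2) ^ 2 / (2 * μ) := by
        field_simp; ring
      have h0 : 0 ≤ t ^ 2 * (μ - t ^ 2) ^ 2 / (2 * μ) := by positivity
      linarith
    have hI : ∫ x, ‖u x‖ ^ 4 ≤ μ / 2 * ‖u‖ ^ 2 + 1 / (2 * μ) * ∫ x, ‖u x‖ ^ 6 := by
      rw [norm_sq_eq_integral, ← integral_const_mul, ← integral_const_mul,
        ← integral_add ((integrable_norm_sq u).const_mul _) (hu.integrable_norm_six.const_mul _)]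
      exact integral_mono (hu.integrable_pow (by norm_num) (by norm_num))
        (((integrable_norm_sq u).const_mul _).add (hu.integrable_norm_six.const_mul _))
        fun x => hY _
    have hI2 : ∫ x, ‖u x‖ ^ 4 ≤ μ / 2 * ‖u‖ ^ 2 + 1 / (2 * μ) * (S * kinetic u ^ 3) := by
      refine hI.trans ?_
      gcongr
      exact hSob u hu
    have e1 : M * (μ / 2 * ‖u‖ ^ 2) = kinetic u / 2 := by rw [hμ]; field_simp
    have e2 : M * (1 / (2 * μ) * (S * kinetic u ^ 3)) =
        (M ^ 2 * S * ‖u‖ ^ 2) * kinetic u * (kinetic u / 2) := by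
      rw [hμ]; field_simp
    have e3 : (M ^ 2 * S * ‖u‖ ^ 2) * kinetic u ≤ 1 := mul_le_one₀ hc2 hA h1
    have e4 : (M ^ 2 * S * ‖u‖ ^ 2) * kinetic u * (kinetic u / 2) ≤ 1 * (kinetic u / 2) := by
      gcongr
    have e5 : 0 ≤ 4 / p * highOrder l₃ p u := by positivity
    have e6 : M * ∫ x, ‖u x‖ ^ 4 ≤
        M * (μ / 2 * ‖u‖ ^ 2 + 1 / (2 * μ) * (S * kinetic u ^ 3)) := by gcongr
    rw [mul_add, e1, e2] at e6
    linarith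

/-! ### The infimum of the energy -/

theorem exists_memH1_ne_zero : ∃ u : L2, MemH1 u ∧ u ≠ 0 := by
  have h₁ : HasCompactSupport (Complex.ofRealCLM ∘ cutoff) :=
    cutoff.hasCompactSupport.comp_left rfl
  have h₂ : ContDiff ℝ ((⊤ : ℕ∞) : WithTop ℕ∞) (Complex.ofRealCLM ∘ cutoff) :=
    Complex.ofRealCLM.contDiff.comp cutoff.contDiff
  let φ : 𝓢(Space, ℂ) := h₁.toSchwartzMap h₂
  refine ⟨φ.toLp 2 volume, memH1_of_isWeakPartial fun i => isWeakPartial_toLp φ i, fun h => ?_⟩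
  have h0 : φ = 0 := by
    apply SchwartzMap.injective_toLp (E := Space) (F := ℂ) 2 volume
    exact h.trans (map_zero (SchwartzMap.toLpCLM ℂ (E := Space) ℂ 2 volume)).symm
  have h1 : φ 0 = 1 := by
    change ((cutoff 0 : ℝ) : ℂ) = 1
    rw [cutoff.one_of_mem_closedBall (by simp [cutoff]), Complex.ofReal_one]
  rw [h0] at h1
  simp at h1

/-- Spreading out a function of fixed mass makes its energy arbitrarily small. -/
theorem exists_energy_lt (l₁ l₂ l₃ : ℝ) {p c ε : ℝ} (hp : 4 < p) (hc : 0 < c) (hε : 0 < ε) :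
    ∃ v ∈ massSphere c, energy l₁ l₂ l₃ p v < ε := by
  obtain ⟨u, hu, hu0⟩ := exists_memH1_ne_zero
  have hm : 0 < ‖u‖ ^ 2 := by positivity
  set k := c / ‖u‖ ^ 2 with hk
  have hk0 : 0 < k := by positivity
  -- the mass-preserving dilation of parameter `s⁻¹`
  have key : ∀ s : ℝ, 0 < s → ∃ v ∈ massSphere c, energy l₁ l₂ l₃ p v =
      1 / 2 * (k * s ^ 2 * kinetic u) + 1 / 2 * (k ^ 2 * s ^ 3 * interaction l₁ l₂ u) +
        2 / p * (k * (√(k * s ^ 3)) ^ (p - 2) * highOrder l₃ p u) := by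
    intro s hs
    have ht : 0 < s⁻¹ := inv_pos.2 hs
    have hD := hu.dilate ht 0
    set r := √(k * s ^ 3) with hr
    have hr0 : 0 < r := Real.sqrt_pos.2 (by positivity)
    have hr2 : r ^ 2 = k * s ^ 3 := Real.sq_sqrt (by positivity)
    refine ⟨(r : ℂ) • dilate s⁻¹ ht 0 u, ⟨hD.smul _, ?_⟩, ?_⟩
    · rw [norm_sq_smul, norm_sq_dilate, hr2, hk]
      field_simp
    · have hrp : r ^ p = r ^ (p - 2) * (k * s ^ 3) := by
        rw [← hr2, ← Real.rpow_natCast r 2, ← Real.rpow_add hr0]; norm_num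
      rw [hD.energy_smul _ _ _ _ hr0.le, hu.kinetic_dilate, interaction_dilate, highOrder_dilate,
        hrp, show r ^ 4 = (r ^ 2) ^ 2 by ring, hr2]
      field_simp
  have hlim : Tendsto (fun s : ℝ => 1 / 2 * (k * s ^ 2 * kinetic u) +
      1 / 2 * (k ^ 2 * s ^ 3 * interaction l₁ l₂ u) +
        2 / p * (k * (√(k * s ^ 3)) ^ (p - 2) * highOrder l₃ p u)) (𝓝[>] 0) (𝓝 0) := by
    have hcont : Continuous fun s : ℝ => 1 / 2 * (k * s ^ 2 * kinetic u) +
      1 / 2 * (k ^ 2 * s ^ 3 * interaction l₁ l₂ u) +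
        2 / p * (k * (√(k * s ^ 3)) ^ (p - 2) * highOrder l₃ p u) := by
      have : Continuous fun s : ℝ => (√(k * s ^ 3)) ^ (p - 2) :=
        Continuous.rpow_const (by fun_prop) fun _ => Or.inr (by linarith)
      fun_prop
    have h := hcont.tendsto 0
    have h0 : (0 : ℝ) ^ (p - 2) = 0 := Real.zero_rpow (by linarith)
    simp only [ne_eq, OfNat.ofNat_ne_zero, not_false_eq_true, zero_pow, mul_zero, zero_mul,
      Real.sqrt_zero, h0, add_zero] at h
    exact h.mono_left nhdsWithin_le_nhds
  obtain ⟨s, hs, hs0⟩ := ((hlim.eventually (gt_mem_nhds hε)).and self_mem_nhdsWithin).exists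
  obtain ⟨v, hv, hE⟩ := key s hs0
  exact ⟨v, hv, hE ▸ hs⟩

theorem infEnergy_le_zero (l₁ l₂ l₃ : ℝ) {p c : ℝ} (hp : 4 < p) (hc : 0 < c) :
    infEnergy l₁ l₂ l₃ p c ≤ 0 := by
  refine EReal.le_of_forall_lt_iff_le.1 fun z hz => ?_
  have hz' : 0 < z := by exact_mod_cast hz
  obtain ⟨v, hv, hE⟩ := exists_energy_lt l₁ l₂ l₃ hp hc hz'
  exact (iInf₂_le v hv).trans (by exact_mod_cast hE.le)

theorem infEnergy_eq_zero_iff (l₁ l₂ l₃ : ℝ) {p c : ℝ} (hp : 4 < p) (hc : 0 < c) :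
    infEnergy l₁ l₂ l₃ p c = 0 ↔ ∀ u ∈ massSphere c, 0 ≤ energy l₁ l₂ l₃ p u := by
  constructor
  · intro h u hu
    have : infEnergy l₁ l₂ l₃ p c ≤ (energy l₁ l₂ l₃ p u : EReal) := iInf₂_le u hu
    rw [h] at this
    exact_mod_cast this
  · intro h
    refine le_antisymm (infEnergy_le_zero _ _ _ hp hc) (le_iInf₂ fun u hu => ?_)
    exact_mod_cast h u hu

theorem mem_zeroSet_iff (l₁ l₂ l₃ : ℝ) {p c : ℝ} (hp : 4 < p) :
    c ∈ zeroSet l₁ l₂ l₃ p ↔ 0 < c ∧ ∀ u ∈ massSphere c, 0 ≤ energy l₁ l₂ l₃ p u :=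
  and_congr_right fun hc => infEnergy_eq_zero_iff l₁ l₂ l₃ hp hc

/-- If the energy is positive on `S(c)`, then its infimum zero is not attained. -/
theorem not_exists_isMinimizer (l₁ l₂ l₃ : ℝ) {p c : ℝ} (hp : 4 < p) (hc : 0 < c)
    (h : ∀ u ∈ massSphere c, 0 < energy l₁ l₂ l₃ p u) :
    ¬ ∃ u, IsMinimizer l₁ l₂ l₃ p c u := by
  rintro ⟨u, hu, hmin⟩
  obtain ⟨v, hv, hlt⟩ := exists_energy_lt l₁ l₂ l₃ hp hc (h u hu)
  exact absurd (isMinOn_iff.1 hmin v hv) (not_le.2 hlt)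

theorem ne_zero_of_mem_massSphere {c : ℝ} (hc : 0 < c) {u : L2} (hu : u ∈ massSphere c) :
    u ≠ 0 := by
  rintro rfl
  have := hu.2
  simp at this
  linarith

theorem energy_pos_of_symbol_nonneg {l₁ l₂ l₃ p : ℝ} (hl₃ : 0 < l₃) (hp : 4 < p)
    (hs : ∀ ξ, 0 ≤ symbol l₁ l₂ ξ) {u : L2} (hu : MemH1 u) (h0 : u ≠ 0) :
    0 < energy l₁ l₂ l₃ p u := by
  have h1 := hu.kinetic_pos h0
  have h2 := interaction_nonneg hs u
  have h3 := highOrder_nonneg hl₃ p u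
  rw [energy]
  positivity

theorem symbol_nonneg {l₁ l₂ : ℝ} (h : (0 ≤ l₂ ∧ 0 ≤ l₁ - 4 * Real.pi / 3 * l₂) ∨
    (l₂ < 0 ∧ 0 ≤ l₁ + 8 * Real.pi / 3 * l₂)) (ξ : Space) : 0 ≤ symbol l₁ l₂ ξ := by
  have h1 := dipoleHat_le ξ
  have h2 := le_dipoleHat ξ
  unfold symbol
  rcases h with ⟨h3, h4⟩ | ⟨h3, h4⟩ <;> nlinarith

/-- Dilating a nonzero function to a larger mass strictly decreases its energy per unit of mass:
the kinetic energy grows like `t`, the mass and the other terms like `t ^ 3`. -/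
theorem exists_energy_lt_of_dilate {l₁ l₂ l₃ p : ℝ} {u : L2} (hu : MemH1 u) (h0 : u ≠ 0) {c : ℝ}
    (hc : ‖u‖ ^ 2 < c) : ∃ v ∈ massSphere c,
      energy l₁ l₂ l₃ p v < c / ‖u‖ ^ 2 * energy l₁ l₂ l₃ p u := by
  have hm : 0 < ‖u‖ ^ 2 := by positivity
  have hq : 1 < c / ‖u‖ ^ 2 := (one_lt_div hm).2 hc
  set t := (c / ‖u‖ ^ 2) ^ ((1 : ℝ) / 3) with ht
  have ht1 : 1 < t := Real.one_lt_rpow hq (by norm_num)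
  have ht0 : 0 < t := by linarith
  have ht3 : t ^ 3 = c / ‖u‖ ^ 2 := by
    rw [ht, ← Real.rpow_natCast, ← Real.rpow_mul (by linarith)]; norm_num
  refine ⟨dilate t ht0 0 u, ⟨hu.dilate _ _, ?_⟩, ?_⟩
  · rw [norm_sq_dilate, ht3]; field_simp
  · rw [hu.energy_dilate, ht3, ← ht3]
    have : 0 < (t ^ 3 - t) / 2 * kinetic u := by
      have h1 := hu.kinetic_pos h0
      have : t < t ^ 3 := by
        nlinarith [mul_pos (mul_pos ht0 (sub_pos.2 ht1)) (by linarith : 0 < t + 1)]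
      have : 0 < t ^ 3 - t := by linarith
      positivity
    linarith

/-! ### Negative energies -/

theorem ae_coord_ne_zero (i : Fin 3) : ∀ᵐ ξ : Space, ξ i ≠ 0 := by
  let s : Submodule ℝ Space := ((EuclideanSpace.proj i : Space →L[ℝ] ℝ) : Space →ₗ[ℝ] ℝ).ker
  have hs : s ≠ ⊤ := fun h => by
    have : basisVec i ∈ s := h ▸ Submodule.mem_top
    simp [s, basisVec] at this
  have := Measure.addHaar_submodule (volume : Measure Space) s hs
  rw [ae_iff]
  convert! this using 2
  ext ξ
  simp [s]

theorem tendsto_dipoleHat_cigar {ξ : Space} (hξ : ξ 0 ≠ 0) {d : ℕ → Fin 3 → ℝ}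
    (hd : ∀ n i, 0 < d n i) (h0 : ∀ n, d n 0 = 1) (h1 : ∀ n, d n 1 = 1)
    (h2 : Tendsto (fun n => d n 2) atTop (𝓝 0)) :
    Tendsto (fun n => dipoleHat (stretch (d n) (hd n) ξ)) atTop (𝓝 (-(4 * Real.pi / 3))) := by
  have hne : ξ 0 ^ 2 + ξ 1 ^ 2 + (0 * ξ 2) ^ 2 ≠ 0 := by positivity
  have h : Tendsto (fun n => 4 * Real.pi / 3 * ((2 * (d n 2 * ξ 2) ^ 2 - ξ 0 ^ 2 - ξ 1 ^ 2) /
      (ξ 0 ^ 2 + ξ 1 ^ 2 + (d n 2 * ξ 2) ^ 2))) atTop (𝓝 (4 * Real.pi / 3 *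
        ((2 * (0 * ξ 2) ^ 2 - ξ 0 ^ 2 - ξ 1 ^ 2) / (ξ 0 ^ 2 + ξ 1 ^ 2 + (0 * ξ 2) ^ 2)))) := by
    refine Tendsto.const_mul _ (Tendsto.div ?_ ?_ hne)
    · exact ((((h2.mul_const _).pow 2).const_mul 2).sub_const _).sub_const _
    · exact ((h2.mul_const _).pow 2).const_add _
  have e : 4 * Real.pi / 3 * ((2 * (0 * ξ 2) ^ 2 - ξ 0 ^ 2 - ξ 1 ^ 2) /
      (ξ 0 ^ 2 + ξ 1 ^ 2 + (0 * ξ 2) ^ 2)) = -(4 * Real.pi / 3) := by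
    rw [div_eq_of_eq_mul (b := ξ 0 ^ 2 + ξ 1 ^ 2 + (0 * ξ 2) ^ 2) (c := -1) hne (by ring)]
    ring
  rw [e] at h
  refine h.congr fun n => ?_
  rw [dipoleHat, EuclideanSpace.real_norm_sq_eq, Fin.sum_univ_three]
  simp [h0, h1]

theorem tendsto_dipoleHat_pancake {ξ : Space} (hξ : ξ 2 ≠ 0) {d : ℕ → Fin 3 → ℝ}
    (hd : ∀ n i, 0 < d n i) (h0 : Tendsto (fun n => d n 0) atTop (𝓝 0))
    (h1 : Tendsto (fun n => d n 1) atTop (𝓝 0)) (h2 : ∀ n, d n 2 = 1) :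
    Tendsto (fun n => dipoleHat (stretch (d n) (hd n) ξ)) atTop (𝓝 (8 * Real.pi / 3)) := by
  have hne : (0 * ξ 0) ^ 2 + (0 * ξ 1) ^ 2 + ξ 2 ^ 2 ≠ 0 := by positivity
  have h : Tendsto (fun n => 4 * Real.pi / 3 * ((2 * ξ 2 ^ 2 - (d n 0 * ξ 0) ^ 2 -
      (d n 1 * ξ 1) ^ 2) / ((d n 0 * ξ 0) ^ 2 + (d n 1 * ξ 1) ^ 2 + ξ 2 ^ 2))) atTop
      (𝓝 (4 * Real.pi / 3 * ((2 * ξ 2 ^ 2 - (0 * ξ 0) ^ 2 - (0 * ξ 1) ^ 2) /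
        ((0 * ξ 0) ^ 2 + (0 * ξ 1) ^ 2 + ξ 2 ^ 2)))) := by
    refine Tendsto.const_mul _ (Tendsto.div ?_ ?_ hne)
    · exact (((h0.mul_const _).pow 2).const_sub _).sub ((h1.mul_const _).pow 2)
    · exact (((h0.mul_const _).pow 2).add ((h1.mul_const _).pow 2)).add_const _
  have e : 4 * Real.pi / 3 * ((2 * ξ 2 ^ 2 - (0 * ξ 0) ^ 2 - (0 * ξ 1) ^ 2) /
        ((0 * ξ 0) ^ 2 + (0 * ξ 1) ^ 2 + ξ 2 ^ 2)) = 8 * Real.pi / 3 := by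
    rw [div_eq_of_eq_mul (b := (0 * ξ 0) ^ 2 + (0 * ξ 1) ^ 2 + ξ 2 ^ 2) (c := 2) hne (by ring)]
    ring
  rw [e] at h
  refine h.congr fun n => ?_
  rw [dipoleHat, EuclideanSpace.real_norm_sq_eq, Fin.sum_univ_three]
  simp [h2]

/-- If the symbol is negative in some direction, then stretching a fixed function in physical
space so that the frequencies of its density concentrate in that direction makes the interaction
negative. -/
theorem exists_interaction_neg {l₁ l₂ : ℝ} (h : (0 ≤ l₂ ∧ l₁ - 4 * Real.pi / 3 * l₂ < 0) ∨
    (l₂ < 0 ∧ l₁ + 8 * Real.pi / 3 * l₂ < 0)) : ∃ u : L2, MemH1 u ∧ interaction l₁ l₂ u < 0 := by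
  obtain ⟨u, hu, hu0⟩ := exists_memH1_ne_zero
  set F : Space → ℝ := fun ξ => ‖fourierHat (fun x => ((‖u x‖ ^ 2 : ℝ) : ℂ)) ξ‖ ^ 2 with hF
  have hε : Tendsto (fun n : ℕ => 1 / ((n : ℝ) + 1)) atTop (𝓝 0) :=
    tendsto_one_div_add_atTop_nhds_zero_nat
  obtain ⟨d, hd, m, hm, hlim⟩ : ∃ (d : ℕ → Fin 3 → ℝ) (hd : ∀ n i, 0 < d n i) (m : ℝ),
      l₁ + l₂ * m < 0 ∧ ∀ᵐ ξ : Space,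
        Tendsto (fun n => dipoleHat (stretch (d n) (hd n) ξ)) atTop (𝓝 m) := by
    rcases h with ⟨_, h2⟩ | ⟨_, h2⟩
    · refine ⟨fun n => ![1, 1, 1 / ((n : ℝ) + 1)], fun n i => ?_, -(4 * Real.pi / 3),
        by linarith, ?_⟩
      · fin_cases i <;> (simp; try positivity)
      · filter_upwards [ae_coord_ne_zero 0] with ξ hξ
        exact tendsto_dipoleHat_cigar hξ _ (fun n => rfl) (fun n => rfl) hε
    · refine ⟨fun n => ![1 / ((n : ℝ) + 1), 1 / ((n : ℝ) + 1), 1], fun n i => ?_,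
        8 * Real.pi / 3, by linarith, ?_⟩
      · fin_cases i <;> (simp; try positivity)
      · filter_upwards [ae_coord_ne_zero 2] with ξ hξ
        exact tendsto_dipoleHat_pancake hξ _ hε hε (fun n => rfl)
  have hFpos : 0 < ∫ ξ, F ξ := by
    have h1 : interaction 1 0 u = ∫ x, ‖u x‖ ^ 4 := by
      rw [hu.interaction_eq, ← hu.norm_sq_density, ← Lp.norm_fourier_eq, norm_sq_eq_integral, form]
      simp [symbol]
    have h2 : interaction 1 0 u = 1 / (2 * Real.pi) ^ 3 * ∫ ξ, F ξ := by
      simp [interaction, hF]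
    have h3 := integral_norm_pow_pos hu hu0 (a := 4) (by norm_num) (by norm_num)
    simp only [Real.rpow_ofNat] at h3
    rw [← h1, h2] at h3
    exact pos_of_mul_pos_right h3 (by positivity)
  have hFint : Integrable F volume := by
    by_contra hni
    rw [integral_undef hni] at hFpos
    exact lt_irrefl _ hFpos
  have hlim2 : Tendsto (fun n => ∫ ξ, symbol l₁ l₂ (stretch (d n) (hd n) ξ) * F ξ) atTop
      (𝓝 (∫ ξ, (l₁ + l₂ * m) * F ξ)) := by
    refine tendsto_integral_of_dominated_convergence (fun ξ => symbolBound l₁ l₂ * F ξ)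
      (fun n => ?_) (hFint.const_mul _) (fun n => Eventually.of_forall fun ξ => ?_) ?_
    · exact ((measurable_symbol l₁ l₂).comp
        (stretch (d n) (hd n)).continuous.measurable).aestronglyMeasurable.mul
          hFint.aestronglyMeasurable
    · rw [norm_mul, Real.norm_eq_abs, Real.norm_of_nonneg (sq_nonneg _)]
      exact mul_le_mul_of_nonneg_right (abs_symbol_le _ _ _) (sq_nonneg _)
    · filter_upwards [hlim] with ξ hξ
      exact ((hξ.const_mul l₂).const_add l₁).mul_const _
  have hneg : ∫ ξ, (l₁ + l₂ * m) * F ξ < 0 := by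
    rw [integral_const_mul]
    exact mul_neg_of_neg_of_pos hm hFpos
  obtain ⟨n, hn⟩ := (hlim2.eventually (gt_mem_nhds hneg)).exists
  refine ⟨compAffine (d n) (hd n) 0 u, hu.compAffine _ _ _, ?_⟩
  rw [interaction_compAffine]
  refine mul_neg_of_pos_of_neg (jac_pos _ _) (mul_neg_of_pos_of_neg (by positivity) hn)

theorem exists_energy_neg {l₁ l₂ : ℝ} (l₃ : ℝ) {p : ℝ} (hp : 4 < p)
    (h : (0 ≤ l₂ ∧ l₁ - 4 * Real.pi / 3 * l₂ < 0) ∨ (l₂ < 0 ∧ l₁ + 8 * Real.pi / 3 * l₂ < 0)) :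
    ∃ u : L2, MemH1 u ∧ energy l₁ l₂ l₃ p u < 0 := by
  obtain ⟨u, hu, hB⟩ := exists_interaction_neg h
  -- a small multiple of `u`, whose interaction dominates the term of order `p`
  obtain ⟨s, hs0, hs⟩ : ∃ s : ℝ, 0 < s ∧
      1 / 2 * (s ^ 4 * interaction l₁ l₂ u) + 2 / p * (s ^ p * highOrder l₃ p u) < 0 := by
    have hcont : Continuous fun s : ℝ => 1 / 2 * interaction l₁ l₂ u +
        2 / p * (s ^ (p - 4) * highOrder l₃ p u) := by
      have : Continuous fun s : ℝ => s ^ (p - 4) :=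
        Continuous.rpow_const continuous_id fun _ => Or.inr (by linarith)
      fun_prop
    have h1 := hcont.tendsto 0
    rw [Real.zero_rpow (by linarith), zero_mul, mul_zero, add_zero] at h1
    obtain ⟨s, hs, hs0⟩ := (((h1.mono_left nhdsWithin_le_nhds).eventually
      (gt_mem_nhds (by linarith : 1 / 2 * interaction l₁ l₂ u < 0))).and
        (self_mem_nhdsWithin (s := Set.Ioi 0))).exists
    refine ⟨s, hs0, ?_⟩
    have hs0' : (0 : ℝ) < s := hs0
    have h2 : s ^ p = s ^ (p - 4) * s ^ 4 := by
      rw [← Real.rpow_natCast s 4, ← Real.rpow_add hs0']; norm_num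
    rw [h2]
    have h3 : 0 < s ^ 4 := by positivity
    nlinarith
  set v : L2 := (s : ℂ) • u with hv
  have hvH : MemH1 v := hu.smul _
  set P := 1 / 2 * (s ^ 4 * interaction l₁ l₂ u) + 2 / p * (s ^ p * highOrder l₃ p u) with hP
  -- under dilation by `t`, the negative part grows like `t ^ 3`, the kinetic energy like `t`
  have hE : ∀ (t : ℝ) (ht : 0 < t), energy l₁ l₂ l₃ p (dilate t ht 0 v) =
      t * (t ^ 2 * P + 1 / 2 * kinetic v) := fun t ht => by
    rw [hvH.energy_dilate, energy, hv, interaction_smul, highOrder_smul _ _ hs0.le, hP]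
    ring
  have hk := kinetic_nonneg v
  set t := √((1 / 2 * kinetic v + 1) / -P) with ht
  have ht0 : 0 < t := Real.sqrt_pos.2 (div_pos (by linarith) (by linarith))
  refine ⟨dilate t ht0 0 v, hvH.dilate _ _, ?_⟩
  rw [hE, ht, Real.sq_sqrt (div_pos (by linarith) (by linarith)).le]
  refine mul_neg_of_pos_of_neg ht0 ?_
  have : (1 / 2 * kinetic v + 1) / -P * P = -(1 / 2 * kinetic v + 1) := by
    field_simp [hs.ne]
  rw [this]
  linarith

/-! ### Averages over balls -/

/-- The uniform probability measure on the ball of radius `r` about the origin. -/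
def ballMeasure (r : ℝ) : Measure Space :=
  (volume (Metric.ball (0 : Space) r))⁻¹ • volume.restrict (Metric.ball (0 : Space) r)

theorem isProbabilityMeasure_ballMeasure {r : ℝ} (hr : 0 < r) :
    IsProbabilityMeasure (ballMeasure r) := by
  refine ⟨?_⟩
  rw [ballMeasure, Measure.smul_apply, Measure.restrict_apply_univ, smul_eq_mul]
  exact ENNReal.inv_mul_cancel (Metric.measure_ball_pos _ _ hr).ne' measure_ball_lt_top.ne

/-- The average of `u` over the ball of radius `r` about `x`. -/
def ballAvg (r : ℝ) (u : L2) (x : Space) : ℂ := ∫ h, u (x + h) ∂(ballMeasure r)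

/-- The element of `L²` that represents `ballAvg r · x`. -/
def ballKernel (r : ℝ) (x : Space) : L2 :=
  indicatorConstLp 2 (measurableSet_ball (x := x) (ε := r)) measure_ball_lt_top.ne
    ((volume.real (Metric.ball (0 : Space) r))⁻¹ : ℂ)

theorem ballAvg_eq_inner (r : ℝ) (u : L2) (x : Space) :
    ballAvg r u x = inner ℂ (ballKernel r x) u := by
  have h1 : ∫ h in Metric.ball (0 : Space) r, u (x + h) = ∫ y in Metric.ball x r, u y := by
    have := (measurePreserving_add_left (volume : Measure Space) x).setIntegral_preimage_emb
      (measurableEmbedding_addLeft x) u (Metric.ball x r)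
    rw [← this]
    congr 2
    ext h
    simp [Metric.mem_ball, dist_eq_norm]
  rw [ballKernel, L2.inner_indicatorConstLp_eq_inner_setIntegral, ballAvg, ballMeasure,
    integral_smul_measure, h1, ENNReal.toReal_inv]
  simp [Measure.real, mul_comm]

theorem norm_ballKernel (r : ℝ) (x : Space) : ‖ballKernel r x‖ = ‖ballKernel r 0‖ := by
  rw [ballKernel, ballKernel, norm_indicatorConstLp (by norm_num) (by norm_num),
    norm_indicatorConstLp (by norm_num) (by norm_num), Measure.real, Measure.real,
    Measure.addHaar_ball_center volume x]

theorem norm_ballAvg_le (r : ℝ) (u : L2) (x : Space) :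
    ‖ballAvg r u x‖ ≤ ‖ballKernel r 0‖ * ‖u‖ := by
  rw [ballAvg_eq_inner, ← norm_ballKernel r x]
  exact norm_inner_le_norm _ _

theorem stronglyMeasurable_ballAvg {r : ℝ} (hr : 0 < r) (u : L2) :
    StronglyMeasurable (ballAvg r u) := by
  have := isProbabilityMeasure_ballMeasure hr
  have h : StronglyMeasurable (Function.uncurry fun x h : Space => u (x + h)) :=
    (Lp.stronglyMeasurable u).comp_measurable (by fun_prop)
  exact h.integral_prod_right

/-- The bound `MemH1.norm_translate_sub_le`, as an integral. -/
theorem lintegral_translate_sub_sq {u : L2} (hu : MemH1 u) (h : Space) :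
    ∫⁻ x, ‖u x - u (x + h)‖ₑ ^ 2 ≤ ENNReal.ofReal (‖h‖ ^ 2 * kinetic u) := by
  have h1 : ∫⁻ x, ‖u x - u (x + h)‖ₑ ^ 2 = ∫⁻ x, ‖(translate h u - u : L2) x‖ₑ ^ 2 := by
    refine lintegral_congr_ae ?_
    filter_upwards [coeFn_translate h u, Lp.coeFn_sub (translate h u) u] with x h1 h2
    rw [h2, Pi.sub_apply, h1, ← enorm_neg, neg_sub]
  have h2 : ∫⁻ x, ‖(translate h u - u : L2) x‖ₑ ^ 2 =
      ENNReal.ofReal (‖translate h u - u‖ ^ 2) := by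
    rw [norm_sq_eq_integral, ofReal_integral_eq_lintegral_ofReal (integrable_norm_sq _)
      (Eventually.of_forall fun x => by positivity)]
    refine lintegral_congr fun x => ?_
    rw [ENNReal.ofReal_pow (norm_nonneg _), ofReal_norm]
  rw [h1, h2]
  refine ENNReal.ofReal_le_ofReal ?_
  calc ‖translate h u - u‖ ^ 2 ≤ (‖h‖ * √(kinetic u)) ^ 2 := by
        gcongr; exact hu.norm_translate_sub_le h
    _ = _ := by rw [mul_pow, Real.sq_sqrt (kinetic_nonneg u)]

/-- A function in `H¹` is close to its averages over small balls, by Jensen's inequality and the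
bound for translations. -/
theorem MemH1.lintegral_sub_ballAvg_sq_le {u : L2} (hu : MemH1 u) {r : ℝ} (hr : 0 < r) :
    ∫⁻ x, ‖u x - ballAvg r u x‖ₑ ^ 2 ≤ ENNReal.ofReal (r ^ 2 * kinetic u) := by
  have := isProbabilityMeasure_ballMeasure hr
  have hm : StronglyMeasurable (Function.uncurry fun x h : Space => u (x + h)) :=
    (Lp.stronglyMeasurable u).comp_measurable (by fun_prop)
  have hm2 : Measurable (Function.uncurry fun x h : Space => ‖u x - u (x + h)‖ₑ ^ 2) :=
    ((((Lp.stronglyMeasurable u).measurable.comp measurable_fst).sub hm.measurable).enorm).pow_const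
      2
  have hpt : ∀ x, ‖u x - ballAvg r u x‖ₑ ^ 2 ≤
      ∫⁻ h, ‖u x - u (x + h)‖ₑ ^ 2 ∂(ballMeasure r) := by
    intro x
    have hmx : StronglyMeasurable fun h : Space => u (x + h) :=
      (Lp.stronglyMeasurable u).comp_measurable (by fun_prop)
    have hint : Integrable (fun h => u (x + h)) (ballMeasure r) := by
      refine Integrable.smul_measure ?_
        (ENNReal.inv_ne_top.2 (Metric.measure_ball_pos _ _ hr).ne')
      have h1 : LocallyIntegrable u (volume : Measure Space) :=
        (Lp.memLp u).locallyIntegrable (by norm_num)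
      have h2 : IntegrableOn u ((Homeomorph.addLeft x) '' Metric.ball 0 r) volume := by
        refine (h1.integrableOn_isCompact (isCompact_closedBall x r)).mono_set ?_
        rintro _ ⟨h, hh, rfl⟩
        simpa [dist_eq_norm] using (mem_ball_zero_iff.1 hh).le
      exact ((measurePreserving_add_left (volume : Measure Space) x).integrableOn_image
        (measurableEmbedding_addLeft x)).1 h2
    have e1 : u x - ballAvg r u x = ∫ h, (u x - u (x + h)) ∂(ballMeasure r) := by
      rw [integral_sub (integrable_const _) hint, integral_const, ballAvg]; simp
    rw [e1]
    have h3 : ‖∫ h, (u x - u (x + h)) ∂(ballMeasure r)‖ₑ ≤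
        eLpNorm (fun h => u x - u (x + h)) 2 (ballMeasure r) := by
      refine (enorm_integral_le_lintegral_enorm _).trans ?_
      rw [← eLpNorm_one_eq_lintegral_enorm]
      exact eLpNorm_le_eLpNorm_of_exponent_le (by norm_num)
        (stronglyMeasurable_const.sub hmx).aestronglyMeasurable
    refine (pow_le_pow_left₀ zero_le h3 2).trans (le_of_eq ?_)
    have h4 := eLpNorm_nnreal_pow_eq_lintegral (f := fun h => u x - u (x + h)) (p := 2)
      (μ := ballMeasure r) (by norm_num)
    simpa using h4
  calc ∫⁻ x, ‖u x - ballAvg r u x‖ₑ ^ 2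
      ≤ ∫⁻ x, (∫⁻ h, ‖u x - u (x + h)‖ₑ ^ 2 ∂(ballMeasure r)) := lintegral_mono hpt
    _ = ∫⁻ h, (∫⁻ x, ‖u x - u (x + h)‖ₑ ^ 2) ∂(ballMeasure r) :=
        lintegral_lintegral_swap hm2.aemeasurable
    _ ≤ ∫⁻ _, ENNReal.ofReal (r ^ 2 * kinetic u) ∂(ballMeasure r) := by
        refine lintegral_mono_ae ?_
        have : ∀ᵐ h ∂(ballMeasure r), h ∈ Metric.ball (0 : Space) r :=
          Measure.ae_smul_measure (ae_restrict_mem measurableSet_ball) _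
        filter_upwards [this] with h hh
        refine (lintegral_translate_sub_sq hu h).trans (ENNReal.ofReal_le_ofReal ?_)
        have := (mem_ball_zero_iff.1 hh).le
        have := kinetic_nonneg u
        gcongr
    _ = _ := by simp

theorem MemH1.integrable_sub_ballAvg_sq {u : L2} (hu : MemH1 u) {r : ℝ} (hr : 0 < r) :
    Integrable (fun x => ‖u x - ballAvg r u x‖ ^ 2) (volume : Measure Space) := by
  refine ⟨((Lp.stronglyMeasurable u).sub
    (stronglyMeasurable_ballAvg hr u)).norm.pow 2 |>.aestronglyMeasurable, ?_⟩
  refine lt_of_le_of_lt (le_of_eq ?_)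
    ((hu.lintegral_sub_ballAvg_sq_le hr).trans_lt ENNReal.ofReal_lt_top)
  refine lintegral_congr fun x => ?_
  rw [enorm_pow, enorm_norm]

theorem MemH1.integral_sub_ballAvg_sq_le {u : L2} (hu : MemH1 u) {r : ℝ} (hr : 0 < r) :
    ∫ x, ‖u x - ballAvg r u x‖ ^ 2 ≤ r ^ 2 * kinetic u := by
  have hk := kinetic_nonneg u
  rw [← ENNReal.ofReal_le_ofReal_iff (by positivity),
    ofReal_integral_eq_lintegral_ofReal (hu.integrable_sub_ballAvg_sq hr)
      (Eventually.of_forall fun x => by positivity)]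
  refine le_trans (le_of_eq (lintegral_congr fun x => ?_)) (hu.lintegral_sub_ballAvg_sq_le hr)
  rw [ENNReal.ofReal_pow (norm_nonneg _), ofReal_norm]

/-! ### Local compactness -/

/-- Weak convergence in `L²`. -/
def WeakTendsto (u : ℕ → L2) (v : L2) : Prop :=
  ∀ ℓ : L2 →L[ℂ] ℂ, Tendsto (fun n => ℓ (u n)) atTop (𝓝 (ℓ v))

theorem WeakTendsto.inner {u : ℕ → L2} {v : L2} (h : WeakTendsto u v) (w : L2) :
    Tendsto (fun n => inner ℂ w (u n)) atTop (𝓝 (inner ℂ w v)) := h (innerSL ℂ w)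

/-- A sequence bounded in `H¹` that tends weakly to zero together with its derivatives. -/
structure NullSeq (K : ℝ) (v : ℕ → L2) : Prop where
  memH1 : ∀ n, MemH1 (v n)
  mass_le : ∀ n, ‖v n‖ ^ 2 ≤ K
  kinetic_le : ∀ n, kinetic (v n) ≤ K
  weak : WeakTendsto v 0
  weak_partial : ∀ i, WeakTendsto (fun n => weakPartial (v n) i) 0

/-- Rellich's theorem: weakly null sequences in `H¹` converge to zero locally in `L²`. Their
averages over balls of a fixed radius converge pointwise and are uniformly bounded, and the error of
averaging is uniformly small in the radius. -/
theorem NullSeq.tendsto_local {K : ℝ} {v : ℕ → L2} (h : NullSeq K v) (R : ℝ) :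
    Tendsto (fun n => ∫ x in Metric.ball (0 : Space) R, ‖v n x‖ ^ 2) atTop (𝓝 0) := by
  have hK0 : 0 ≤ K := (sq_nonneg _).trans (h.mass_le 0)
  set B := Metric.ball (0 : Space) R
  have havg : ∀ r, 0 < r → Tendsto (fun n => ∫ x in B, ‖ballAvg r (v n) x‖ ^ 2) atTop (𝓝 0) := by
    intro r hr
    have h0 : ∫ x in B, (0 : ℝ) = 0 := by simp
    rw [← h0]
    refine tendsto_integral_of_dominated_convergence (fun _ => ‖ballKernel r 0‖ ^ 2 * K)
      (fun n => ((stronglyMeasurable_ballAvg hr (v n)).norm.pow 2).aestronglyMeasurable)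
      (integrableOn_const (by exact measure_ball_lt_top.ne))
      (fun n => Eventually.of_forall fun x => ?_)
      (Eventually.of_forall fun x => ?_)
    · rw [norm_pow, norm_norm]
      calc ‖ballAvg r (v n) x‖ ^ 2 ≤ (‖ballKernel r 0‖ * ‖v n‖) ^ 2 := by
            gcongr; exact norm_ballAvg_le _ _ _
        _ = ‖ballKernel r 0‖ ^ 2 * ‖v n‖ ^ 2 := by ring
        _ ≤ _ := by gcongr; exact h.mass_le n
    · have h1 := ((h.weak.inner (ballKernel r x)).norm).pow 2
      simp only [inner_zero_right, norm_zero, ne_eq, OfNat.ofNat_ne_zero, not_false_eq_true,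
        zero_pow] at h1
      refine h1.congr fun n => ?_
      rw [ballAvg_eq_inner]
  have hle : ∀ r, 0 < r → ∀ n, ∫ x in B, ‖v n x‖ ^ 2 ≤
      2 * (∫ x in B, ‖ballAvg r (v n) x‖ ^ 2) + 2 * (r ^ 2 * K) := by
    intro r hr n
    have hi1 : IntegrableOn (fun x => ‖ballAvg r (v n) x‖ ^ 2) B volume := by
      refine Integrable.mono' (g := fun _ => (‖ballKernel r 0‖ * ‖v n‖) ^ 2)
        (integrableOn_const (by exact measure_ball_lt_top.ne))
        ((stronglyMeasurable_ballAvg hr (v n)).norm.pow 2).aestronglyMeasurable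
        (Eventually.of_forall fun x => ?_)
      rw [norm_pow, norm_norm]
      gcongr
      exact norm_ballAvg_le _ _ _
    have hi2 := (h.memH1 n).integrable_sub_ballAvg_sq hr
    have h1 : ∫ x in B, ‖v n x‖ ^ 2 ≤ ∫ x in B, (2 * ‖ballAvg r (v n) x‖ ^ 2 +
        2 * ‖v n x - ballAvg r (v n) x‖ ^ 2) := by
      refine integral_mono (integrable_norm_sq _).integrableOn
        ((hi1.const_mul 2).add (hi2.integrableOn.const_mul 2)) fun x => ?_
      have h2 : ‖v n x‖ ≤ ‖ballAvg r (v n) x‖ + ‖v n x - ballAvg r (v n) x‖ := by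
        simpa using norm_add_le (ballAvg r (v n) x) (v n x - ballAvg r (v n) x)
      simp only
      nlinarith [norm_nonneg (v n x), sq_nonneg (‖ballAvg r (v n) x‖ - ‖v n x - ballAvg r (v n) x‖)]
    rw [integral_add (hi1.const_mul 2) (hi2.integrableOn.const_mul 2), integral_const_mul,
      integral_const_mul] at h1
    have h2 : ∫ x in B, ‖v n x - ballAvg r (v n) x‖ ^ 2 ≤ r ^ 2 * K :=
      (setIntegral_le_integral hi2 (Eventually.of_forall fun x => by positivity)).trans
        (((h.memH1 n).integral_sub_ballAvg_sq_le hr).trans (by gcongr; exact h.kinetic_le n))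
    linarith
  rw [Metric.tendsto_atTop]
  intro ε hε
  -- a radius for which the error of averaging is below `ε / 2`
  obtain ⟨r, hr, hrK⟩ : ∃ r : ℝ, 0 < r ∧ 2 * (r ^ 2 * K) < ε / 2 := by
    have hc : Tendsto (fun r : ℝ => 2 * (r ^ 2 * K)) (𝓝[>] 0) (𝓝 0) := by
      have : Continuous fun r : ℝ => 2 * (r ^ 2 * K) := by fun_prop
      have := this.tendsto 0
      simp only [ne_eq, OfNat.ofNat_ne_zero, not_false_eq_true, zero_pow, zero_mul,
        mul_zero] at this
      exact this.mono_left nhdsWithin_le_nhds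
    obtain ⟨r, h1, h2⟩ := ((hc.eventually (gt_mem_nhds (half_pos hε))).and
      self_mem_nhdsWithin).exists
    exact ⟨r, h2, h1⟩
  obtain ⟨N, hN⟩ := eventually_atTop.1 ((havg r hr).eventually
    (gt_mem_nhds (show (0 : ℝ) < ε / 4 by positivity)))
  refine ⟨N, fun n hn => ?_⟩
  rw [Real.dist_0_eq_abs, abs_of_nonneg (integral_nonneg fun x => by positivity)]
  linarith [hle r hr n, hN n hn]

/-! ### Vanishing of interaction integrals -/

/-- Powers below six are controlled by the square, up to a small multiple of `1 + t ^ 6`; the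
summand `1` allows for exponents below two, at the price of working on sets of finite measure. -/
theorem rpow_le_interpolate {a ε : ℝ} (ha : 0 < a) (ha6 : a < 6) (hε : 0 < ε) :
    ∃ C : ℝ, 0 < C ∧ ∀ t : ℝ, 0 ≤ t → t ^ a ≤ ε * (1 + t ^ 6) + C * t ^ 2 := by
  set τ := ε ^ a⁻¹ with hτ
  set T := ε⁻¹ ^ (6 - a)⁻¹ with hT
  have hτ0 : 0 < τ := by positivity
  have hT0 : 0 < T := by positivity
  refine ⟨T ^ a / τ ^ 2, by positivity, fun t ht => ?_⟩
  have h6 : 0 ≤ ε * t ^ 6 := by positivity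
  have h2 : 0 ≤ T ^ a / τ ^ 2 * t ^ 2 := by positivity
  rcases le_total t τ with h | h
  · have : t ^ a ≤ τ ^ a := by gcongr
    rw [hτ, ← Real.rpow_mul hε.le, inv_mul_cancel₀ ha.ne', Real.rpow_one] at this
    linarith
  have ht0 : 0 < t := hτ0.trans_le h
  rcases le_total t T with h' | h'
  · have h3 : t ^ a ≤ T ^ a := by gcongr
    have h4 : 1 ≤ t ^ 2 / τ ^ 2 := (one_le_div (by positivity)).2 (by gcongr)
    have h5 : T ^ a ≤ T ^ a / τ ^ 2 * t ^ 2 := by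
      rw [div_mul_eq_mul_div, mul_div_assoc]
      exact le_mul_of_one_le_right (by positivity) h4
    linarith
  · have h3 : ε⁻¹ ≤ t ^ (6 - a) := by
      have := Real.rpow_le_rpow hT0.le h' (by linarith : 0 ≤ 6 - a)
      rwa [hT, ← Real.rpow_mul (by positivity), inv_mul_cancel₀ (by linarith),
        Real.rpow_one] at this
    have h4 : t ^ 6 = t ^ (6 - a) * t ^ a := by
      rw [← Real.rpow_natCast t 6, ← Real.rpow_add ht0]; norm_num
    have h5 : 1 ≤ ε * t ^ (6 - a) := by
      calc (1 : ℝ) = ε * ε⁻¹ := (mul_inv_cancel₀ hε.ne').symm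
        _ ≤ _ := by gcongr
    have h7 : t ^ a ≤ ε * t ^ 6 := by
      rw [h4, ← mul_assoc]
      exact le_mul_of_one_le_left (by positivity) h5
    linarith

/-- Young's inequality with a small constant in front of one of the powers. -/
theorem young_small {q q' δ : ℝ} (hq : q.HolderConjugate q') (hδ : 0 < δ) :
    ∃ C : ℝ, 0 < C ∧ ∀ x y : ℝ, 0 ≤ x → 0 ≤ y → x * y ≤ C * x ^ q + δ * y ^ q' := by
  have hq0 := hq.pos
  have hq'0 := hq.symm.pos
  set l := δ ^ q'⁻¹ with hl
  have hl0 : 0 < l := by positivity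
  have hlq : l ^ q' = δ := by
    rw [hl, ← Real.rpow_mul hδ.le, inv_mul_cancel₀ hq'0.ne', Real.rpow_one]
  refine ⟨l⁻¹ ^ q, by positivity, fun x y hx hy => ?_⟩
  have h := Real.young_inequality_of_nonneg (a := l⁻¹ * x) (b := l * y) (by positivity)
    (by positivity) hq
  rw [Real.mul_rpow (by positivity) hx, Real.mul_rpow hl0.le hy, hlq] at h
  have h1 : l⁻¹ * x * (l * y) = x * y := by field_simp
  have h2 : l⁻¹ ^ q * x ^ q / q ≤ l⁻¹ ^ q * x ^ q := div_le_self (by positivity) hq.lt.le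
  have h3 : δ * y ^ q' / q' ≤ δ * y ^ q' := div_le_self (by positivity) hq.symm.lt.le
  linarith

section
variable {K : ℝ} {v : ℕ → L2}

theorem NullSeq.nonneg (h : NullSeq K v) : 0 ≤ K := (sq_nonneg _).trans (h.mass_le 0)

/-- Bounded sequences in `H¹` are bounded in `L^b` for `2 ≤ b ≤ 6`. -/
theorem NullSeq.exists_integral_rpow_le (h : NullSeq K v) :
    ∃ L : ℝ, 0 < L ∧ ∀ n (b : ℝ), 2 ≤ b → b ≤ 6 → ∫ x, ‖v n x‖ ^ b ≤ L := by
  obtain ⟨S, hS, hSob⟩ := exists_sobolev_const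
  have hK := h.nonneg
  refine ⟨K + S * K ^ 3 + 1, by positivity, fun n b h2 h6 => ?_⟩
  have hn := h.memH1 n
  have h1 : ∫ x, ‖v n x‖ ^ b ≤ ∫ x, (‖v n x‖ ^ 2 + ‖v n x‖ ^ 6) :=
    integral_mono (hn.integrable_rpow h2 h6) ((integrable_norm_sq _).add hn.integrable_norm_six)
      fun x => rpow_le_sq_add_six (norm_nonneg _) h2 h6
  rw [integral_add (integrable_norm_sq _) hn.integrable_norm_six, ← norm_sq_eq_integral] at h1
  have h3 : ∫ x, ‖v n x‖ ^ 6 ≤ S * K ^ 3 := by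
    refine (hSob _ hn).trans ?_
    have := kinetic_nonneg (v n)
    gcongr
    exact h.kinetic_le n
  linarith [h.mass_le n]

theorem integrableOn_ball_rpow {u : L2} (hu : MemH1 u) {a : ℝ} (ha : 0 < a) (ha6 : a < 6) (R : ℝ) :
    IntegrableOn (fun x => ‖u x‖ ^ a) (Metric.ball 0 R) volume := by
  obtain ⟨C, hC, h⟩ := rpow_le_interpolate ha ha6 one_pos
  have hc : IntegrableOn (fun _ : Space => (1 : ℝ)) (Metric.ball 0 R) volume :=
    integrableOn_const (by exact measure_ball_lt_top.ne)
  refine (((hc.add hu.integrable_norm_six.integrableOn).const_mul 1).add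
    ((integrable_norm_sq u).integrableOn.const_mul C)).mono'
    (((Lp.aestronglyMeasurable u).norm.aemeasurable.pow_const a).aestronglyMeasurable.restrict)
    (Eventually.of_forall fun x => ?_)
  rw [Real.norm_of_nonneg (by positivity)]
  exact h _ (norm_nonneg _)

theorem NullSeq.tendsto_local_rpow (h : NullSeq K v) {a : ℝ} (ha : 0 < a) (ha6 : a < 6) (R : ℝ) :
    Tendsto (fun n => ∫ x in Metric.ball (0 : Space) R, ‖v n x‖ ^ a) atTop (𝓝 0) := by
  obtain ⟨L, hL, hLn⟩ := h.exists_integral_rpow_le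
  set B := Metric.ball (0 : Space) R
  set V := volume.real B with hV
  rw [Metric.tendsto_atTop]
  intro ε hε
  have hV0 : 0 ≤ V := measureReal_nonneg
  set δ := ε / (2 * (V + L + 1)) with hδ
  have hδ0 : 0 < δ := by positivity
  obtain ⟨C, hC, hle⟩ := rpow_le_interpolate ha ha6 hδ0
  obtain ⟨N, hN⟩ := eventually_atTop.1 ((h.tendsto_local R).eventually
    (gt_mem_nhds (show (0 : ℝ) < ε / (2 * C) by positivity)))
  refine ⟨N, fun n hn => ?_⟩
  rw [Real.dist_0_eq_abs, abs_of_nonneg (integral_nonneg fun x => by positivity)]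
  have hc : IntegrableOn (fun _ : Space => (1 : ℝ)) B volume :=
    integrableOn_const (by exact measure_ball_lt_top.ne)
  have h6 := (h.memH1 n).integrable_norm_six
  have h2 := integrable_norm_sq (v n)
  have h1 : ∫ x in B, ‖v n x‖ ^ a ≤
      ∫ x in B, (δ * (1 + ‖v n x‖ ^ 6) + C * ‖v n x‖ ^ 2) :=
    integral_mono (integrableOn_ball_rpow (h.memH1 n) ha ha6 R)
      (((hc.add h6.integrableOn).const_mul δ).add (h2.integrableOn.const_mul C))
      fun x => hle _ (norm_nonneg _)
  have h16 : IntegrableOn (fun x => 1 + ‖v n x‖ ^ 6) B volume := hc.add h6.integrableOn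
  rw [integral_add (h16.const_mul δ) (h2.integrableOn.const_mul C), integral_const_mul,
    integral_const_mul, integral_add hc h6.integrableOn] at h1
  have e1 : ∫ _ in B, (1 : ℝ) = V := by simp [hV]
  have e2 : ∫ x in B, ‖v n x‖ ^ 6 ≤ L := by
    refine (setIntegral_le_integral h6 (Eventually.of_forall fun x => by positivity)).trans ?_
    simpa using hLn n 6 (by norm_num) le_rfl
  have e3 := hN n hn
  have e4 : δ * (V + ∫ x in B, ‖v n x‖ ^ 6) ≤ ε / 2 := by
    calc δ * (V + ∫ x in B, ‖v n x‖ ^ 6) ≤ δ * (V + L + 1) :=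
          mul_le_mul_of_nonneg_left (by linarith) hδ0.le
      _ = ε / 2 := by rw [hδ]; field_simp
  have e5 : C * ∫ x in B, ‖v n x‖ ^ 2 < ε / 2 := by
    calc C * ∫ x in B, ‖v n x‖ ^ 2 < C * (ε / (2 * C)) := by gcongr
      _ = ε / 2 := by field_simp
  rw [e1] at h1
  linarith

/-- Hölder's inequality, in the form used for the mixed terms of the splitting. -/
theorem integrable_weighted {u : L2} (hu : MemH1 u) {w : Space → ℝ} (hw : AEMeasurable w volume)
    (hw0 : ∀ x, 0 ≤ w x) {a q q' : ℝ} (hq : q.HolderConjugate q')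
    (hwq : Integrable (fun x => w x ^ q) volume) (h2 : 2 ≤ a * q') (h6 : a * q' ≤ 6) :
    Integrable (fun x => w x * ‖u x‖ ^ a) volume := by
  obtain ⟨C, hC, h⟩ := young_small hq one_pos
  refine ((hwq.const_mul C).add ((hu.integrable_rpow h2 h6).const_mul 1)).mono'
    (hw.mul ((Lp.aestronglyMeasurable u).norm.aemeasurable.pow_const a)).aestronglyMeasurable
    (Eventually.of_forall fun x => ?_)
  rw [Real.norm_of_nonneg (mul_nonneg (hw0 x) (by positivity))]
  have := h (w x) (‖u x‖ ^ a) (hw0 x) (by positivity)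
  rwa [← Real.rpow_mul (norm_nonneg _)] at this

/-- Powers of a weakly null sequence in `H¹` vanish in the limit when tested against a fixed weight
of the dual integrability: where the weight is bounded and the space variable is confined to a ball
this is Rellich's theorem, and the rest of the weight is small. -/
theorem NullSeq.tendsto_weighted (h : NullSeq K v) {w : Space → ℝ} (hw : AEMeasurable w volume)
    (hw0 : ∀ x, 0 ≤ w x) {a q q' : ℝ} (ha : 0 < a) (ha6 : a < 6) (hq : q.HolderConjugate q')
    (hwq : Integrable (fun x => w x ^ q) volume) (h2 : 2 ≤ a * q') (h6 : a * q' ≤ 6) :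
    Tendsto (fun n => ∫ x, w x * ‖v n x‖ ^ a) atTop (𝓝 0) := by
  obtain ⟨L, hL, hLn⟩ := h.exists_integral_rpow_le
  rw [Metric.tendsto_atTop]
  intro ε hε
  set δ := ε / (3 * L) with hδ
  have hδ0 : 0 < δ := by positivity
  obtain ⟨C, hC, hle⟩ := young_small hq hδ0
  -- the part of the weight that is large or far away
  let bad : ℕ → Space → ℝ := fun k x => if ‖x‖ < k ∧ w x ≤ k then 0 else w x ^ q
  have hbad0 : ∀ k x, 0 ≤ bad k x := fun k x => by
    simp only [bad]; split_ifs
    · exact le_rfl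
    · exact Real.rpow_nonneg (hw0 x) _
  have hbadle : ∀ k x, bad k x ≤ w x ^ q := fun k x => by
    simp only [bad]; split_ifs
    · exact Real.rpow_nonneg (hw0 x) _
    · exact le_rfl
  have hbadm : ∀ k, AEStronglyMeasurable (bad k) volume := fun k => by
    have hs : NullMeasurableSet {x : Space | ‖x‖ < k ∧ w x ≤ k} volume :=
      (measurableSet_lt measurable_norm measurable_const).nullMeasurableSet.inter
        (nullMeasurableSet_le hw aemeasurable_const)
    have : bad k = {x : Space | ‖x‖ < k ∧ w x ≤ k}ᶜ.indicator fun x => w x ^ q := by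
      ext x
      by_cases hx : ‖x‖ < k ∧ w x ≤ k <;> simp [bad, hx]
    rw [this]
    exact ((hw.pow_const q).indicator₀ hs.compl).aestronglyMeasurable
  have hbadi : ∀ k, Integrable (bad k) volume := fun k => hwq.mono' (hbadm k)
    (Eventually.of_forall fun x => by rw [Real.norm_of_nonneg (hbad0 k x)]; exact hbadle k x)
  have hbad : Tendsto (fun k => ∫ x, bad k x) atTop (𝓝 0) := by
    have h0 : ∫ _ : Space, (0 : ℝ) = 0 := by simp
    rw [← h0]
    refine tendsto_integral_of_dominated_convergence (fun x => w x ^ q) hbadm hwq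
      (fun k => Eventually.of_forall fun x => ?_) (Eventually.of_forall fun x => ?_)
    · rw [Real.norm_of_nonneg (hbad0 k x)]; exact hbadle k x
    · refine tendsto_const_nhds.congr' ?_
      filter_upwards [tendsto_natCast_atTop_atTop.eventually (eventually_gt_atTop ‖x‖),
        tendsto_natCast_atTop_atTop.eventually (eventually_ge_atTop (w x))] with k h1 h2
      simp [bad, h1, h2]
  obtain ⟨k, hk⟩ := (hbad.eventually
    (gt_mem_nhds (show (0 : ℝ) < ε / (3 * C) by positivity))).exists
  have hloc := ((h.tendsto_local_rpow ha ha6 k).const_mul (k : ℝ))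
  rw [mul_zero] at hloc
  obtain ⟨N, hN⟩ := eventually_atTop.1 (hloc.eventually
    (gt_mem_nhds (show (0 : ℝ) < ε / 3 by positivity)))
  refine ⟨N, fun n hn => ?_⟩
  rw [Real.dist_0_eq_abs,
    abs_of_nonneg (integral_nonneg fun x => mul_nonneg (hw0 x) (by positivity))]
  have hi1 : Integrable (fun x => (k : ℝ) *
      (Metric.ball (0 : Space) k).indicator (fun x => ‖v n x‖ ^ a) x) volume :=
    ((integrable_indicator_iff measurableSet_ball).2
      (integrableOn_ball_rpow (h.memH1 n) ha ha6 k)).const_mul _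
  have hi2 : Integrable (fun x => C * bad k x) volume := (hbadi k).const_mul C
  have hi3 : Integrable (fun x => δ * ‖v n x‖ ^ (a * q')) volume :=
    ((h.memH1 n).integrable_rpow h2 h6).const_mul δ
  have hpt : ∀ x, w x * ‖v n x‖ ^ a ≤ (k : ℝ) *
      (Metric.ball (0 : Space) k).indicator (fun x => ‖v n x‖ ^ a) x + C * bad k x +
        δ * ‖v n x‖ ^ (a * q') := by
    intro x
    have h1 : 0 ≤ δ * ‖v n x‖ ^ (a * q') := by positivity
    have h3 : 0 ≤ C * bad k x := mul_nonneg hC.le (hbad0 k x)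
    by_cases hx : ‖x‖ < k ∧ w x ≤ k
    · rw [Set.indicator_of_mem (mem_ball_zero_iff.2 hx.1)]
      have : w x * ‖v n x‖ ^ a ≤ k * ‖v n x‖ ^ a :=
        mul_le_mul_of_nonneg_right hx.2 (by positivity)
      linarith
    · have h4 := hle (w x) (‖v n x‖ ^ a) (hw0 x) (by positivity)
      rw [← Real.rpow_mul (norm_nonneg _)] at h4
      have h5 : bad k x = w x ^ q := by simp only [bad]; rw [if_neg hx]
      have h7 : 0 ≤ (k : ℝ) * (Metric.ball (0 : Space) k).indicator (fun x => ‖v n x‖ ^ a) x :=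
        mul_nonneg (Nat.cast_nonneg k) (Set.indicator_nonneg (fun x _ => by positivity) x)
      rw [h5]
      linarith
  have hmono := integral_mono (integrable_weighted (h.memH1 n) hw hw0 hq hwq h2 h6)
    ((hi1.add hi2).add hi3) hpt
  have hsum : ∫ x, ((k : ℝ) * (Metric.ball (0 : Space) k).indicator (fun x => ‖v n x‖ ^ a) x +
      C * bad k x + δ * ‖v n x‖ ^ (a * q')) = k * (∫ x in Metric.ball (0 : Space) k, ‖v n x‖ ^ a) +
      C * (∫ x, bad k x) + δ * ∫ x, ‖v n x‖ ^ (a * q') := by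
    have e1 : Integrable (fun x => (k : ℝ) * (Metric.ball (0 : Space) k).indicator
      (fun x => ‖v n x‖ ^ a) x + C * bad k x) volume := hi1.add hi2
    rw [integral_add e1 hi3, integral_add hi1 hi2, integral_const_mul, integral_const_mul,
      integral_const_mul, integral_indicator measurableSet_ball]
  have e2 : C * ∫ x, bad k x < ε / 3 := by
    calc C * ∫ x, bad k x < C * (ε / (3 * C)) := by gcongr
      _ = ε / 3 := by field_simp
  have e3 : δ * ∫ x, ‖v n x‖ ^ (a * q') ≤ ε / 3 := by
    calc δ * ∫ x, ‖v n x‖ ^ (a * q') ≤ δ * L := by gcongr; exact hLn n _ h2 h6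
      _ = ε / 3 := by rw [hδ]; field_simp
  have e4 := hN n hn
  refine lt_of_le_of_lt hmono ?_
  refine lt_of_eq_of_lt hsum ?_
  linarith

end

/-! ### Splitting of the energy along weakly convergent sequences -/

theorem MemH1.add {u v : L2} (hu : MemH1 u) (hv : MemH1 v) : MemH1 (u + v) :=
  memH1_of_isWeakPartial fun i => (hu.isWeakPartial i).add (hv.isWeakPartial i)

theorem MemH1.weakPartial_add {u v : L2} (hu : MemH1 u) (hv : MemH1 v) (i : Fin 3) :
    weakPartial (u + v) i = weakPartial u i + weakPartial v i :=
  ((hu.isWeakPartial i).add (hv.isWeakPartial i)).weakPartial_eq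

/-- A consequence of Bernoulli's inequality for `(1 - t / s) ^ p`. -/
theorem abs_sub_rpow_ge {p s t : ℝ} (hp : 1 ≤ p) (ht : 0 ≤ t) (hts : t ≤ s) :
    s ^ p + t ^ p - (p + 1) * (s ^ (p - 1) * t) ≤ (s - t) ^ p := by
  rcases (ht.trans hts).eq_or_lt with h0 | hs
  · have : t = 0 := le_antisymm (h0 ▸ hts) ht
    subst h0; subst this
    simp [Real.zero_rpow (by linarith : p ≠ 0)]
  have hb := one_add_mul_self_le_rpow_one_add (s := -(t / s)) (p := p)
    (by have := (div_le_one hs).2 hts; linarith) hp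
  have h1 : (s - t) ^ p = s ^ p * (1 + -(t / s)) ^ p := by
    rw [← Real.mul_rpow hs.le (by have := (div_le_one hs).2 hts; linarith)]
    congr 1
    field_simp
    ring
  have h2 : s ^ p = s ^ (p - 1) * s := by
    rw [← Real.rpow_add_one hs.ne']; norm_num
  have h3 : t ^ p ≤ s ^ (p - 1) * t := by
    rcases ht.eq_or_lt with h | h
    · rw [← h, Real.zero_rpow (by linarith)]; simp
    · have : t ^ p = t ^ (p - 1) * t := by rw [← Real.rpow_add_one h.ne']; norm_num
      rw [this]
      gcongr
  have h4 : s ^ p * (1 + p * -(t / s)) ≤ s ^ p * (1 + -(t / s)) ^ p := by gcongr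
  have h5 : s ^ p * (1 + p * -(t / s)) = s ^ p - p * (s ^ (p - 1) * t) := by
    rw [h2]; field_simp; ring
  rw [h1]
  linarith

/-- The pointwise inequality behind the Brezis–Lieb splitting, in the direction that is needed. -/
theorem norm_add_rpow_ge {p : ℝ} (hp : 1 ≤ p) (a b : ℂ) :
    ‖a‖ ^ p + ‖b‖ ^ p - (p + 1) * (‖a‖ ^ (p - 1) * ‖b‖ + ‖a‖ * ‖b‖ ^ (p - 1)) ≤ ‖a + b‖ ^ p := by
  have hp1 : 0 ≤ p + 1 := by linarith
  have e1 : 0 ≤ (p + 1) * (‖a‖ ^ (p - 1) * ‖b‖) := by positivity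
  have e2 : 0 ≤ (p + 1) * (‖a‖ * ‖b‖ ^ (p - 1)) := by positivity
  rcases le_total ‖b‖ ‖a‖ with h | h
  · have h1 := abs_sub_rpow_ge hp (norm_nonneg b) h
    have h2 : (‖a‖ - ‖b‖) ^ p ≤ ‖a + b‖ ^ p := by
      have := norm_sub_norm_le a (-b)
      rw [norm_neg, sub_neg_eq_add] at this
      exact Real.rpow_le_rpow (by linarith) this (by linarith)
    linarith
  · have h1 := abs_sub_rpow_ge hp (norm_nonneg a) h
    have h2 : (‖b‖ - ‖a‖) ^ p ≤ ‖a + b‖ ^ p := by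
      have := norm_sub_norm_le b (-a)
      rw [norm_neg, sub_neg_eq_add, add_comm b a] at this
      exact Real.rpow_le_rpow (by linarith) this (by linarith)
    have h3 : (p + 1) * (‖b‖ ^ (p - 1) * ‖a‖) = (p + 1) * (‖a‖ * ‖b‖ ^ (p - 1)) := by ring
    linarith

section
variable {K : ℝ} {v : ℕ → L2} {w : L2}

/-- The exponent six is allowed: the mixed terms contain the powers `1` and `p - 1` of `v n`, both
below the Sobolev exponent. -/
theorem NullSeq.highOrder_split (h : NullSeq K v) (hw : MemH1 w) {l₃ p : ℝ} (hl₃ : 0 < l₃)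
    (hp : 4 < p) (hp6 : p ≤ 6) : ∃ e : ℕ → ℝ, Tendsto e atTop (𝓝 0) ∧ ∀ n,
      highOrder l₃ p w + highOrder l₃ p (v n) - e n ≤ highOrder l₃ p (w + v n) := by
  have hpq : p.HolderConjugate (p / (p - 1)) := Real.HolderConjugate.conjExponent (by linarith)
  have hp1 : p - 1 ≠ 0 := by linarith
  have hwm : AEMeasurable (fun x => ‖w x‖) volume :=
    (Lp.aestronglyMeasurable w).norm.aemeasurable
  have hwp := hw.integrable_rpow (a := p) (by linarith) hp6
  have hwp' : Integrable (fun x => (‖w x‖ ^ (p - 1)) ^ (p / (p - 1))) volume := by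
    refine hwp.congr (Eventually.of_forall fun x => ?_)
    simp only
    rw [← Real.rpow_mul (norm_nonneg _), mul_div_cancel₀ _ hp1]
  have e0 : (p - 1) * (p / (p - 1)) = p := mul_div_cancel₀ _ hp1
  have hA1 := fun n => integrable_weighted (h.memH1 n) (hwm.pow_const (p - 1))
    (fun x => by positivity) (a := 1) hpq.symm hwp' (by linarith) (by linarith)
  have hB1 := fun n => integrable_weighted (h.memH1 n) hwm (fun x => norm_nonneg _) (a := p - 1)
    hpq hwp (by rw [e0]; linarith) (by rw [e0]; linarith)
  have hA := h.tendsto_weighted (hwm.pow_const (p - 1)) (fun x => by positivity) (a := 1)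
    one_pos (by norm_num) hpq.symm hwp' (by linarith) (by linarith)
  have hB := h.tendsto_weighted hwm (fun x => norm_nonneg _) (a := p - 1) (by linarith)
    (by linarith) hpq hwp (by rw [e0]; linarith) (by rw [e0]; linarith)
  simp only [Real.rpow_one] at hA hA1
  refine ⟨fun n => l₃ * ((p + 1) * ((∫ x, ‖w x‖ ^ (p - 1) * ‖v n x‖) +
    ∫ x, ‖w x‖ * ‖v n x‖ ^ (p - 1))), ?_, fun n => ?_⟩
  · simpa using ((hA.add hB).const_mul (p + 1)).const_mul l₃
  · have hvp := (h.memH1 n).integrable_rpow (a := p) (by linarith) hp6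
    have hi : Integrable (fun x => (p + 1) * (‖w x‖ ^ (p - 1) * ‖v n x‖ +
        ‖w x‖ * ‖v n x‖ ^ (p - 1))) volume := ((hA1 n).add (hB1 n)).const_mul (p + 1)
    have hs : Integrable (fun x => ‖w x‖ ^ p + ‖v n x‖ ^ p) volume := hwp.add hvp
    have hmono : ∫ x, (‖w x‖ ^ p + ‖v n x‖ ^ p - (p + 1) * (‖w x‖ ^ (p - 1) * ‖v n x‖ +
        ‖w x‖ * ‖v n x‖ ^ (p - 1))) ≤ ∫ x, ‖(w + v n : L2) x‖ ^ p := by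
      refine integral_mono_ae (hs.sub hi)
        ((hw.add (h.memH1 n)).integrable_rpow (by linarith) hp6) ?_
      filter_upwards [Lp.coeFn_add w (v n)] with x hx
      rw [hx]
      exact norm_add_rpow_ge (by linarith) _ _
    rw [integral_sub hs hi, integral_add hwp hvp, integral_const_mul,
      integral_add (hA1 n) (hB1 n)] at hmono
    have := mul_le_mul_of_nonneg_left hmono hl₃.le
    simp only [highOrder]
    linarith

theorem NullSeq.kinetic_split (h : NullSeq K v) (hw : MemH1 w) :
    ∃ e : ℕ → ℝ, Tendsto e atTop (𝓝 0) ∧ ∀ n,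
      kinetic (w + v n) = kinetic w + kinetic (v n) + e n := by
  refine ⟨fun n => ∑ i, 2 * (inner ℂ (weakPartial w i) (weakPartial (v n) i)).re, ?_, fun n => ?_⟩
  · have h0 : ∀ i, Tendsto (fun n => 2 * (inner ℂ (weakPartial w i) (weakPartial (v n) i)).re)
        atTop (𝓝 0) := fun i => by
      have h1 := (h.weak_partial i).inner (weakPartial w i)
      rw [inner_zero_right] at h1
      simpa using ((Complex.continuous_re.tendsto _).comp h1).const_mul 2
    simpa using tendsto_finsetSum Finset.univ fun i _ => h0 i
  · simp only [kinetic]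
    rw [← Finset.sum_add_distrib, ← Finset.sum_add_distrib]
    refine Finset.sum_congr rfl fun i _ => ?_
    rw [hw.weakPartial_add (h.memH1 n), @norm_add_sq ℂ]
    simp only [RCLike.re_eq_complex_re]
    ring

theorem NullSeq.tendsto_inner_density (h : NullSeq K v) (g : L2) :
    Tendsto (fun n => (inner ℂ g (density (v n))).re) atTop (𝓝 0) := by
  have hg : Integrable (fun x => ‖g x‖ ^ (2 : ℝ)) volume := by
    simpa using integrable_norm_sq g
  have h2 : (2 : ℝ).HolderConjugate 2 := Real.HolderConjugate.two_two
  have hgm : AEMeasurable (fun x => ‖g x‖) volume := (Lp.aestronglyMeasurable g).norm.aemeasurable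
  have hlim := h.tendsto_weighted hgm (fun x => norm_nonneg _) (a := 2) (by norm_num)
    (by norm_num) h2 hg (by norm_num) (by norm_num)
  refine squeeze_zero_norm (fun n => ?_) hlim
  have hi := integrable_weighted (h.memH1 n) hgm (fun x => norm_nonneg _) (a := 2) h2 hg
    (by norm_num) (by norm_num)
  refine (Complex.abs_re_le_norm _).trans ?_
  rw [L2.inner_def]
  refine norm_integral_le_of_norm_le hi ?_
  filter_upwards [(h.memH1 n).coeFn_density] with x hx
  refine (norm_inner_le_norm _ _).trans (le_of_eq ?_)
  rw [hx, Complex.norm_real, Real.norm_of_nonneg (by positivity), Real.rpow_ofNat]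

/-- The densities of `w` and `v n` decouple in `L²`. -/
theorem NullSeq.density_split (h : NullSeq K v) (hw : MemH1 w) :
    Tendsto (fun n => ‖density (w + v n) - (density w + density (v n))‖) atTop (𝓝 0) := by
  have h4 : Integrable (fun x => (‖w x‖ ^ 2) ^ (2 : ℝ)) volume := by
    refine (hw.integrable_pow (a := 4) (by norm_num) (by norm_num)).congr
      (Eventually.of_forall fun x => ?_)
    simp only [Real.rpow_ofNat]
    ring
  have h2 : (2 : ℝ).HolderConjugate 2 := Real.HolderConjugate.two_two
  have hgm : AEMeasurable (fun x => ‖w x‖ ^ 2) volume :=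
    (Lp.aestronglyMeasurable w).norm.aemeasurable.pow_const 2
  have hlim := (h.tendsto_weighted hgm (fun x => by positivity) (a := 2) (by norm_num)
    (by norm_num) h2 h4 (by norm_num) (by norm_num)).const_mul 4
  rw [mul_zero] at hlim
  have hsq : Tendsto (fun n => ‖density (w + v n) - (density w + density (v n))‖ ^ 2)
      atTop (𝓝 0) := by
    refine squeeze_zero (fun n => sq_nonneg _) (fun n => ?_) hlim
    have hi := integrable_weighted (h.memH1 n) hgm (fun x => by positivity) (a := 2) h2 h4
      (by norm_num) (by norm_num)
    rw [norm_sq_eq_integral, ← integral_const_mul]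
    refine integral_mono_ae (integrable_norm_sq _) (hi.const_mul 4) ?_
    filter_upwards [(hw.add (h.memH1 n)).coeFn_density, hw.coeFn_density,
      (h.memH1 n).coeFn_density, Lp.coeFn_add w (v n), Lp.coeFn_add (density w) (density (v n)),
      Lp.coeFn_sub (density (w + v n)) (density w + density (v n))] with x h1 h2 h3 h4 h5 h6
    rw [h6, Pi.sub_apply, h5, Pi.add_apply, h1, h2, h3, h4, Pi.add_apply, ← Complex.ofReal_add,
      ← Complex.ofReal_sub, Complex.norm_real, Real.norm_eq_abs, sq_abs, @norm_add_sq ℂ,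
      Real.rpow_ofNat]
    have h7 := abs_le.1 ((RCLike.abs_re_le_norm (inner ℂ (w x) (v n x))).trans
      (norm_inner_le_norm (𝕜 := ℂ) (w x) (v n x)))
    have h8 : RCLike.re (inner ℂ (w x) (v n x)) ^ 2 ≤ (‖w x‖ * ‖v n x‖) ^ 2 :=
      sq_le_sq' h7.1 h7.2
    nlinarith
  have := (Real.continuous_sqrt.tendsto _).comp hsq
  rw [Real.sqrt_zero] at this
  refine this.congr fun n => ?_
  simp [Real.sqrt_sq]

/-- The mixed term vanishes because `density (v n)` tends weakly to zero in `L²`. -/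
theorem NullSeq.interaction_split (h : NullSeq K v) (hw : MemH1 w) (l₁ l₂ : ℝ) :
    ∃ e : ℕ → ℝ, Tendsto e atTop (𝓝 0) ∧ ∀ n,
      interaction l₁ l₂ (w + v n) = interaction l₁ l₂ w + interaction l₁ l₂ (v n) + e n := by
  obtain ⟨L, hL, hLn⟩ := h.exists_integral_rpow_le
  set M := symbolBound l₁ l₂ with hM
  have hM0 : 0 ≤ M := symbolBound_nonneg _ _
  let r : ℕ → L2 := fun n => density (w + v n) - (density w + density (v n))
  have hr : Tendsto (fun n => ‖r n‖) atTop (𝓝 0) := h.density_split hw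
  let g : ℕ → L2 := fun n => formGradient l₁ l₂ (density w + density (v n))
  refine ⟨fun n => 2 * (inner ℂ (formGradient l₁ l₂ (density w)) (density (v n))).re +
    (form l₁ l₂ (r n) + 2 * (inner ℂ (g n) (r n)).re), ?_, fun n => ?_⟩
  · have h1 := (h.tendsto_inner_density (formGradient l₁ l₂ (density w))).const_mul 2
    have h2 : Tendsto (fun n => form l₁ l₂ (r n)) atTop (𝓝 0) := by
      refine squeeze_zero_norm (fun n => abs_form_le l₁ l₂ (r n)) ?_
      simpa using (hr.pow 2).const_mul M
    have hg : ∀ n, ‖g n‖ ≤ M * (‖density w‖ + √L) := fun n => by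
      refine (norm_formGradient_le _ _ _).trans ?_
      gcongr
      refine (norm_add_le _ _).trans ?_
      gcongr
      refine Real.le_sqrt_of_sq_le ?_
      rw [(h.memH1 n).norm_sq_density]
      simpa using hLn n 4 (by norm_num) (by norm_num)
    have h3 : Tendsto (fun n => (inner ℂ (g n) (r n)).re) atTop (𝓝 0) := by
      refine squeeze_zero_norm (fun n => ?_)
        (by simpa using hr.const_mul (M * (‖density w‖ + √L)))
      refine (Complex.abs_re_le_norm _).trans ((norm_inner_le_norm _ _).trans ?_)
      gcongr
      exact hg n
    simpa using h1.add (h2.add (h3.const_mul 2))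
  · have e1 : density (w + v n) = (density w + density (v n)) + r n := by simp [r]
    rw [(hw.add (h.memH1 n)).interaction_eq, hw.interaction_eq, (h.memH1 n).interaction_eq, e1,
      form_add, form_add]
    ring

/-- The energy of `w + v n` is asymptotically at least that of `w` plus that of `v n`. -/
theorem NullSeq.energy_split (h : NullSeq K v) (hw : MemH1 w) (l₁ l₂ : ℝ) {l₃ p : ℝ} (hl₃ : 0 < l₃)
    (hp : 4 < p) (hp6 : p ≤ 6) : ∃ e : ℕ → ℝ, Tendsto e atTop (𝓝 0) ∧ ∀ n,
      energy l₁ l₂ l₃ p w + energy l₁ l₂ l₃ p (v n) - e n ≤ energy l₁ l₂ l₃ p (w + v n) := by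
  obtain ⟨e₁, h₁, h₁'⟩ := h.kinetic_split hw
  obtain ⟨e₂, h₂, h₂'⟩ := h.interaction_split hw l₁ l₂
  obtain ⟨e₃, h₃, h₃'⟩ := h.highOrder_split hw hl₃ hp hp6
  refine ⟨fun n => 2 / p * e₃ n - 1 / 2 * e₁ n - 1 / 2 * e₂ n, ?_, fun n => ?_⟩
  · have := ((h₃.const_mul (2 / p)).sub (h₁.const_mul (1 / 2))).sub (h₂.const_mul (1 / 2))
    simp only [mul_zero, sub_zero] at this
    exact this
  · have hp0 : 0 < 2 / p := by positivity
    have := mul_le_mul_of_nonneg_left (h₃' n) hp0.le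
    unfold energy
    rw [h₁' n, h₂' n]
    linarith

theorem NullSeq.mass_split (h : NullSeq K v) (w : L2) :
    Tendsto (fun n => ‖w + v n‖ ^ 2 - ‖v n‖ ^ 2) atTop (𝓝 (‖w‖ ^ 2)) := by
  have h1 := h.weak.inner w
  rw [inner_zero_right] at h1
  have h2 := (((Complex.continuous_re.tendsto _).comp h1).const_mul 2).const_add (‖w‖ ^ 2)
  simp only [Complex.zero_re, mul_zero, add_zero] at h2
  refine h2.congr fun n => ?_
  rw [@norm_add_sq ℂ]
  simp only [RCLike.re_eq_complex_re, Function.comp_apply]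
  ring

end

/-! ### Non-vanishing -/

/-- If the averages of `u` over all balls of a suitably small radius are small, then so is the
`L⁴` norm of `u`. -/
theorem exists_ballAvg_ge (K : ℝ) {δ : ℝ} (hK : 0 < K) (hδ : 0 < δ) : ∃ r η : ℝ, 0 < r ∧ 0 < η ∧
    ∀ u : L2, MemH1 u → ‖u‖ ^ 2 ≤ K → kinetic u ≤ K → δ ≤ ∫ x, ‖u x‖ ^ 4 →
      ∃ x, η ≤ ‖ballAvg r u x‖ := by
  obtain ⟨S, hS, hSob⟩ := exists_sobolev_const
  set L := K + S * K ^ 3 with hL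
  have hL0 : 0 < L := by positivity
  set l := δ / (2 * L) with hl
  have hl0 : 0 < l := by positivity
  set r := √(l * δ / (2 * K)) with hr
  have hr0 : 0 < r := Real.sqrt_pos.2 (by positivity)
  have hr2 : r ^ 2 = l * δ / (2 * K) := Real.sq_sqrt (by positivity)
  refine ⟨r, δ / (4 * L), hr0, by positivity, fun u hu hm hk h4 => ?_⟩
  by_contra! hcon
  have hd := hu.integrable_sub_ballAvg_sq hr0
  have h3 := hu.integrable_pow (a := 3) (by norm_num) (by norm_num)
  have h6 := hu.integrable_norm_six
  have hpt : ∀ x, ‖u x‖ ^ 4 ≤ δ / (4 * L) * ‖u x‖ ^ 3 + l / 2 * ‖u x‖ ^ 6 +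
      1 / (2 * l) * ‖u x - ballAvg r u x‖ ^ 2 := by
    intro x
    have h1 : ‖u x‖ ≤ δ / (4 * L) + ‖u x - ballAvg r u x‖ := by
      have := norm_add_le (ballAvg r u x) (u x - ballAvg r u x)
      rw [add_sub_cancel] at this
      linarith [hcon x]
    have h2 : ‖u x‖ ^ 3 * ‖u x - ballAvg r u x‖ ≤ l / 2 * ‖u x‖ ^ 6 +
        1 / (2 * l) * ‖u x - ballAvg r u x‖ ^ 2 := by
      have e : l / 2 * ‖u x‖ ^ 6 + 1 / (2 * l) * ‖u x - ballAvg r u x‖ ^ 2 -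
          ‖u x‖ ^ 3 * ‖u x - ballAvg r u x‖ =
          (l * ‖u x‖ ^ 3 - ‖u x - ballAvg r u x‖) ^ 2 / (2 * l) := by
        field_simp; ring
      have : 0 ≤ (l * ‖u x‖ ^ 3 - ‖u x - ballAvg r u x‖) ^ 2 / (2 * l) := by positivity
      linarith
    calc ‖u x‖ ^ 4 = ‖u x‖ ^ 3 * ‖u x‖ := by ring
      _ ≤ ‖u x‖ ^ 3 * (δ / (4 * L) + ‖u x - ballAvg r u x‖) := by gcongr
      _ = δ / (4 * L) * ‖u x‖ ^ 3 + ‖u x‖ ^ 3 * ‖u x - ballAvg r u x‖ := by ring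
      _ ≤ _ := by linarith
  have hi36 : Integrable (fun x => δ / (4 * L) * ‖u x‖ ^ 3 + l / 2 * ‖u x‖ ^ 6) volume :=
    (h3.const_mul _).add (h6.const_mul _)
  have hI := integral_mono (hu.integrable_pow (by norm_num) (by norm_num))
    (hi36.add (hd.const_mul (1 / (2 * l)))) hpt
  have hI' : ∫ x, ‖u x‖ ^ 4 ≤ δ / (4 * L) * (∫ x, ‖u x‖ ^ 3) + l / 2 * (∫ x, ‖u x‖ ^ 6) +
      1 / (2 * l) * ∫ x, ‖u x - ballAvg r u x‖ ^ 2 := by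
    refine hI.trans (le_of_eq ?_)
    rw [← integral_const_mul, ← integral_const_mul, ← integral_const_mul,
      ← integral_add (h3.const_mul _) (h6.const_mul _),
      ← integral_add hi36 (hd.const_mul (1 / (2 * l)))]
    rfl
  have b6 : ∫ x, ‖u x‖ ^ 6 ≤ S * K ^ 3 := by
    refine (hSob u hu).trans ?_
    have := kinetic_nonneg u
    gcongr
  have b3 : ∫ x, ‖u x‖ ^ 3 ≤ L := by
    have : ∫ x, ‖u x‖ ^ 3 ≤ ∫ x, (‖u x‖ ^ 2 + ‖u x‖ ^ 6) :=
      integral_mono h3 ((integrable_norm_sq u).add h6) fun x => by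
        simpa using rpow_le_sq_add_six (norm_nonneg (u x)) (a := 3) (by norm_num) (by norm_num)
    rw [integral_add (integrable_norm_sq u) h6, ← norm_sq_eq_integral] at this
    linarith
  have bd : ∫ x, ‖u x - ballAvg r u x‖ ^ 2 ≤ r ^ 2 * K := by
    refine (hu.integral_sub_ballAvg_sq_le hr0).trans ?_
    gcongr
  have c3 : δ / (4 * L) * (∫ x, ‖u x‖ ^ 3) ≤ δ / 4 := by
    calc δ / (4 * L) * (∫ x, ‖u x‖ ^ 3) ≤ δ / (4 * L) * L := by gcongr
      _ = δ / 4 := by field_simp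
  have c6 : l / 2 * (∫ x, ‖u x‖ ^ 6) ≤ δ / 4 := by
    calc l / 2 * (∫ x, ‖u x‖ ^ 6) ≤ l / 2 * L := by gcongr; linarith
      _ = δ / 4 := by rw [hl]; field_simp; norm_num
  have cd : 1 / (2 * l) * ∫ x, ‖u x - ballAvg r u x‖ ^ 2 ≤ δ / 4 := by
    calc 1 / (2 * l) * ∫ x, ‖u x - ballAvg r u x‖ ^ 2 ≤ 1 / (2 * l) * (r ^ 2 * K) := by gcongr
      _ = δ / 4 := by rw [hr2]; field_simp; norm_num
  linarith

/-! ### Weak compactness -/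

theorem exists_weakTendsto_subseq {u : ℕ → L2} {K : ℝ} (h : ∀ n, ‖u n‖ ≤ K) :
    ∃ φ : ℕ → ℕ, StrictMono φ ∧ ∃ v : L2, WeakTendsto (fun n => u (φ n)) v := by
  have : Fact ((2 : ℝ≥0∞) ≠ ∞) := ⟨by norm_num⟩
  have : TopologicalSpace.SeparableSpace L2 := inferInstance
  let x : ℕ → WeakDual ℂ L2 := fun n =>
    StrongDual.toWeakDual (InnerProductSpace.toDual ℂ L2 (u n))
  obtain ⟨a, -, φ, hφ, hlim⟩ := WeakDual.isSeqCompact_closedBall ℂ L2 0 K (x := x) fun n => by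
    change InnerProductSpace.toDual ℂ L2 (u n) ∈ Metric.closedBall 0 K
    simpa using h n
  refine ⟨φ, hφ, (InnerProductSpace.toDual ℂ L2).symm (WeakDual.toStrongDual a), fun ℓ => ?_⟩
  obtain ⟨w, rfl⟩ := (InnerProductSpace.toDual ℂ L2).surjective ℓ
  have h1 : Tendsto (fun n => inner ℂ (u (φ n)) w) atTop (𝓝 (a w)) :=
    ((WeakDual.eval_continuous w).tendsto a).comp hlim
  have h2 := (Complex.continuous_conj.tendsto _).comp h1
  have h3 : a w = inner ℂ ((InnerProductSpace.toDual ℂ L2).symm (WeakDual.toStrongDual a)) w :=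
    (InnerProductSpace.toDual_symm_apply).symm
  rw [h3, inner_conj_symm] at h2
  refine h2.congr fun n => ?_
  simp [InnerProductSpace.toDual_apply_apply, inner_conj_symm]

theorem WeakTendsto.comp {u : ℕ → L2} {v : L2} (h : WeakTendsto u v) {φ : ℕ → ℕ}
    (hφ : StrictMono φ) : WeakTendsto (fun n => u (φ n)) v := fun ℓ =>
  (h ℓ).comp hφ.tendsto_atTop

theorem WeakTendsto.sub_const {u : ℕ → L2} {v : L2} (h : WeakTendsto u v) :
    WeakTendsto (fun n => u n - v) 0 := fun ℓ => by
  have := (h ℓ).sub_const (ℓ v)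
  simpa using this

/-- The graph of a weak derivative is weakly closed. -/
theorem WeakTendsto.isWeakPartial {u g : ℕ → L2} {u' g' : L2} {i : Fin 3}
    (hu : WeakTendsto u u') (hg : WeakTendsto g g') (h : ∀ n, IsWeakPartial i (u n) (g n)) :
    IsWeakPartial i u' g' := by
  rw [isWeakPartial_iff]
  intro φ
  -- testing against a Schwartz function is an inner product with its conjugate
  have key : ∀ (ψ : 𝓢(Space, ℂ)) {a : ℕ → L2} {a' : L2}, WeakTendsto a a' →
      Tendsto (fun n => ∫ x, ψ x * a n x) atTop (𝓝 (∫ x, ψ x * a' x)) := by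
    intro ψ a a' ha
    have hm : MemLp (fun x => (starRingEnd ℂ) (ψ x)) 2 (volume : Measure Space) :=
      (ψ.memLp 2 volume).star
    have h1 : ∀ b : L2, Inner.inner ℂ (hm.toLp _ : L2) b = ∫ x, ψ x * b x := fun b => by
      rw [L2.inner_def]
      refine integral_congr_ae ?_
      filter_upwards [hm.coeFn_toLp] with x hx
      rw [hx, RCLike.inner_apply, Complex.conj_conj, mul_comm]
    simpa only [h1] using ha.inner (hm.toLp _)
  refine tendsto_nhds_unique (key (∂_{basisVec i} φ) hu) ?_
  refine (key φ hg).neg.congr fun n => ?_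
  exact ((isWeakPartial_iff.1 (h n)) φ).symm

theorem norm_weakPartial_sq_le (u : L2) (i : Fin 3) : ‖weakPartial u i‖ ^ 2 ≤ kinetic u :=
  Finset.single_le_sum (f := fun i => ‖weakPartial u i‖ ^ 2) (fun _ _ => sq_nonneg _)
    (Finset.mem_univ i)

/-- Bounded sequences in `H¹` have weakly convergent subsequences. -/
theorem exists_memH1_weakTendsto_subseq {u : ℕ → L2} {K : ℝ} (hu : ∀ n, MemH1 (u n))
    (hm : ∀ n, ‖u n‖ ^ 2 ≤ K) (hk : ∀ n, kinetic (u n) ≤ K) :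
    ∃ φ : ℕ → ℕ, StrictMono φ ∧ ∃ w : L2, MemH1 w ∧ WeakTendsto (fun n => u (φ n)) w ∧
      ∀ i, WeakTendsto (fun n => weakPartial (u (φ n)) i) (weakPartial w i) := by
  have hb : ∀ n i, ‖weakPartial (u n) i‖ ≤ √K := fun n i =>
    Real.le_sqrt_of_sq_le ((norm_weakPartial_sq_le _ i).trans (hk n))
  obtain ⟨φ, hφ, w, hw⟩ := exists_weakTendsto_subseq fun n => Real.le_sqrt_of_sq_le (hm n)
  obtain ⟨φ₀, hφ₀, g₀, hg₀⟩ := exists_weakTendsto_subseq fun n => hb (φ n) 0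
  obtain ⟨φ₁, hφ₁, g₁, hg₁⟩ := exists_weakTendsto_subseq fun n => hb (φ (φ₀ n)) 1
  obtain ⟨φ₂, hφ₂, g₂, hg₂⟩ := exists_weakTendsto_subseq fun n => hb (φ (φ₀ (φ₁ n))) 2
  have hw' : WeakTendsto (fun n => u (φ (φ₀ (φ₁ (φ₂ n))))) w := hw.comp (hφ₀.comp (hφ₁.comp hφ₂))
  have hg : ∀ i, ∃ g, WeakTendsto (fun n => weakPartial (u (φ (φ₀ (φ₁ (φ₂ n))))) i) g := by
    intro i
    fin_cases i
    · exact ⟨g₀, hg₀.comp (hφ₁.comp hφ₂)⟩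
    · exact ⟨g₁, hg₁.comp hφ₂⟩
    · exact ⟨g₂, hg₂⟩
  choose g hg using hg
  have hp : ∀ i, IsWeakPartial i w (g i) := fun i =>
    hw'.isWeakPartial (hg i) fun n => (hu _).isWeakPartial i
  refine ⟨fun n => φ (φ₀ (φ₁ (φ₂ n))), hφ.comp (hφ₀.comp (hφ₁.comp hφ₂)), w,
    memH1_of_isWeakPartial hp, hw', fun i => ?_⟩
  rw [(hp i).weakPartial_eq]
  exact hg i

/-! ### Existence of minimizers -/

theorem translate_eq_dilate (y : Space) (u : L2) : translate y u = dilate 1 one_pos y u := by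
  apply Lp.ext
  filter_upwards [coeFn_translate y u,
    coeFn_compAffine (fun _ => (1 : ℝ)⁻¹) (fun _ => inv_pos.2 one_pos) y u] with x h1 h2
  rw [h1, dilate, h2]
  congr 2
  ext i
  simp

theorem ballAvg_translate (r : ℝ) (y : Space) (u : L2) :
    ballAvg r (translate y u) 0 = ballAvg r u y := by
  refine integral_congr_ae ?_
  have : ∀ᵐ h ∂(ballMeasure r), translate y u h = u (h + y) :=
    Measure.ae_smul_measure (ae_restrict_of_ae (coeFn_translate y u)) _
  filter_upwards [this] with h hh
  rw [zero_add, hh, add_comm]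

theorem energy_zero (l₁ l₂ l₃ : ℝ) {p : ℝ} (hp : 4 < p) : energy l₁ l₂ l₃ p 0 = 0 := by
  obtain ⟨u, hu, -⟩ := exists_memH1_ne_zero
  have := hu.energy_smul l₁ l₂ l₃ p (le_refl (0 : ℝ))
  simpa [Real.zero_rpow (by linarith : p ≠ 0)] using this

/-- The ratio of the infimum of the energy to the mass is nonincreasing in the mass. -/
theorem mass_mul_le_energy {l₁ l₂ l₃ p c g : ℝ} (hp : 4 < p) (hc : 0 < c)
    (hg : ∀ u ∈ massSphere c, g ≤ energy l₁ l₂ l₃ p u) {v : L2} (hv : MemH1 v)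
    (hm : ‖v‖ ^ 2 < c) : ‖v‖ ^ 2 / c * g ≤ energy l₁ l₂ l₃ p v := by
  rcases eq_or_ne v 0 with rfl | h0
  · rw [energy_zero _ _ _ hp]; simp
  have hv0 : 0 < ‖v‖ ^ 2 := by positivity
  obtain ⟨v', hv', hlt⟩ := exists_energy_lt_of_dilate (l₁ := l₁) (l₂ := l₂) (l₃ := l₃) (p := p)
    hv h0 hm
  have h1 : g ≤ c / ‖v‖ ^ 2 * energy l₁ l₂ l₃ p v := (hg v' hv').trans hlt.le
  calc ‖v‖ ^ 2 / c * g ≤ ‖v‖ ^ 2 / c * (c / ‖v‖ ^ 2 * energy l₁ l₂ l₃ p v) := by gcongr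
    _ = _ := by field_simp

theorem norm_sub_sq_le (a b : L2) : ‖a - b‖ ^ 2 ≤ 2 * ‖a‖ ^ 2 + 2 * ‖b‖ ^ 2 := by
  have := norm_sub_le a b
  nlinarith [norm_nonneg (a - b), sq_nonneg (‖a‖ - ‖b‖)]

theorem MemH1.kinetic_sub_le {u v : L2} (hu : MemH1 u) (hv : MemH1 v) :
    kinetic (u - v) ≤ 2 * kinetic u + 2 * kinetic v := by
  simp only [kinetic, Finset.mul_sum]
  rw [← Finset.sum_add_distrib]
  refine Finset.sum_le_sum fun i _ => ?_
  rw [hu.weakPartial_sub hv]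
  exact norm_sub_sq_le _ _

/-- Functions of fixed mass whose energy is bounded above by a negative constant are bounded in
`H¹` and do not vanish in `L⁴`. -/
theorem exists_bounds_of_energy_le (l₁ l₂ : ℝ) {l₃ p : ℝ} (hl₃ : 0 < l₃) (hp : 4 < p) (hp6 : p ≤ 6)
    {c ε : ℝ} (hc : 0 < c) (hε : 0 < ε) : ∃ K δ : ℝ, 0 < K ∧ 0 < δ ∧ ∀ u ∈ massSphere c,
      energy l₁ l₂ l₃ p u ≤ -ε → ‖u‖ ^ 2 ≤ K ∧ kinetic u ≤ K ∧ δ ≤ ∫ x, ‖u x‖ ^ 4 := by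
  obtain ⟨K, hK, hcoer⟩ := exists_energy_coercive l₁ l₂ hl₃ hp hp6
  set M := symbolBound l₁ l₂ + 1 with hM
  have hM0 : 0 < M := by have := symbolBound_nonneg l₁ l₂; linarith
  refine ⟨c + 2 * K * c, 2 * ε / M, by positivity, by positivity, fun u hu hE => ?_⟩
  have hKc : 0 < K * c := by positivity
  have h1 := hcoer u hu.1
  rw [hu.2] at h1
  refine ⟨by rw [hu.2]; linarith, by linarith, ?_⟩
  have h2 := neg_le_of_abs_le (hu.1.abs_interaction_le l₁ l₂)
  have h3 := kinetic_nonneg u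
  have h4 := highOrder_nonneg hl₃ p u
  have h5 : 0 ≤ ∫ x, ‖u x‖ ^ 4 := integral_nonneg fun x => by positivity
  have h6 : 0 ≤ 2 / p * highOrder l₃ p u := by positivity
  rw [div_le_iff₀ hM0, hM]
  rw [energy] at hE
  nlinarith

/-- If the energy takes a negative value on `S(c)`, then it attains its minimum there. -/
theorem exists_isMinimizer {l₁ l₂ l₃ p c : ℝ} (hl₃ : 0 < l₃) (hp : 4 < p) (hp6 : p ≤ 6)
    (hc : 0 < c) (hneg : ∃ u ∈ massSphere c, energy l₁ l₂ l₃ p u < 0) :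
    ∃ u, IsMinimizer l₁ l₂ l₃ p c u := by
  obtain ⟨u₀, hu₀, hE₀⟩ := hneg
  obtain ⟨K₀, hK₀, hcoer⟩ := exists_energy_coercive l₁ l₂ hl₃ hp hp6
  set A := energy l₁ l₂ l₃ p '' massSphere c with hA
  have hbdd : BddBelow A := by
    refine ⟨-(K₀ * c), ?_⟩
    rintro _ ⟨u, hu, rfl⟩
    have h1 := hcoer u hu.1
    rw [hu.2] at h1
    linarith [kinetic_nonneg u]
  set g := sInf A with hg
  have hgle : ∀ u ∈ massSphere c, g ≤ energy l₁ l₂ l₃ p u := fun u hu =>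
    csInf_le hbdd ⟨u, hu, rfl⟩
  have hg0 : g < 0 := (hgle u₀ hu₀).trans_lt hE₀
  -- a minimizing sequence with energies at most `g / 2`
  have hseq : ∀ n : ℕ, ∃ u ∈ massSphere c, energy l₁ l₂ l₃ p u ≤ g / 2 ∧
      energy l₁ l₂ l₃ p u < g + 1 / ((n : ℝ) + 1) := by
    intro n
    have hlt : g < min (g / 2) (g + 1 / ((n : ℝ) + 1)) :=
      lt_min (by linarith) (by have : 0 < 1 / ((n : ℝ) + 1) := by positivity
                               linarith)
    have hne : A.Nonempty := ⟨_, u₀, hu₀, rfl⟩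
    obtain ⟨_, ⟨u, hu, rfl⟩, h⟩ := exists_lt_of_csInf_lt hne hlt
    exact ⟨u, hu, (h.trans_le (min_le_left _ _)).le, h.trans_le (min_le_right _ _)⟩
  choose u hu hu2 hulim using hseq
  obtain ⟨K, δ, hK, hδ, hbd⟩ := exists_bounds_of_energy_le l₁ l₂ hl₃ hp hp6 hc
    (show 0 < -(g / 2) by linarith)
  obtain ⟨r, η, hr, hη, hnv⟩ := exists_ballAvg_ge K hK hδ
  have hbd' := fun n => hbd (u n) (hu n) (by rw [neg_neg]; exact hu2 n)
  choose y hy using fun n => hnv (u n) (hu n).1 (hbd' n).1 (hbd' n).2.1 (hbd' n).2.2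
  -- recentred at points where the averages do not vanish
  let z : ℕ → L2 := fun n => translate (y n) (u n)
  have hzH : ∀ n, MemH1 (z n) := fun n => by
    simp only [z, translate_eq_dilate]; exact (hu n).1.dilate _ _
  have hzm : ∀ n, ‖z n‖ ^ 2 = c := fun n => by
    simp only [z, norm_translate]; exact (hu n).2
  have hzk : ∀ n, kinetic (z n) ≤ K := fun n => by
    simp only [z, translate_eq_dilate]
    rw [(hu n).1.kinetic_dilate, one_mul]
    exact (hbd' n).2.1
  have hzE : ∀ n, energy l₁ l₂ l₃ p (z n) = energy l₁ l₂ l₃ p (u n) := fun n => by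
    simp only [z, translate_eq_dilate]
    rw [(hu n).1.energy_dilate]
    ring
  have hcK : c ≤ K := by
    have := (hbd' 0).1
    rwa [(hu 0).2] at this
  obtain ⟨φ, hφ, w, hw, hzw, hzp⟩ := exists_memH1_weakTendsto_subseq hzH
    (fun n => (hzm n).le.trans hcK) hzk
  -- the averages at the origin converge, so the weak limit does not vanish
  have hw0 : w ≠ 0 := by
    rintro rfl
    have h1 : Tendsto (fun n => ‖ballAvg r (z (φ n)) 0‖) atTop (𝓝 0) := by
      have := (hzw.inner (ballKernel r 0)).norm
      simpa only [← ballAvg_eq_inner, inner_zero_right, norm_zero] using this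
    refine absurd (ge_of_tendsto' h1 fun n => ?_) (not_le.2 hη)
    simp only [z, ballAvg_translate]
    exact hy (φ n)
  set m := ‖w‖ ^ 2 with hm
  have hm0 : 0 < m := by positivity
  let v : ℕ → L2 := fun n => z (φ n) - w
  have hv : NullSeq (2 * K + 2 * m + 2 * kinetic w) v :=
    { memH1 := fun n => (hzH _).sub hw
      mass_le := fun n => by
        have := norm_sub_sq_le (z (φ n)) w
        rw [hzm] at this
        linarith [kinetic_nonneg w]
      kinetic_le := fun n => by
        have := (hzH (φ n)).kinetic_sub_le hw
        linarith [hzk (φ n)]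
      weak := hzw.sub_const
      weak_partial := fun i => by
        simp only [v, (hzH _).weakPartial_sub hw]
        exact (hzp i).sub_const }
  have hwv : ∀ n, w + v n = z (φ n) := fun n => add_sub_cancel _ _
  have hvm : Tendsto (fun n => ‖v n‖ ^ 2) atTop (𝓝 (c - m)) := by
    have h1 := (hv.mass_split w).const_sub c
    refine h1.congr fun n => ?_
    rw [hwv, hzm]
    ring
  have hmc : m ≤ c := sub_nonneg.1 (ge_of_tendsto' hvm fun n => sq_nonneg _)
  obtain ⟨e, he, hsplit⟩ := hv.energy_split hw l₁ l₂ hl₃ hp hp6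
  have hElim : Tendsto (fun n => g + 1 / ((φ n : ℝ) + 1) + e n - ‖v n‖ ^ 2 / c * g) atTop
      (𝓝 (g + 0 + 0 - (c - m) / c * g)) :=
    (((tendsto_one_div_add_atTop_nhds_zero_nat.comp hφ.tendsto_atTop).const_add g).add he).sub
      ((hvm.div_const c).mul_const g)
  have hEw : energy l₁ l₂ l₃ p w ≤ m / c * g := by
    have h1 : energy l₁ l₂ l₃ p w ≤ g + 0 + 0 - (c - m) / c * g := by
      refine ge_of_tendsto hElim ?_
      filter_upwards [hvm.eventually (gt_mem_nhds (show c - m < c by linarith))] with n hn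
      have h2 := hsplit n
      rw [hwv, hzE] at h2
      linarith [mass_mul_le_energy hp hc hgle (hv.memH1 n) hn, hulim (φ n)]
    refine h1.trans (le_of_eq ?_)
    field_simp
    ring
  rcases hmc.lt_or_eq with hlt | heq
  · -- a loss of mass contradicts strict monotonicity of the energy per mass
    obtain ⟨w', hw', hE⟩ := exists_energy_lt_of_dilate (l₁ := l₁) (l₂ := l₂) (l₃ := l₃) (p := p)
      hw hw0 hlt
    have h1 : c / m * energy l₁ l₂ l₃ p w ≤ c / m * (m / c * g) := by gcongr
    have h2 : c / m * (m / c * g) = g := by field_simp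
    linarith [hgle w' hw']
  · rw [heq, div_self hc.ne', one_mul] at hEw
    exact ⟨w, ⟨hw, heq⟩, isMinOn_iff.2 fun u' hu' => hEw.trans (hgle u' hu')⟩

/-! ### The critical mass -/

/-- Below a mass of nonnegative energy, all energies are positive. -/
theorem energy_pos_of_lt_mem_zeroSet {l₁ l₂ l₃ p c c' : ℝ} (hp : 4 < p)
    (hc : c ∈ zeroSet l₁ l₂ l₃ p) (hc' : 0 < c') (hlt : c' < c) {u : L2}
    (hu : u ∈ massSphere c') : 0 < energy l₁ l₂ l₃ p u := by
  by_contra! hE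
  have hu0 := ne_zero_of_mem_massSphere hc' hu
  obtain ⟨v, hv, hlt'⟩ := exists_energy_lt_of_dilate (l₁ := l₁) (l₂ := l₂) (l₃ := l₃) (p := p)
    hu.1 hu0 (hu.2.symm ▸ hlt)
  have h1 := ((mem_zeroSet_iff l₁ l₂ l₃ hp).1 hc).2 v hv
  have h2 : c / ‖u‖ ^ 2 * energy l₁ l₂ l₃ p u ≤ 0 :=
    mul_nonpos_of_nonneg_of_nonpos (div_nonneg (hc'.trans hlt).le (sq_nonneg _)) hE
  linarith

theorem zeroSet_nonempty (l₁ l₂ : ℝ) {l₃ p : ℝ} (hl₃ : 0 < l₃) (hp : 4 < p) (hp6 : p ≤ 6) :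
    (zeroSet l₁ l₂ l₃ p).Nonempty := by
  obtain ⟨c₀, hc₀, h⟩ := exists_energy_nonneg_of_small_mass l₁ l₂ hl₃ hp hp6
  exact ⟨c₀, (mem_zeroSet_iff l₁ l₂ l₃ hp).2 ⟨hc₀, fun u hu => h u hu.1 hu.2.le⟩⟩

theorem bddAbove_zeroSet {l₁ l₂ : ℝ} (l₃ : ℝ) {p : ℝ} (hp : 4 < p)
    (h : (0 ≤ l₂ ∧ l₁ - 4 * Real.pi / 3 * l₂ < 0) ∨ (l₂ < 0 ∧ l₁ + 8 * Real.pi / 3 * l₂ < 0)) :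
    BddAbove (zeroSet l₁ l₂ l₃ p) := by
  obtain ⟨u, hu, hE⟩ := exists_energy_neg l₃ hp h
  have hu0 : u ≠ 0 := by
    rintro rfl
    exact hE.ne (energy_zero _ _ _ hp)
  refine ⟨‖u‖ ^ 2, fun c hc => ?_⟩
  by_contra! hlt
  exact hE.not_gt (energy_pos_of_lt_mem_zeroSet hp hc (by positivity) hlt ⟨hu, rfl⟩)

/-- The set of masses with nonnegative energies contains its supremum, because the energy is
continuous along the ray through a given function. -/
theorem sSup_mem_zeroSet {l₁ l₂ l₃ p : ℝ} (hp : 4 < p) (hne : (zeroSet l₁ l₂ l₃ p).Nonempty)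
    (hb : BddAbove (zeroSet l₁ l₂ l₃ p)) :
    sSup (zeroSet l₁ l₂ l₃ p) ∈ zeroSet l₁ l₂ l₃ p := by
  obtain ⟨c₀, hc₀⟩ := hne
  have hpos : 0 < sSup (zeroSet l₁ l₂ l₃ p) := hc₀.1.trans_le (le_csSup hb hc₀)
  refine (mem_zeroSet_iff l₁ l₂ l₃ hp).2 ⟨hpos, fun u hu => ?_⟩
  by_contra! hE
  have hcont : Continuous fun s : ℝ => 1 / 2 * (s ^ 2 * kinetic u) +
      1 / 2 * (s ^ 4 * interaction l₁ l₂ u) + 2 / p * (s ^ p * highOrder l₃ p u) := by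
    have : Continuous fun s : ℝ => s ^ p :=
      Continuous.rpow_const continuous_id fun _ => Or.inr (by linarith)
    fun_prop
  have h1 := hcont.tendsto 1
  simp only [one_pow, Real.one_rpow, one_mul] at h1
  obtain ⟨s, ⟨hs, hs0⟩, hs1⟩ := ((((h1.eventually (gt_mem_nhds hE)).and
    (lt_mem_nhds one_pos)).filter_mono nhdsWithin_le_nhds).and
      (self_mem_nhdsWithin (a := (1 : ℝ)) (s := Set.Iio 1))).exists
  rw [← hu.1.energy_smul l₁ l₂ l₃ p hs0.le] at hs
  have hs1' : s < 1 := hs1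
  have hmass : ‖(s : ℂ) • u‖ ^ 2 = s ^ 2 * sSup (zeroSet l₁ l₂ l₃ p) := by
    rw [norm_sq_smul, hu.2]
  have hlt : s ^ 2 * sSup (zeroSet l₁ l₂ l₃ p) < sSup (zeroSet l₁ l₂ l₃ p) :=
    mul_lt_of_lt_one_left hpos (pow_lt_one₀ hs0.le hs1' two_ne_zero)
  obtain ⟨c, hc, hlt'⟩ := exists_lt_of_lt_csSup ⟨c₀, hc₀⟩ hlt
  exact hs.not_gt (energy_pos_of_lt_mem_zeroSet hp hc (by positivity) hlt' ⟨hu.1.smul _, hmass⟩)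

end

end DipolarGP

theorem mainTheorem1 (l₁ l₂ l₃ p : ℝ) (hl₃ : 0 < l₃) (hp₁ : 4 < p) (hp₂ : p ≤ 6) :
    (((0 ≤ l₂ ∧ 0 ≤ l₁ - 4 * Real.pi / 3 * l₂) ∨
        (l₂ < 0 ∧ 0 ≤ l₁ + 8 * Real.pi / 3 * l₂)) →
      ∀ c : ℝ, 0 < c →
        (∀ u ∈ DipolarGP.massSphere c, 0 < DipolarGP.energy l₁ l₂ l₃ p u) ∧
        DipolarGP.infEnergy l₁ l₂ l₃ p c = 0 ∧
        ¬ ∃ u, DipolarGP.IsMinimizer l₁ l₂ l₃ p c u) ∧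
    (((0 ≤ l₂ ∧ l₁ - 4 * Real.pi / 3 * l₂ < 0) ∨
        (l₂ < 0 ∧ l₁ + 8 * Real.pi / 3 * l₂ < 0)) →
      ∃ c_b : ℝ, DipolarGP.criticalMass l₁ l₂ l₃ p = (c_b : EReal) ∧
        IsGreatest (DipolarGP.zeroSet l₁ l₂ l₃ p) c_b ∧
        0 < c_b ∧
        (∀ c : ℝ, 0 < c → c < c_b →
          (∀ u ∈ DipolarGP.massSphere c, 0 < DipolarGP.energy l₁ l₂ l₃ p u) ∧
          ¬ ∃ u, DipolarGP.IsMinimizer l₁ l₂ l₃ p c u) ∧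
        (∀ c : ℝ, c_b < c → ∃ u, DipolarGP.IsMinimizer l₁ l₂ l₃ p c u)) := by
  refine ⟨fun h c hc => ?_, fun h => ?_⟩
  · have hpos : ∀ u ∈ DipolarGP.massSphere c, 0 < DipolarGP.energy l₁ l₂ l₃ p u := fun u hu =>
      DipolarGP.energy_pos_of_symbol_nonneg hl₃ hp₁ (DipolarGP.symbol_nonneg h) hu.1
        (DipolarGP.ne_zero_of_mem_massSphere hc hu)
    exact ⟨hpos, (DipolarGP.infEnergy_eq_zero_iff l₁ l₂ l₃ hp₁ hc).2 fun u hu => (hpos u hu).le,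
      DipolarGP.not_exists_isMinimizer l₁ l₂ l₃ hp₁ hc hpos⟩
  · have hb := DipolarGP.bddAbove_zeroSet l₃ hp₁ h
    have hmem := DipolarGP.sSup_mem_zeroSet hp₁
      (DipolarGP.zeroSet_nonempty l₁ l₂ hl₃ hp₁ hp₂) hb
    have hgr : IsGreatest (DipolarGP.zeroSet l₁ l₂ l₃ p) (sSup (DipolarGP.zeroSet l₁ l₂ l₃ p)) :=
      ⟨hmem, fun c hc => le_csSup hb hc⟩
    refine ⟨_, ?_, hgr, hmem.1, fun c hc hlt => ?_, fun c hlt => ?_⟩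
    · exact (EReal.coe_strictMono.monotone.map_isGreatest hgr).isLUB.sSup_eq
    · have hpos : ∀ u ∈ DipolarGP.massSphere c, 0 < DipolarGP.energy l₁ l₂ l₃ p u := fun u hu =>
        DipolarGP.energy_pos_of_lt_mem_zeroSet hp₁ hmem hc hlt hu
      exact ⟨hpos, DipolarGP.not_exists_isMinimizer l₁ l₂ l₃ hp₁ hc hpos⟩
    · have hc : 0 < c := hmem.1.trans hlt
      refine DipolarGP.exists_isMinimizer hl₃ hp₁ hp₂ hc ?_
      by_contra! hn
      exact hlt.not_ge (hgr.2 ((DipolarGP.mem_zeroSet_iff l₁ l₂ l₃ hp₁).2 ⟨hc, hn⟩))
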